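/- Let $\mathbb T^2=\mathbb R^2/\mathbb Z^2$ and $\epsilon\in(0,1)$. Put $\Lambda=(-\Delta)^{1/2}$ on $\mathbb T^2$, and let $G$ be the Green function of $\Lambda^{1+\epsilon}$ on functions of mean zero, i.e. the function with Fourier coefficients $(2\pi|n|)^{-(1+\epsilon)}$ for $n\in\mathbb Z^2\setminus\{0\}$ and $0$ for $n=0$; away from the origin $G$ is smooth. Let $K:\mathbb T^2\to\mathbb R^2$, $K(x)=\nabla^{\perp}G(x)=(-\partial_2G(x),\partial_1G(x))$ for $x\neq0$, and $K(0)=0$. For $N\in\mathbb N$ let $$\Delta_N=\{(x_1,\dots,x_N)\in(\mathbb T^2)^N : x_i=x_j\text{ for some }i\neq j\},$$ and let $Leb_{2N}$ be the normalised Lebesgue (product) measure on $(\mathbb T^2)^N$. For intensities $\xi=(\xi_1,\dots,\xi_N)\in\mathbb R^N$ consider the point vortex system $$\frac{dx_i(t)}{dt}=\frac1{\sqrt N}\sum_{j=1}^N\xi_j\,K\bigl(x_i(t)-x_j(t)\bigr),\qquad i=1,\dots,N. \tag{1}$$ **Theorem.** Let $\epsilon\in(0,1)$, $N\in\mathbb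 N$ and $(\xi_1,\dots,\xi_N)\in\mathbb R^N$. 1. For $Leb_{2N}$-a.e. $X_0\in\Delta_N^c$ there is a unique solution $X_\cdot:[0,\infty)\to\Delta_N^c$ of (1) with initial value $X_0$. 2. Let $X_0$ be a random variable with law $Leb_{2N}$ on a probability space $(\Omega,\mathcal F,P)$. Then there is a process $(X_t)_{t\ge0}$ with values in $(\mathbb T^2)^N$ for which, for $P$-a.e. $\omega$, the path $t\mapsto X_t(\omega)$ is a solution $[0,\infty)\to\Delta_N^c$ of (1) with initial value $X_0(\omega)$. For every such process, each $X_t$ is measurable up to a $P$-null set, $(X_t)_{t\ge0}$ is stationary (for all $t_1,\dots,t_m,h\ge0$ the vectors $(X_{t_1+h},\dots,X_{t_m+h})$ and $(X_{t_1},\dots,X_{t_m})$ have the same law), and $X_t$ has law $Leb_{2N}$ for every $t\ge0$. -/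

import Mathlib

open MeasureTheory ProbabilityTheory Filter Topology
open scoped NNReal

noncomputable section

namespace PointVortex

/-- The torus `𝕋² = ℝ² / ℤ²`; its `volume` is Lebesgue measure, of total mass one. -/
abbrev Torus : Type := UnitAddTorus (Fin 2)

/-- Positions of `N` point vortices; `volume` is the product measure `Leb_{2N}`. -/
abbrev Config (N : ℕ) : Type := Fin N → Torus

/-- The quotient map `ℝ² → 𝕋²`. -/
def proj (y : Fin 2 → ℝ) : Torus := fun k => (y k : UnitAddCircle)

/-- The symbol `2π|n|` of `Λ = (-Δ)^{1/2}` on `𝕋²`: `Λ e_n = 2π|n| e_n`, where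
`e_n(x) = exp(2πi n·x)`. -/
def symbolLam (n : Fin 2 → ℤ) : ℝ :=
  2 * Real.pi * Real.sqrt ((n 0 : ℝ) ^ 2 + (n 1 : ℝ) ^ 2)

/-- The Fourier coefficients of the Green function of `Λ^{1+ε}`: `(2π|n|)^{-(1+ε)}` for `n ≠ 0`,
and `0` for `n = 0` (functions of mean zero). -/
def greenCoeff (ε : ℝ) (n : Fin 2 → ℤ) : ℝ :=
  if n = 0 then 0 else symbolLam n ^ (-(1 + ε))

/-- The Green function `G` of `Λ^{1+ε}` on `𝕋²`, i.e. the function with Fourier coefficients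
`greenCoeff ε`, so that `Λ^{-1-ε} θ = G * θ` for `θ` of mean zero.
The Fourier series `∑ n, (2π|n|)^{-(1+ε)} cos (2π n·x)` does not converge absolutely; it is summed
by inserting the heat factor `exp (-τ (2π|n|)²)` and letting `τ ↓ 0`, which converges for every
`x ≠ 0`. The value at `x = 0`, the singularity, plays no role. -/
def green (ε : ℝ) (x : Torus) : ℝ :=
  limUnder (𝓝[>] (0 : ℝ)) fun τ : ℝ =>
    ∑' n : Fin 2 → ℤ,
      greenCoeff ε n * Real.exp (-τ * symbolLam n ^ 2) * (UnitAddTorus.mFourier n x).re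

/-- The partial derivative `∂_k f (x)` of a function on the torus. -/
def partialDeriv (k : Fin 2) (f : Torus → ℝ) (x : Torus) : ℝ :=
  deriv (fun s : ℝ => f (x + proj (Pi.single k s))) 0

open Classical in
/-- The interaction kernel `K = ∇^⊥ G = (-∂₂ G, ∂₁ G)` off the origin, with `K(0) = 0`: the velocity
field is `u = ∇^⊥ Λ^{-1-ε} θ = K * θ`. -/
def kernelK (ε : ℝ) (x : Torus) : Fin 2 → ℝ :=
  if x = 0 then 0 else ![-partialDeriv 1 (green ε) x, partialDeriv 0 (green ε) x]

/-- The generalised diagonal `Δ_N`: at least two vortices sit at the same place. -/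
def diagonal (N : ℕ) : Set (Config N) := {x | ∃ i j, i ≠ j ∧ x i = x j}

/-- The velocity of the `i`-th vortex, `N^{-1/2} ∑_j ξ_j K(x_i - x_j)`. -/
def velocity {N : ℕ} (ε : ℝ) (ξ : Fin N → ℝ) (x : Config N) (i : Fin N) : Fin 2 → ℝ :=
  (Real.sqrt N)⁻¹ • ∑ j, ξ j • kernelK ε (x i - x j)

/-- `X : [0,∞) → Δ_Nᶜ` is a solution of `dx_i/dt = N^{-1/2} ∑_j ξ_j K(x_i - x_j)` with `X 0 = x₀`.
A curve in the torus is differentiated through a lift `Y` to `(ℝ²)^N`; the derivative at `t = 0` is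
the right one. -/
structure IsVortexSolution {N : ℕ} (ε : ℝ) (ξ : Fin N → ℝ) (x₀ : Config N)
    (X : ℝ≥0 → Config N) : Prop where
  init : X 0 = x₀
  noCollision : ∀ t, X t ∈ (diagonal N)ᶜ
  ode : ∃ Y : ℝ → Fin N → Fin 2 → ℝ,
    (∀ (t : ℝ≥0) (i : Fin N), proj (Y t i) = X t i) ∧
    ∀ (t : ℝ≥0) (i : Fin N),
      HasDerivWithinAt (fun s => Y s i) (velocity ε ξ (X t) i) (Set.Ici 0) (t : ℝ)

/-- The vortex process with random initial condition `X₀`: almost every path is a solution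
`[0,∞) → Δ_Nᶜ` of the vortex system that starts at `X₀ ω`. -/
def IsVortexProcess {N : ℕ} (ε : ℝ) (ξ : Fin N → ℝ) {Ω : Type*} [MeasurableSpace Ω]
    (P : Measure Ω) (X₀ : Ω → Config N) (X : ℝ≥0 → Ω → Config N) : Prop :=
  ∀ᵐ ω ∂P, IsVortexSolution ε ξ (X₀ ω) (fun t => X t ω)

/-- Stationarity: the finite-dimensional distributions are invariant under time shifts
(`IdentDistrib` contains the a.e. measurability of both sides). -/
def IsStationaryProcess {Ω E : Type*} [MeasurableSpace Ω] [MeasurableSpace E]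
    (P : Measure Ω) (X : ℝ≥0 → Ω → E) : Prop :=
  ∀ (m : ℕ) (t : Fin m → ℝ≥0) (h : ℝ≥0),
    IdentDistrib (fun ω (k : Fin m) => X (t k + h) ω) (fun ω (k : Fin m) => X (t k) ω) P P

end PointVortex

end

/-! The kernel is singular only where vortices collide, so everything reduces to showing that almost
no configuration collides in finite time. Since the intensities may have either sign, the conserved
Hamiltonian gives no control of individual distances. A pair energy without intensities, the sum of
`G (x i - x j)` over `i ≠ j`, is used instead. It is not conserved, but its growth is integrable on
average.

Cut `G` off smoothly between the levels `M` and `M + 1`. The truncated kernel is Lipschitz, bounded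
and divergence free, hence has a global flow (`exists_isFlow`), and this flow preserves Lebesgue
measure (`measurePreserving_torusFlow`). Along it the derivative of the pair energy consists of
products of a gradient at `x i - x j` with a kernel at `x i - x l` or `x j - x l`. The dangerous
products, with both factors at the same difference, vanish because a gradient is orthogonal to its
own rotation (`abs_energyDeriv_le`). In the others the two differences are independent and uniform
on the torus, so integrability of `∇G` alone makes them integrable, with a bound not depending on
`M` (`lintegral_energyRate_lt`).

By invariance of the measure, the mean of the growth bound accumulated up to time `T` is a constant
independent of `M`. Fatou's lemma then shows that almost every starting point has arbitrarily large
`M` for which this growth is below `M / 2`. For such a large `M` every pair potential stays below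
`M`, the truncation is never felt, and the truncated orbit solves the original system on `[0, T]`
(`ae_exists_trunc_inactive`). Conversely, compactness shows that every collision-free solution
coincides on `[0, T]` with the truncated orbits for all large `M`. This yields uniqueness, and it
transfers stationarity and the invariant law from the truncated flows.

What is needed of `G` is collected in `IsSingularPotential`. It is proved by Ewald splitting
(`liftGreen_eq`): with `s = (1 + ε) / 2`, write `Γ(s) λ^(-2s)` as the integral of `u^(s-1) exp(-λ²
u)` and cut it at `u = 1`. Large times give a rapidly convergent Fourier series; small times become,
by Poisson summation, a lattice sum of radial functions. Only the term at the nearest lattice point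
is singular: it tends to infinity since `s < 1`, and its gradient is integrable since `s > 1/2`. -/

namespace PointVortex

/-! ### Global flows of bounded Lipschitz vector fields. -/

section Flow

variable {E : Type*} [NormedAddCommGroup E] [NormedSpace ℝ E]

/-- `φ` is a global flow of the autonomous vector field `b`. -/
structure IsFlow (b : E → E) (φ : ℝ → E → E) : Prop where
  zero : ∀ x, φ 0 x = x
  hasDerivAt : ∀ x t, HasDerivAt (fun s => φ s x) (b (φ t x)) t

/-- The speed bound confines a solution to the ball of radius `B * (n + 1)` during `(-(n+1), n+1)`,
so Picard–Lindelöf applies on each such interval. Uniqueness glues the pieces; at time `t` the piece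
`n = ⌈|t|⌉₊` is used, whose open interval contains `t`. -/
theorem exists_isFlow [CompleteSpace E] {b : E → E} {K B : ℝ≥0} (hb : LipschitzWith K b)
    (hB : ∀ x, ‖b x‖ ≤ B) : ∃ φ : ℝ → E → E, IsFlow b φ := by
  have loc : ∀ (x : E) (n : ℕ), ∃ α : ℝ → E, α 0 = x ∧
      ∀ t ∈ Set.Ioo (-(n + 1 : ℝ)) (n + 1), HasDerivAt α (b (α t)) t := by
    intro x n
    have h0 : (0 : ℝ) ∈ Set.Icc (-(n + 1 : ℝ)) (n + 1) := ⟨by linarith [n.cast_nonneg (α := ℝ)],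
      by positivity⟩
    have hpl : IsPicardLindelof (fun _ => b) (tmin := -(n + 1 : ℝ)) (tmax := n + 1) ⟨0, h0⟩ x
        (B * (n + 1)) 0 B K := by
      refine IsPicardLindelof.of_time_independent (fun y _ => hB y) hb.lipschitzOnWith ?_
      simp
    obtain ⟨α, h1, h2⟩ := hpl.exists_eq_forall_mem_Icc_hasDerivWithinAt₀
    exact ⟨α, h1, fun t ht => (h2 t ⟨ht.1.le, ht.2.le⟩).hasDerivAt (Icc_mem_nhds ht.1 ht.2)⟩
  choose α h0 hα using loc
  have agree : ∀ x (n m : ℕ), n ≤ m → ∀ t ∈ Set.Ioo (-(n + 1 : ℝ)) (n + 1), α x m t = α x n t := by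
    intro x n m hnm t ht
    have hn : (0 : ℝ) ≤ n := n.cast_nonneg
    have hnm' : (n : ℝ) ≤ m := by exact_mod_cast hnm
    refine ODE_solution_unique_of_mem_Ioo (v := fun _ => b) (s := fun _ => Set.univ) (K := K)
      (a := -(n + 1 : ℝ)) (b := n + 1) (t₀ := 0) (fun _ _ => hb.lipschitzOnWith)
      ⟨by linarith, by linarith⟩ (fun s hs => ⟨hα x m s ⟨by linarith [hs.1], by linarith [hs.2]⟩,
        trivial⟩) (fun s hs => ⟨hα x n s hs, trivial⟩) (by rw [h0, h0]) ht
  have key : ∀ x (n : ℕ), ∀ t ∈ Set.Ioo (-(n + 1 : ℝ)) (n + 1), α x ⌈|t|⌉₊ t = α x n t := by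
    intro x n t ht
    have hc : |t| ≤ ⌈|t|⌉₊ := Nat.le_ceil _
    rcases le_total n ⌈|t|⌉₊ with h | h
    · exact agree x _ _ h t ht
    · refine (agree x _ _ h t ?_).symm
      have := abs_le.1 hc
      constructor <;> linarith [this.1, this.2]
  refine ⟨fun t x => α x ⌈|t|⌉₊ t, fun x => h0 x _, fun x t => ?_⟩
  have ht : t ∈ Set.Ioo (-((⌈|t|⌉₊ : ℕ) + 1 : ℝ)) (⌈|t|⌉₊ + 1) := by
    have := abs_le.1 (Nat.le_ceil |t|)
    constructor <;> linarith [this.1, this.2]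
  refine (hα x _ t ht).congr_of_eventuallyEq ?_
  filter_upwards [Ioo_mem_nhds ht.1 ht.2] with s hs using key x _ s hs

namespace IsFlow

variable {b : E → E} {φ : ℝ → E → E} {K : ℝ≥0}

theorem continuous_time (h : IsFlow b φ) (x : E) : Continuous fun t => φ t x :=
  continuous_iff_continuousAt.2 fun t => (h.hasDerivAt x t).continuousAt

/-- Vortex paths live on `[0,∞)` and agree with a given truncation only up to a finite time; hence
this one-sided, finite-horizon form of uniqueness. -/
theorem eq_of_hasDerivWithinAt (h : IsFlow b φ) (hb : LipschitzWith K b) {γ : ℝ → E} {T : ℝ}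
    (hγ : ∀ t ∈ Set.Icc 0 T, HasDerivWithinAt γ (b (γ t)) (Set.Ici 0) t) :
    ∀ t ∈ Set.Icc 0 T, γ t = φ t (γ 0) := by
  refine ODE_solution_unique (v := fun _ => b) (fun _ => hb)
    (fun t ht => (hγ t ht).continuousWithinAt.mono Set.Icc_subset_Ici_self)
    (fun t ht => (hγ t ⟨ht.1, ht.2.le⟩).mono (Set.Ici_subset_Ici.2 ht.1))
    (h.continuous_time _).continuousOn
    (fun t _ => (h.hasDerivAt _ t).hasDerivWithinAt) (h.zero _).symm

theorem eq_of_hasDerivAt (h : IsFlow b φ) (hb : LipschitzWith K b) {γ : ℝ → E}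
    (hγ : ∀ t, HasDerivAt γ (b (γ t)) t) (t : ℝ) : γ t = φ t (γ 0) :=
  congrFun (ODE_solution_unique_univ (v := fun _ => b) (s := fun _ => Set.univ) (K := K) (t₀ := 0)
    (fun _ => hb.lipschitzOnWith) (fun t => ⟨hγ t, trivial⟩)
    (fun t => ⟨h.hasDerivAt _ t, trivial⟩) (h.zero _).symm) t

theorem add_apply (h : IsFlow b φ) (hb : LipschitzWith K b) (t s : ℝ) (x : E) :
    φ (t + s) x = φ t (φ s x) := by
  have := h.eq_of_hasDerivAt hb (γ := fun t => φ (t + s) x)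
    (fun t => (h.hasDerivAt x (t + s)).comp_add_const t s) t
  simpa using this

/-- A translate of an orbit by a period is again an orbit. This is what lets the flow descend to the
torus. -/
theorem apply_add (h : IsFlow b φ) (hb : LipschitzWith K b) {m : E} (hm : ∀ x, b (x + m) = b x)
    (t : ℝ) (x : E) : φ t (x + m) = φ t x + m := by
  have := h.eq_of_hasDerivAt hb (γ := fun t => φ t x + m)
    (fun t => by rw [hm]; exact (h.hasDerivAt x t).add_const m) t
  simp only [h.zero] at this
  exact this.symm

theorem neg (h : IsFlow b φ) : IsFlow (fun x => -b x) (fun t => φ (-t)) where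
  zero x := by simpa using h.zero x
  hasDerivAt x t := by
    simpa [Function.comp_def] using (h.hasDerivAt x (-t)).scomp t (hasDerivAt_neg t)

theorem lipschitzWith_of_nonneg (h : IsFlow b φ) (hb : LipschitzWith K b) {t : ℝ} (ht : 0 ≤ t) :
    LipschitzWith (Real.toNNReal (Real.exp (K * t))) (φ t) := by
  refine LipschitzWith.of_dist_le_mul fun x y => ?_
  have := dist_le_of_trajectories_ODE (v := fun _ => b) (fun _ => hb)
    (f := fun s => φ s x) (g := fun s => φ s y) (a := 0) (b := t)
    (h.continuous_time _).continuousOn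
    (fun s _ => (h.hasDerivAt _ s).hasDerivWithinAt) (h.continuous_time _).continuousOn
    (fun s _ => (h.hasDerivAt _ s).hasDerivWithinAt) (δ := dist x y) (by simp [h.zero]) t
    ⟨ht, le_rfl⟩
  rw [Real.coe_toNNReal _ (Real.exp_pos _).le]
  simpa [mul_comm] using this

theorem exists_lipschitzWith (h : IsFlow b φ) (hb : LipschitzWith K b) (t : ℝ) :
    ∃ C : ℝ≥0, LipschitzWith C (φ t) := by
  rcases le_total 0 t with ht | ht
  · exact ⟨_, h.lipschitzWith_of_nonneg hb ht⟩
  · have := h.neg.lipschitzWith_of_nonneg (LipschitzWith.neg hb) (neg_nonneg.2 ht)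
    rw [neg_neg] at this
    exact ⟨_, this⟩

theorem lipschitzWith_time (h : IsFlow b φ) {B : ℝ≥0} (hB : ∀ x, ‖b x‖ ≤ B) (x : E) :
    LipschitzWith B fun t => φ t x :=
  lipschitzWith_of_nnnorm_deriv_le (fun t => (h.hasDerivAt x t).differentiableAt)
    fun t => by rw [(h.hasDerivAt x t).deriv]; exact hB _

end IsFlow

end Flow

end PointVortex

namespace PointVortex

/-! ### Lifting from the torus to Euclidean space and the fundamental cell. -/

section Torus

instance : IsProbabilityMeasure (volume : Measure UnitAddCircle) := ⟨UnitAddCircle.measure_univ⟩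

instance : BorelSpace Torus := inferInstanceAs (BorelSpace (Fin 2 → UnitAddCircle))

instance : SecondCountableTopology Torus :=
  inferInstanceAs (SecondCountableTopology (Fin 2 → UnitAddCircle))

instance (N : ℕ) : BorelSpace (Config N) := inferInstanceAs (BorelSpace (Fin N → Torus))

instance (N : ℕ) : Measure.IsAddHaarMeasure (volume : Measure (Config N)) :=
  Measure.pi.isAddHaarMeasure fun _ => (volume : Measure Torus)

theorem proj_add (y z : Fin 2 → ℝ) : proj (y + z) = proj y + proj z := by
  ext k; simp [proj]

theorem proj_neg (y : Fin 2 → ℝ) : proj (-y) = -proj y := by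
  ext k; simp [proj]

theorem proj_sub (y z : Fin 2 → ℝ) : proj (y - z) = proj y - proj z := by
  ext k; simp [proj]

theorem continuous_proj : Continuous proj :=
  continuous_pi fun k => (AddCircle.continuous_mk' 1).comp (continuous_apply k)

/-- The space of lifted configurations. -/
abbrev Lift (N : ℕ) : Type := Fin N → Fin 2 → ℝ

/-- The quotient map from lifted configurations to configurations. -/
def projN {N : ℕ} (y : Lift N) : Config N := fun i => proj (y i)

theorem projN_add {N : ℕ} (y z : Lift N) : projN (y + z) = projN y + projN z := by
  ext i : 1; exact proj_add _ _

theorem continuous_projN {N : ℕ} : Continuous (projN (N := N)) :=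
  continuous_pi fun i => continuous_proj.comp (continuous_apply i)

/-- The fundamental cell `(-1/2, 1/2]²`. -/
def cell : Set (Fin 2 → ℝ) := Set.univ.pi fun _ => Set.Ioc (-1 / 2) (-1 / 2 + 1)

/-- The fundamental cell of the lifted configurations. -/
def cellN (N : ℕ) : Set (Lift N) := Set.univ.pi fun _ => cell

theorem measurePreserving_proj : MeasurePreserving proj (volume.restrict cell) volume := by
  have := measurePreserving_pi (fun _ : Fin 2 => volume.restrict (Set.Ioc (-1 / 2 : ℝ) (-1 / 2 + 1)))
    (fun _ : Fin 2 => (volume : Measure UnitAddCircle))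
    (fun _ => UnitAddCircle.measurePreserving_mk (-1 / 2))
  rwa [← Measure.restrict_pi_pi] at this

theorem measurePreserving_projN (N : ℕ) :
    MeasurePreserving (projN (N := N)) (volume.restrict (cellN N)) volume := by
  have := measurePreserving_pi (fun _ : Fin N => volume.restrict cell)
    (fun _ : Fin N => (volume : Measure Torus)) (fun _ => measurePreserving_proj)
  rwa [← Measure.restrict_pi_pi] at this

instance (N : ℕ) : IsProbabilityMeasure ((volume : Measure (Lift N)).restrict (cellN N)) :=
  ⟨by rw [← Set.preimage_univ (f := projN),
    (measurePreserving_projN N).measure_preimage MeasurableSet.univ.nullMeasurableSet,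
    measure_univ]⟩

/-- The representative in the fundamental cell of a point of the torus. -/
noncomputable def rep (x : Torus) : Fin 2 → ℝ := fun k => (AddCircle.measurableEquivIoc 1 (-1 / 2) (x k) : ℝ)

noncomputable def repN {N : ℕ} (x : Config N) : Lift N := fun i => rep (x i)

theorem measurable_rep : Measurable rep :=
  measurable_pi_lambda _ fun k => measurable_subtype_coe.comp
    ((AddCircle.measurableEquivIoc 1 (-1 / 2)).measurable.comp (measurable_pi_apply k))

theorem measurable_repN {N : ℕ} : Measurable (repN (N := N)) :=
  measurable_pi_lambda _ fun i => measurable_rep.comp (measurable_pi_apply i)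

theorem proj_rep (x : Torus) : proj (rep x) = x := by
  ext k
  exact (AddCircle.measurableEquivIoc 1 (-1 / 2)).symm_apply_apply (x k)

theorem projN_repN {N : ℕ} (x : Config N) : projN (repN x) = x := by
  ext i : 1; exact proj_rep _

theorem rep_mem_cell (x : Torus) : rep x ∈ cell := fun k _ =>
  (AddCircle.measurableEquivIoc 1 (-1 / 2) (x k)).2

theorem norm_le_of_mem_cell {y : Fin 2 → ℝ} (hy : y ∈ cell) : ‖y‖ ≤ 1 / 2 := by
  refine (pi_norm_le_iff_of_nonneg (by norm_num)).2 fun k => ?_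
  have := hy k trivial
  rw [Real.norm_eq_abs, abs_le]
  constructor <;> linarith [this.1, this.2]

theorem norm_le_of_mem_cellN {N : ℕ} {y : Lift N} (hy : y ∈ cellN N) : ‖y‖ ≤ 1 / 2 :=
  (pi_norm_le_iff_of_nonneg (by norm_num)).2 fun i => norm_le_of_mem_cell (hy i trivial)

theorem measurableSet_cellN (N : ℕ) : MeasurableSet (cellN N) :=
  MeasurableSet.univ_pi fun _ => MeasurableSet.univ_pi fun _ => measurableSet_Ioc

/-- Functions of the lifted configuration which descend to the torus. -/
def IsPeriodic {N : ℕ} {F : Type*} (f : Lift N → F) : Prop :=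
  ∀ y z, projN y = projN z → f y = f z

theorem IsPeriodic.repN_projN {N : ℕ} {F : Type*} {f : Lift N → F} (hf : IsPeriodic f)
    (y : Lift N) : f (repN (projN y)) = f y := hf _ _ (projN_repN _)

/-- Haar measure on the torus is translation invariant, and the cell integral of a periodic function
is a Haar integral. -/
theorem integral_cellN_add {N : ℕ} {f : Lift N → ℝ} (hf : IsPeriodic f) (hm : Measurable f)
    (v : Lift N) : ∫ y in cellN N, f (y + v) = ∫ y in cellN N, f y := by
  have hc : ∀ g : Config N → ℝ, Measurable g →
      ∫ y in cellN N, g (projN y) = ∫ x, g x := fun g hg => by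
    rw [← (measurePreserving_projN N).map_eq, integral_map
      (measurePreserving_projN N).measurable.aemeasurable hg.aestronglyMeasurable]
  have h1 : Measurable fun x : Config N => f (repN x) := hm.comp measurable_repN
  have e1 : ∀ y : Lift N, f (y + v) = f (repN (projN y + projN v)) := fun y => by
    rw [← projN_add, hf.repN_projN]
  have e2 : ∀ y : Lift N, f y = f (repN (projN y)) := fun y => (hf.repN_projN y).symm
  rw [integral_congr_ae (.of_forall e1), integral_congr_ae (.of_forall e2), hc _ h1,
    hc (fun x => f (repN (x + projN v))) (h1.comp (measurable_add_const _))]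
  exact integral_add_right_eq_self (μ := (volume : Measure (Config N))) (fun x => f (repN x)) _

/-- The lattice `ℤ²` inside the lifted configurations. -/
theorem exists_sub_of_projN_eq {N : ℕ} {y z : Lift N} (h : projN y = projN z) :
    ∃ m : Lift N, projN m = 0 ∧ y = z + m := by
  refine ⟨y - z, ?_, by abel⟩
  have : projN (z + (y - z)) = projN z := by rw [← h]; congr 1; abel
  rw [projN_add] at this
  exact left_eq_add.1 this.symm

end Torus

end PointVortex

namespace PointVortex

/-! ### Liouville's theorem with Lipschitz test functions. -/

section Liouville

variable {N : ℕ}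

theorem integrable_cellN {f : Lift N → ℝ} (hf : Continuous f) :
    Integrable f (volume.restrict (cellN N)) :=
  (hf.continuousOn.integrableOn_compact (isCompact_closedBall 0 (1 / 2))).mono_set
    fun _ hy => mem_closedBall_zero_iff.2 (norm_le_of_mem_cellN hy)

theorem IsPeriodic.comp {F F' : Type*} {f : Lift N → F} (hf : IsPeriodic f) (g : F → F') :
    IsPeriodic fun y => g (f y) := fun _ _ h => congrArg g (hf _ _ h)

theorem IsPeriodic.add_right {F : Type*} {f : Lift N → F} (hf : IsPeriodic f) (v : Lift N) :
    IsPeriodic fun y => f (y + v) := fun y z h => hf _ _ (by rw [projN_add, projN_add, h])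

theorem IsPeriodic.mul {f g : Lift N → ℝ} (hf : IsPeriodic f) (hg : IsPeriodic g) :
    IsPeriodic fun y => f y * g y := fun y z h => by simp only [hf y z h, hg y z h]

/-- The coordinate direction of the `k`-th coordinate of the `i`-th point. -/
def coordDir (i : Fin N) (k : Fin 2) : Lift N := Pi.single i (Pi.single k 1)

theorem eq_sum_coordDir (v : Lift N) : v = ∑ i, ∑ k, v i k • coordDir i k := by
  ext j l
  simp [coordDir, Finset.sum_apply, Pi.single_apply, ite_apply, Fin.sum_univ_two]
  fin_cases l <;> simp

theorem fderiv_apply_eq_sum (g : Lift N → ℝ) (y v : Lift N) :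
    fderiv ℝ g y v = ∑ i, ∑ k, v i k * fderiv ℝ g y (coordDir i k) := by
  conv_lhs => rw [eq_sum_coordDir v]
  simp only [map_sum, map_smul, smul_eq_mul]

theorem norm_le_of_lipschitz_of_mem_cellN {g : Lift N → ℝ} {C : ℝ≥0} (hg : LipschitzWith C g)
    {y : Lift N} (hy : y ∈ cellN N) : ‖g y‖ ≤ ‖g 0‖ + C := by
  have h1 := hg.dist_le_mul y 0
  have h2 := norm_le_of_mem_cellN hy
  rw [dist_eq_norm, dist_zero_right] at h1
  have h3 : (C : ℝ) * ‖y‖ ≤ C * 1 := by gcongr; linarith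
  have h4 := norm_sub_norm_le (g y) (g 0)
  linarith

theorem tendsto_slope_smul {f : Lift N → ℝ} {y v : Lift N} {d : ℝ}
    (h : HasDerivAt (fun s : ℝ => f (y + s • v)) d 0) :
    Tendsto (fun s : ℝ => s⁻¹ * (f (y + s • v) - f y)) (𝓝[≠] 0) (𝓝 d) := by
  have := h.tendsto_slope_zero
  simpa using this

/-- Integration by parts on the torus against a Lipschitz function, one coordinate at a time. -/
theorem integral_mul_fderiv_coordDir {b g d : Lift N → ℝ} {K C B : ℝ≥0} (hb : LipschitzWith K b)
    (hB : ∀ y, ‖b y‖ ≤ B) (hbp : IsPeriodic b) (hg : LipschitzWith C g) (hgp : IsPeriodic g)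
    (v : Lift N) (hd : ∀ y, HasDerivAt (fun s : ℝ => b (y + s • v)) (d y) 0) :
    ∫ y in cellN N, b y * fderiv ℝ g y v = -∫ y in cellN N, d y * g y := by
  have hgd : ∀ᵐ y ∂(volume.restrict (cellN N)), DifferentiableAt ℝ g y :=
    ae_restrict_of_ae (hg.ae_differentiableAt (μ := volume))
  have hquot : ∀ {f : Lift N → ℝ} {L : ℝ≥0}, LipschitzWith L f → ∀ (s : ℝ) (y : Lift N),
      ‖s⁻¹ * (f (y + s • v) - f y)‖ ≤ L * ‖v‖ := by
    intro f L hf s y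
    have := hf.dist_le_mul (y + s • v) y
    rw [dist_eq_norm, dist_eq_norm, add_sub_cancel_left, norm_smul] at this
    rw [norm_mul, norm_inv]
    rcases eq_or_ne s 0 with rfl | hs
    · simp; positivity
    · rw [inv_mul_le_iff₀ (norm_pos_iff.2 hs)]
      linarith
  have lim1 : Tendsto (fun s : ℝ => ∫ y in cellN N, b y * (s⁻¹ * (g (y + s • v) - g y))) (𝓝[≠] 0)
      (𝓝 (∫ y in cellN N, b y * fderiv ℝ g y v)) := by
    refine tendsto_integral_filter_of_dominated_convergence (fun _ => B * (C * ‖v‖))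
      (.of_forall fun s => ?_) (.of_forall fun s => .of_forall fun y => ?_) (integrable_const _) ?_
    · have := hb.continuous
      have := hg.continuous
      exact Continuous.aestronglyMeasurable (by fun_prop)
    · rw [norm_mul]
      exact mul_le_mul (hB y) (hquot hg s y) (norm_nonneg _) B.2
    · filter_upwards [hgd] with y hy
      refine (tendsto_slope_smul ?_).const_mul _
      have h1 : HasFDerivAt g (fderiv ℝ g y) (y + (0 : ℝ) • v) := by simpa using hy.hasFDerivAt
      have h2 : HasDerivAt (fun s : ℝ => y + s • v) v 0 := by
        simpa using ((hasDerivAt_id (0 : ℝ)).smul_const v).const_add y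
      exact h1.comp_hasDerivAt 0 h2
  have lim2 : Tendsto (fun s : ℝ => ∫ y in cellN N, (s⁻¹ * (b (y + s • v) - b y)) * g y) (𝓝[≠] 0)
      (𝓝 (∫ y in cellN N, d y * g y)) := by
    refine tendsto_integral_filter_of_dominated_convergence (fun _ => (K * ‖v‖) * (‖g 0‖ + C))
      (.of_forall fun s => ?_) (.of_forall fun s => ?_) (integrable_const _) ?_
    · have := hb.continuous
      have := hg.continuous
      exact Continuous.aestronglyMeasurable (by fun_prop)
    · filter_upwards [ae_restrict_mem (measurableSet_cellN N)] with y hy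
      rw [norm_mul]
      exact mul_le_mul (hquot hb s y) (norm_le_of_lipschitz_of_mem_cellN hg hy) (norm_nonneg _)
        (by positivity)
    · exact .of_forall fun y => (tendsto_slope_smul (hd y)).mul_const _
  have hneg : Tendsto (fun s : ℝ => -s) (𝓝[≠] 0) (𝓝[≠] 0) := by
    refine tendsto_nhdsWithin_iff.2 ⟨?_, ?_⟩
    · simpa using (continuous_neg.tendsto (0 : ℝ)).mono_left nhdsWithin_le_nhds
    · filter_upwards [self_mem_nhdsWithin] with s hs
      simpa using hs
  -- Before passing to the limit there is an exact discrete identity: translating by `s • v` moves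
  -- the difference quotient from `g` with step `s` to `b` with step `-s`.
  refine tendsto_nhds_unique lim1 (((lim2.comp hneg).neg).congr fun s => ?_)
  have hbc := hb.continuous
  have hgc := hg.continuous
  have i1 : ∫ y in cellN N, b y * g (y + s • v) = ∫ y in cellN N, b (y + -s • v) * g y := by
    rw [← integral_cellN_add ((hbp.add_right (-s • v)).mul hgp)
      (Continuous.measurable (by fun_prop)) (s • v)]
    refine integral_congr_ae (.of_forall fun y => ?_)
    simp
  have e1 : ∀ y, b y * (s⁻¹ * (g (y + s • v) - g y))
      = s⁻¹ * (b y * g (y + s • v)) - s⁻¹ * (b y * g y) := fun y => by ring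
  have e2 : ∀ y, (-s)⁻¹ * (b (y + -s • v) - b y) * g y
      = -(s⁻¹ * (b (y + -s • v) * g y) - s⁻¹ * (b y * g y)) := fun y => by rw [inv_neg]; ring
  simp only [Function.comp, e1, e2]
  rw [integral_neg, neg_neg, integral_sub, integral_sub, integral_const_mul, integral_const_mul,
    integral_const_mul, i1]
  all_goals exact integrable_cellN (by fun_prop)

/-- A bounded, Lipschitz, divergence free vector field on the torus, in lifted form. -/
structure IsSolenoidal (b : Lift N → Lift N) (K B : ℝ≥0) : Prop where
  lipschitz : LipschitzWith K b
  bound : ∀ y, ‖b y‖ ≤ B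
  periodic : IsPeriodic b
  div : ∃ d : Fin N → Fin 2 → Lift N → ℝ, Continuous (fun y i k => d i k y) ∧
    (∀ i k y, HasDerivAt (fun s : ℝ => b (y + s • coordDir i k) i k) (d i k y) 0) ∧
    ∀ y, ∑ i, ∑ k, d i k y = 0

/-- Integrating by parts in each coordinate leaves `g` times the divergence. The test function is
merely Lipschitz because it will be composed with a flow known only to be Lipschitz. -/
theorem IsSolenoidal.integral_fderiv {b : Lift N → Lift N} {K B C : ℝ≥0} (hb : IsSolenoidal b K B)
    {g : Lift N → ℝ} (hg : LipschitzWith C g) (hgp : IsPeriodic g) :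
    ∫ y in cellN N, fderiv ℝ g y (b y) = 0 := by
  obtain ⟨d, hdc, hd, hsum⟩ := hb.div
  have hdc' : ∀ i k, Continuous (d i k) := fun i k =>
    (continuous_apply k).comp ((continuous_apply i).comp hdc)
  have hcomp : ∀ i k, LipschitzWith K fun y => b y i k := fun i k =>
    LipschitzWith.of_dist_le_mul fun y z =>
      ((dist_le_pi_dist (b y i) (b z i) k).trans (dist_le_pi_dist (b y) (b z) i)).trans
        (hb.lipschitz.dist_le_mul y z)
  have hbd : ∀ i k y, ‖b y i k‖ ≤ B := fun i k y =>
    ((norm_le_pi_norm (b y i) k).trans (norm_le_pi_norm (b y) i)).trans (hb.bound y)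
  have hmeas : ∀ v, Measurable fun y => fderiv ℝ g y v := fun v => measurable_fderiv_apply_const _ _ v
  have hint : ∀ i k, Integrable (fun y => b y i k * fderiv ℝ g y (coordDir i k))
      (volume.restrict (cellN N)) := fun i k => by
    refine Integrable.mono' (integrable_const (B * (C * ‖coordDir i k‖) : ℝ))
      (((hcomp i k).continuous.measurable.mul (hmeas _)).aestronglyMeasurable)
      (.of_forall fun y => ?_)
    rw [norm_mul]
    refine mul_le_mul (hbd i k y) ?_ (norm_nonneg _) B.2
    exact (ContinuousLinearMap.le_opNorm _ _).trans
      (mul_le_mul_of_nonneg_right (norm_fderiv_le_of_lipschitz ℝ hg) (norm_nonneg _))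
  have hgc := hg.continuous
  calc ∫ y in cellN N, fderiv ℝ g y (b y)
      = ∫ y in cellN N, ∑ i, ∑ k, b y i k * fderiv ℝ g y (coordDir i k) := by
        refine integral_congr_ae (.of_forall fun y => ?_)
        exact fderiv_apply_eq_sum g y (b y)
    _ = ∑ i, ∑ k, ∫ y in cellN N, b y i k * fderiv ℝ g y (coordDir i k) := by
        rw [integral_finsetSum _ fun i _ => integrable_finsetSum _ fun k _ => hint i k]
        exact Finset.sum_congr rfl fun i _ => integral_finsetSum _ fun k _ => hint i k
    _ = ∑ i, ∑ k, -∫ y in cellN N, d i k y * g y := by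
        refine Finset.sum_congr rfl fun i _ => Finset.sum_congr rfl fun k _ => ?_
        exact integral_mul_fderiv_coordDir (hcomp i k) (hbd i k)
          (hb.periodic.comp fun z => z i k) hg hgp _ (hd i k)
    _ = -∫ y in cellN N, ∑ i, ∑ k, d i k y * g y := by
        have h2 : ∀ i k, Integrable (fun y => d i k y * g y) (volume.restrict (cellN N)) :=
          fun i k => integrable_cellN ((hdc' i k).mul hgc)
        rw [integral_finsetSum _ fun i _ => integrable_finsetSum _ fun k _ => h2 i k,
          ← Finset.sum_neg_distrib]
        refine Finset.sum_congr rfl fun i _ => ?_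
        rw [integral_finsetSum _ fun k _ => h2 i k, ← Finset.sum_neg_distrib]
    _ = 0 := by
        have : ∀ y, ∑ i, ∑ k, d i k y * g y = 0 := fun y => by
          simp_rw [← Finset.sum_mul]; rw [hsum, zero_mul]
        simp only [this, integral_zero, neg_zero]

theorem IsFlow.projN_eq {b : Lift N → Lift N} {φ : ℝ → Lift N → Lift N} {K B : ℝ≥0}
    (h : IsFlow b φ) (hb : IsSolenoidal b K B) (t : ℝ) {y z : Lift N} (hyz : projN y = projN z) :
    projN (φ t y) = projN (φ t z) := by
  obtain ⟨m, hm, rfl⟩ := exists_sub_of_projN_eq hyz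
  rw [h.apply_add hb.lipschitz (fun x => hb.periodic _ _ (by rw [projN_add, hm, add_zero])),
    projN_add, hm, add_zero]

/-- By the group law `φ s = φ t ∘ φ (s - t)`, differentiating at time `t` amounts to differentiating
`g = f ∘ φ t` along `b` at time zero. Rademacher's theorem provides the derivative of `g` almost
everywhere, and its integral vanishes by `IsSolenoidal.integral_fderiv`. No derivative of the flow
in space is taken. -/
theorem integral_comp_flow {b : Lift N → Lift N} {φ : ℝ → Lift N → Lift N} {K B C : ℝ≥0}
    (h : IsFlow b φ) (hb : IsSolenoidal b K B) {f : Lift N → ℝ} (hf : LipschitzWith C f)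
    (hfp : IsPeriodic f) (t : ℝ) : ∫ y in cellN N, f (φ t y) = ∫ y in cellN N, f y := by
  have key : ∀ t, HasDerivAt (fun s => ∫ y in cellN N, f (φ s y)) 0 t := by
    intro t
    obtain ⟨L, hL⟩ := h.exists_lipschitzWith hb.lipschitz t
    have hg : LipschitzWith (C * L) fun y => f (φ t y) := hf.comp hL
    have hgp : IsPeriodic fun y => f (φ t y) := fun y z hyz => hfp _ _ (h.projN_eq hb t hyz)
    have hgd : ∀ᵐ y ∂(volume.restrict (cellN N)), DifferentiableAt ℝ (fun y => f (φ t y)) y :=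
      ae_restrict_of_ae (hg.ae_differentiableAt (μ := volume))
    have hc : ∀ s, Continuous (φ s) := fun s => (h.exists_lipschitzWith hb.lipschitz s).choose_spec.continuous
    have hd := (hasDerivAt_integral_of_dominated_loc_of_lip
      (F := fun s y => f (φ t (φ s y))) (F' := fun y => fderiv ℝ (fun y => f (φ t y)) y (b y))
      (x₀ := (0 : ℝ)) (s := Set.univ) (bound := fun _ => (C * L * B : ℝ))
      (μ := volume.restrict (cellN N)) univ_mem
      (.of_forall fun s => (hg.continuous.comp (hc s)).aestronglyMeasurable)
      (integrable_cellN (hg.continuous.comp (hc 0)))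
      ?_ ?_ (integrable_const _) ?_).2
    · rw [hb.integral_fderiv hg hgp] at hd
      have e : (fun s => ∫ y in cellN N, f (φ s y))
          = fun s => ∫ y in cellN N, f (φ t (φ (s - t) y)) := by
        ext s
        refine integral_congr_ae (.of_forall fun y => ?_)
        simp only [← h.add_apply hb.lipschitz, add_sub_cancel]
      rw [e]
      have hd' : HasDerivAt (fun s => ∫ y in cellN N, f (φ t (φ s y))) 0 (t - t) := by
        rwa [sub_self]
      exact hd'.comp_sub_const t t
    · have hbc := hb.lipschitz.continuous
      rw [funext fun y => fderiv_apply_eq_sum (fun y => f (φ t y)) y (b y)]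
      refine (Finset.measurable_fun_sum _ fun i _ => Finset.measurable_fun_sum _ fun k _ =>
        Measurable.mul (Continuous.measurable (by fun_prop))
          (measurable_fderiv_apply_const _ _ _)).aestronglyMeasurable
    · refine .of_forall fun y => ?_
      have := (hg.comp (h.lipschitzWith_time hb.bound y)).lipschitzOnWith (s := Set.univ)
      have e : Real.nnabs (C * L * B : ℝ) = C * L * B := by
        rw [← NNReal.coe_mul, ← NNReal.coe_mul, Real.nnabs_coe]
      rw [e]
      exact this
    · filter_upwards [hgd] with y hy
      have h1 := h.hasDerivAt y 0
      rw [h.zero] at h1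
      have h2 : HasFDerivAt (fun y => f (φ t y)) (fderiv ℝ (fun y => f (φ t y)) y) (φ 0 y) := by
        rw [h.zero]; exact hy.hasFDerivAt
      exact h2.comp_hasDerivAt_of_eq 0 h1 rfl
  have := is_const_of_deriv_eq_zero (fun s => (key s).differentiableAt) (fun s => (key s).deriv) t 0
  simpa [h.zero] using this

/-- The flow on the torus. -/
noncomputable def torusFlow (φ : ℝ → Lift N → Lift N) (t : ℝ) (x : Config N) : Config N :=
  projN (φ t (repN x))

theorem torusFlow_projN {b : Lift N → Lift N} {φ : ℝ → Lift N → Lift N} {K B : ℝ≥0}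
    (h : IsFlow b φ) (hb : IsSolenoidal b K B) (t : ℝ) (y : Lift N) :
    torusFlow φ t (projN y) = projN (φ t y) := h.projN_eq hb t (projN_repN _)

theorem torusFlow_add {b : Lift N → Lift N} {φ : ℝ → Lift N → Lift N} {K B : ℝ≥0}
    (h : IsFlow b φ) (hb : IsSolenoidal b K B) (t s : ℝ) (x : Config N) :
    torusFlow φ (t + s) x = torusFlow φ t (torusFlow φ s x) := by
  conv_rhs => rw [torusFlow.eq_1 φ s, torusFlow_projN h hb, ← h.add_apply hb.lipschitz]
  rfl

theorem measurable_torusFlow {b : Lift N → Lift N} {φ : ℝ → Lift N → Lift N} {K B : ℝ≥0}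
    (h : IsFlow b φ) (hb : IsSolenoidal b K B) (t : ℝ) : Measurable (torusFlow φ t) :=
  (continuous_projN.comp
    (h.exists_lipschitzWith hb.lipschitz t).choose_spec.continuous).measurable.comp measurable_repN

theorem lipschitzWith_proj : LipschitzWith 1 proj := by
  refine LipschitzWith.of_dist_le_mul fun y z => ?_
  rw [NNReal.coe_one, one_mul]
  refine (dist_pi_le_iff dist_nonneg).2 fun k => ?_
  refine le_trans ?_ (dist_le_pi_dist y z k)
  rw [dist_eq_norm, dist_eq_norm]
  simp only [proj]
  rw [← AddCircle.coe_sub]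
  exact QuotientAddGroup.norm_mk_le_norm

theorem lipschitzWith_projN : LipschitzWith 1 (projN (N := N)) := by
  refine LipschitzWith.of_dist_le_mul fun y z => ?_
  rw [NNReal.coe_one, one_mul]
  refine (dist_pi_le_iff dist_nonneg).2 fun i => ?_
  exact (lipschitzWith_proj.dist_le_mul _ _).trans (by simpa using dist_le_pi_dist y z i)

/-- Bounded Lipschitz functions determine weak convergence, so the constant sequence `μ` converges
to `ν`, and weak limits are unique. -/
theorem ext_of_forall_lipschitz_integral_eq {X : Type*} [PseudoMetricSpace X] [MeasurableSpace X]
    [BorelSpace X] {μ ν : Measure X} [IsProbabilityMeasure μ] [IsProbabilityMeasure ν]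
    (h : ∀ (f : X → ℝ) (C : ℝ≥0), LipschitzWith C f → ∫ x, f x ∂μ = ∫ x, f x ∂ν) : μ = ν := by
  let μ' : ProbabilityMeasure X := ⟨μ, inferInstance⟩
  let ν' : ProbabilityMeasure X := ⟨ν, inferInstance⟩
  have : Tendsto (fun _ : ℕ => μ') atTop (𝓝 ν') :=
    tendsto_iff_forall_lipschitz_integral_tendsto.2 fun f _ ⟨C, hf⟩ => by
      change Tendsto (fun _ => ∫ x, f x ∂μ) _ (𝓝 (∫ x, f x ∂ν))
      rw [h f C hf]
      exact tendsto_const_nhds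
  have e : μ' = ν' := tendsto_nhds_unique tendsto_const_nhds this
  exact congrArg Subtype.val e

/-- **Liouville's theorem** on the torus for Lipschitz divergence free vector fields. -/
theorem measurePreserving_torusFlow {b : Lift N → Lift N} {φ : ℝ → Lift N → Lift N} {K B : ℝ≥0}
    (h : IsFlow b φ) (hb : IsSolenoidal b K B) (t : ℝ) :
    MeasurePreserving (torusFlow φ t) (volume : Measure (Config N)) volume := by
  have hm := measurable_torusFlow h hb t
  refine ⟨hm, ?_⟩
  have := Measure.isProbabilityMeasure_map (μ := (volume : Measure (Config N))) hm.aemeasurable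
  refine ext_of_forall_lipschitz_integral_eq fun f C hf => ?_
  have hpm := measurePreserving_projN N
  have hc : ∀ g : Config N → ℝ, Measurable g →
      ∫ x, g x = ∫ y in cellN N, g (projN y) := fun g hg => by
    rw [← hpm.map_eq, integral_map hpm.measurable.aemeasurable hg.aestronglyMeasurable]
  rw [integral_map hm.aemeasurable hf.continuous.aestronglyMeasurable,
    hc (fun x => f (torusFlow φ t x)) (hf.continuous.measurable.comp hm), hc _ hf.continuous.measurable,
    ← integral_comp_flow (f := fun y => f (projN y)) h hb (hf.comp lipschitzWith_projN)
      (fun y z hyz => congrArg f hyz) t]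
  simp only [torusFlow_projN h hb]

end Liouville

end PointVortex

namespace PointVortex

/-! ### The truncation profile. -/

section Cutoff

/-- A smooth function equal to `w` for `w ≤ 0` and equal to `1` for `w ≥ 1`. -/
noncomputable def cutoff (w : ℝ) : ℝ := w + (1 - w) * Real.smoothTransition w

theorem contDiff_cutoff : ContDiff ℝ 2 cutoff :=
  contDiff_id.add ((contDiff_const.sub contDiff_id).mul Real.smoothTransition.contDiff)

theorem cutoff_of_nonpos {w : ℝ} (hw : w ≤ 0) : cutoff w = w := by
  rw [cutoff, Real.smoothTransition.zero_of_nonpos hw]; ring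

theorem cutoff_of_one_le {w : ℝ} (hw : 1 ≤ w) : cutoff w = 1 := by
  rw [cutoff, Real.smoothTransition.one_of_one_le hw]; ring

theorem cutoff_nonneg {w : ℝ} (hw : 0 ≤ w) : 0 ≤ cutoff w := by
  rcases le_total w 1 with h | h
  · have := Real.smoothTransition.nonneg w
    have : 0 ≤ (1 - w) * Real.smoothTransition w := mul_nonneg (by linarith) this
    unfold cutoff; linarith
  · rw [cutoff_of_one_le h]; exact zero_le_one

theorem exists_abs_deriv_cutoff_le : ∃ C : ℝ, 1 ≤ C ∧ ∀ w, |deriv cutoff w| ≤ C := by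
  have hc : Continuous (deriv cutoff) := contDiff_cutoff.continuous_deriv (by norm_num)
  obtain ⟨C, hC⟩ := isCompact_Icc.exists_bound_of_continuousOn
    (s := Set.Icc (0 : ℝ) 1) hc.continuousOn
  refine ⟨max C 1, le_max_right _ _, fun w => ?_⟩
  by_cases h0 : w < 0
  · have : cutoff =ᶠ[𝓝 w] id := by
      filter_upwards [Iio_mem_nhds h0] with v hv using cutoff_of_nonpos (le_of_lt hv)
    rw [this.deriv_eq]; simp
  by_cases h1 : 1 < w
  · have : cutoff =ᶠ[𝓝 w] fun _ => 1 := by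
      filter_upwards [Ioi_mem_nhds h1] with v hv using cutoff_of_one_le (le_of_lt hv)
    rw [this.deriv_eq]; simp
  · exact (hC w ⟨not_lt.1 h0, not_lt.1 h1⟩).trans (le_max_left _ _)

/-- A bound for the derivative of the cutoff. -/
noncomputable def cutoffBound : ℝ := exists_abs_deriv_cutoff_le.choose

theorem one_le_cutoffBound : 1 ≤ cutoffBound := exists_abs_deriv_cutoff_le.choose_spec.1

theorem abs_deriv_cutoff_le (w : ℝ) : |deriv cutoff w| ≤ cutoffBound :=
  exists_abs_deriv_cutoff_le.choose_spec.2 w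

end Cutoff

/-! ### Singular potentials and their smooth truncations. -/

section Potential

/-- An even potential on the torus (in lifted form) which is `C²` off the lattice, tends to infinity
at the lattice and has integrable gradient. -/
structure IsSingularPotential (G : (Fin 2 → ℝ) → ℝ) : Prop where
  periodic : ∀ y z, proj y = proj z → G y = G z
  even : ∀ y, G (-y) = G y
  contDiffAt : ∀ y, proj y ≠ 0 → ContDiffAt ℝ 2 G y
  tendsto : Tendsto G (𝓝[≠] 0) atTop
  lintegral_lt : ∫⁻ y in cell, ‖fderiv ℝ G y‖ₑ < ⊤

open Classical in
/-- The potential truncated smoothly between the levels `M` and `M + 1`. -/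
noncomputable def trunc (G : (Fin 2 → ℝ) → ℝ) (M : ℝ) (y : Fin 2 → ℝ) : ℝ :=
  if proj y = 0 then M + 1 else M + cutoff (G y - M)

open Classical in
/-- The size of the gradient, with value `0` on the lattice. -/
noncomputable def gradSize (G : (Fin 2 → ℝ) → ℝ) (y : Fin 2 → ℝ) : ℝ :=
  if proj y = 0 then 0 else ‖fderiv ℝ G y‖

theorem gradSize_nonneg (G : (Fin 2 → ℝ) → ℝ) (y : Fin 2 → ℝ) : 0 ≤ gradSize G y := by
  unfold gradSize; split_ifs <;> simp

theorem fderiv_eq_of_proj_eq {F : Type*} [NormedAddCommGroup F] [NormedSpace ℝ F]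
    {f : (Fin 2 → ℝ) → F} (hf : ∀ y z, proj y = proj z → f y = f z) {y z : Fin 2 → ℝ}
    (h : proj y = proj z) : fderiv ℝ f y = fderiv ℝ f z := by
  have e : f = fun x => f (x + (y - z)) := funext fun x => hf _ _ (by
    rw [proj_add, proj_sub, h, sub_self, add_zero])
  conv_rhs => rw [e, fderiv_comp_add_right, add_sub_cancel]

theorem exists_norm_le_of_continuous_of_periodic {F : Type*} [NormedAddCommGroup F]
    {f : (Fin 2 → ℝ) → F} (hc : Continuous f) (hf : ∀ y z, proj y = proj z → f y = f z) :
    ∃ C : ℝ≥0, ∀ y, ‖f y‖ ≤ C := by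
  obtain ⟨C, hC⟩ := (isCompact_closedBall (0 : Fin 2 → ℝ) (1 / 2)).exists_bound_of_continuousOn
    hc.continuousOn
  refine ⟨C.toNNReal, fun y => ?_⟩
  rw [hf y (rep (proj y)) (proj_rep _).symm]
  exact (hC _ (mem_closedBall_zero_iff.2 (norm_le_of_mem_cell (rep_mem_cell _)))).trans
    (Real.le_coe_toNNReal _)

theorem isOpen_setOf_proj_ne_zero : IsOpen {y : Fin 2 → ℝ | proj y ≠ 0} :=
  isOpen_ne_fun continuous_proj continuous_const

variable {G : (Fin 2 → ℝ) → ℝ}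

theorem trunc_of_ne (M : ℝ) {y : Fin 2 → ℝ} (hy : proj y ≠ 0) :
    trunc G M y = M + cutoff (G y - M) := if_neg hy

theorem trunc_eventuallyEq_of_ne (M : ℝ) {y : Fin 2 → ℝ} (hy : proj y ≠ 0) :
    trunc G M =ᶠ[𝓝 y] fun z => M + cutoff (G z - M) := by
  filter_upwards [isOpen_setOf_proj_ne_zero.mem_nhds hy] with z hz using trunc_of_ne M hz

namespace IsSingularPotential

theorem trunc_periodic (h : IsSingularPotential G) (M : ℝ) (y z : Fin 2 → ℝ)
    (hyz : proj y = proj z) : trunc G M y = trunc G M z := by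
  unfold trunc; rw [hyz, h.periodic _ _ hyz]

theorem trunc_even (h : IsSingularPotential G) (M : ℝ) (y : Fin 2 → ℝ) :
    trunc G M (-y) = trunc G M y := by
  unfold trunc; simp only [proj_neg, neg_eq_zero, h.even]

/-- Since `G` tends to infinity at the lattice, the truncation is already saturated in a whole
neighbourhood; this is why it is `C²` across the singularity. -/
theorem trunc_eventuallyEq (h : IsSingularPotential G) (M : ℝ) {y : Fin 2 → ℝ} (hy : proj y = 0) :
    trunc G M =ᶠ[𝓝 y] fun _ => M + 1 := by
  have h1 : ∀ᶠ z in 𝓝 (0 : Fin 2 → ℝ), z ≠ 0 → M + 1 ≤ G z :=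
    eventually_nhdsWithin_iff.1 (h.tendsto.eventually_ge_atTop (M + 1))
  have h2 : Tendsto (fun z => z - y) (𝓝 y) (𝓝 0) :=
    (continuous_id.sub continuous_const).tendsto' y 0 (sub_self y)
  filter_upwards [h2.eventually h1] with z hz
  unfold trunc
  split_ifs with hz0
  · rfl
  · have hne : z - y ≠ 0 := fun e => hz0 (by rw [sub_eq_zero.1 e, hy])
    have := hz hne
    rw [h.periodic (z - y) z (by rw [proj_sub, hy, sub_zero])] at this
    rw [cutoff_of_one_le (by linarith)]

theorem contDiff_trunc (h : IsSingularPotential G) (M : ℝ) : ContDiff ℝ 2 (trunc G M) := by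
  refine contDiff_iff_contDiffAt.2 fun y => ?_
  by_cases hy : proj y = 0
  · exact contDiffAt_const.congr_of_eventuallyEq (h.trunc_eventuallyEq M hy)
  · refine ContDiffAt.congr_of_eventuallyEq ?_ (trunc_eventuallyEq_of_ne M hy)
    exact contDiffAt_const.add (contDiff_cutoff.contDiffAt.comp y
      ((h.contDiffAt y hy).sub contDiffAt_const))

theorem differentiableAt (h : IsSingularPotential G) {y : Fin 2 → ℝ} (hy : proj y ≠ 0) :
    DifferentiableAt ℝ G y := (h.contDiffAt y hy).differentiableAt (by norm_num)

/-- Chain rule. The point is that the constant does not depend on `M`. -/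
theorem norm_fderiv_trunc_le (h : IsSingularPotential G) (M : ℝ) (y : Fin 2 → ℝ) :
    ‖fderiv ℝ (trunc G M) y‖ ≤ cutoffBound * gradSize G y := by
  unfold gradSize
  split_ifs with hy
  · rw [(h.trunc_eventuallyEq M hy).fderiv_eq]; simp
  · rw [(trunc_eventuallyEq_of_ne M hy).fderiv_eq]
    have h1 : HasFDerivAt (fun z => G z - M) (fderiv ℝ G y) y :=
      (h.differentiableAt hy).hasFDerivAt.sub_const M
    have h2 : HasDerivAt cutoff (deriv cutoff (G y - M)) (G y - M) :=
      ((contDiff_cutoff.differentiable (by norm_num)) _).hasDerivAt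
    have h3 := (h2.comp_hasFDerivAt y h1).const_add M
    rw [HasFDerivAt.fderiv (f := fun z => M + cutoff (G z - M)) h3, norm_smul]
    exact mul_le_mul_of_nonneg_right (abs_deriv_cutoff_le _) (norm_nonneg _)

theorem trunc_eventuallyEq_self (h : IsSingularPotential G) {M : ℝ} {y : Fin 2 → ℝ}
    (hy : proj y ≠ 0) (hM : G y < M) : trunc G M =ᶠ[𝓝 y] G := by
  filter_upwards [trunc_eventuallyEq_of_ne M hy,
    (h.differentiableAt hy).continuousAt.eventually_lt continuousAt_const hM] with z h1 h2
  rw [h1, cutoff_of_nonpos (by linarith)]; ring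

theorem lt_of_trunc_lt (_h : IsSingularPotential G) {M : ℝ} {y : Fin 2 → ℝ}
    (hM : trunc G M y < M) : proj y ≠ 0 ∧ G y < M := by
  unfold trunc at hM
  split_ifs at hM with hy
  · linarith
  · refine ⟨hy, ?_⟩
    by_contra hG
    have := cutoff_nonneg (w := G y - M) (by linarith)
    linarith

/-- Where `G ≤ 0` all truncations at levels `M ≥ 0` agree with the one at level `0`, which is
bounded; elsewhere they are nonnegative. -/
theorem exists_lower_bound (h : IsSingularPotential G) :
    ∃ c : ℝ, 0 ≤ c ∧ ∀ M, 0 ≤ M → ∀ y, -c ≤ trunc G M y := by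
  obtain ⟨C, hC⟩ := exists_norm_le_of_continuous_of_periodic (h.contDiff_trunc 0).continuous
    (h.trunc_periodic 0)
  refine ⟨C, C.2, fun M hM y => ?_⟩
  have h1 := neg_le_of_abs_le (hC y)
  unfold trunc at h1 ⊢
  split_ifs at h1 ⊢ with hy
  · have := C.2; simp only [NNReal.val_eq_coe] at this; linarith
  · rcases le_total (G y) M with hG | hG
    · rw [cutoff_of_nonpos (by linarith)]
      rcases le_total (G y) 0 with hG0 | hG0
      · rw [cutoff_of_nonpos (by linarith)] at h1; linarith
      · have := C.2; simp only [NNReal.val_eq_coe] at this; linarith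
    · have := cutoff_nonneg (w := G y - M) (by linarith)
      have := C.2; simp only [NNReal.val_eq_coe] at this; linarith

end IsSingularPotential

/-- The direction of the `k`-th coordinate of the plane. -/
def planeDir (k : Fin 2) : Fin 2 → ℝ := Pi.single k 1

/-- The kernel `∇^⊥` of the truncated potential. -/
noncomputable def regKernel (G : (Fin 2 → ℝ) → ℝ) (M : ℝ) (y : Fin 2 → ℝ) : Fin 2 → ℝ :=
  ![-(fderiv ℝ (trunc G M) y (planeDir 1)), fderiv ℝ (trunc G M) y (planeDir 0)]

theorem fderiv_apply_eq (f : (Fin 2 → ℝ) → ℝ) (y v : Fin 2 → ℝ) :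
    fderiv ℝ f y v = v 0 * fderiv ℝ f y (planeDir 0) + v 1 * fderiv ℝ f y (planeDir 1) := by
  have : v = v 0 • planeDir 0 + v 1 • planeDir 1 := by
    ext k; fin_cases k <;> simp [planeDir]
  conv_lhs => rw [this]
  simp only [map_add, map_smul, smul_eq_mul]

theorem norm_planeDir (k : Fin 2) : ‖planeDir k‖ = 1 := by
  rw [planeDir, Pi.norm_single, norm_one]

/-- A gradient is orthogonal to its own rotation. This cancellation removes the products of two
equal singularities from the energy balance. -/
theorem fderiv_trunc_regKernel (M : ℝ) (y : Fin 2 → ℝ) :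
    fderiv ℝ (trunc G M) y (regKernel G M y) = 0 := by
  rw [fderiv_apply_eq]; simp [regKernel]; ring

namespace IsSingularPotential

theorem norm_regKernel_le (h : IsSingularPotential G) (M : ℝ) (y : Fin 2 → ℝ) :
    ‖regKernel G M y‖ ≤ cutoffBound * gradSize G y := by
  refine le_trans ?_ (h.norm_fderiv_trunc_le M y)
  refine (pi_norm_le_iff_of_nonneg (norm_nonneg _)).2 fun k => ?_
  have := fun l => (fderiv ℝ (trunc G M) y).le_opNorm (planeDir l)
  simp only [norm_planeDir, mul_one] at this
  fin_cases k <;> simpa [regKernel] using this _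

theorem contDiff_regKernel (h : IsSingularPotential G) (M : ℝ) : ContDiff ℝ 1 (regKernel G M) := by
  have h1 : ContDiff ℝ 1 (fderiv ℝ (trunc G M)) :=
    (h.contDiff_trunc M).fderiv_right (by norm_num)
  have h2 : ∀ v, ContDiff ℝ 1 fun y => fderiv ℝ (trunc G M) y v := fun v =>
    h1.clm_apply contDiff_const
  refine contDiff_pi.2 fun k => ?_
  fin_cases k
  · exact (h2 _).neg
  · exact h2 _

theorem regKernel_periodic (h : IsSingularPotential G) (M : ℝ) (y z : Fin 2 → ℝ)
    (hyz : proj y = proj z) : regKernel G M y = regKernel G M z := by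
  unfold regKernel; rw [fderiv_eq_of_proj_eq (h.trunc_periodic M) hyz]

theorem regKernel_neg (h : IsSingularPotential G) (M : ℝ) (y : Fin 2 → ℝ) :
    regKernel G M (-y) = -regKernel G M y := by
  have e : fderiv ℝ (trunc G M) (-y) = -fderiv ℝ (trunc G M) y := by
    have h1 : HasFDerivAt (trunc G M) (fderiv ℝ (trunc G M) (-y)) (-y) :=
      ((h.contDiff_trunc M).differentiable (by norm_num) _).hasFDerivAt
    have h2 := h1.comp y (hasFDerivAt_id y).fun_neg
    have h3 : trunc G M ∘ Neg.neg = trunc G M := funext fun z => h.trunc_even M z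
    rw [h3] at h2
    rw [h2.fderiv]
    ext; simp
  unfold regKernel
  rw [e]
  ext k; fin_cases k <;> simp

theorem regKernel_zero (h : IsSingularPotential G) (M : ℝ) : regKernel G M 0 = 0 := by
  have := h.regKernel_neg M 0
  rwa [neg_zero, eq_comm, neg_eq_self] at this

/-- The two mixed second derivatives cancel; this is the reason for truncating the potential rather
than the kernel. -/
theorem regKernel_div (h : IsSingularPotential G) (M : ℝ) (y : Fin 2 → ℝ) :
    ∑ k, fderiv ℝ (fun z => regKernel G M z k) y (planeDir k) = 0 := by
  have hd : DifferentiableAt ℝ (fderiv ℝ (trunc G M)) y :=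
    ((h.contDiff_trunc M).fderiv_right (m := 1) (by norm_num)).differentiable (by norm_num) y
  have h1 : ∀ v w, fderiv ℝ (fun z => fderiv ℝ (trunc G M) z v) y w
      = fderiv ℝ (fderiv ℝ (trunc G M)) y w v := fun v w => by
    rw [fderiv_clm_apply hd (differentiableAt_const _)]; simp
  have hs : IsSymmSndFDerivAt ℝ (trunc G M) y :=
    (h.contDiff_trunc M).contDiffAt.isSymmSndFDerivAt (by simp)
  have e0 : (fun z => regKernel G M z 0) = fun z => -fderiv ℝ (trunc G M) z (planeDir 1) := rfl
  have e1 : (fun z => regKernel G M z 1) = fun z => fderiv ℝ (trunc G M) z (planeDir 0) := rfl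
  rw [Fin.sum_univ_two, e0, e1, fderiv_fun_neg, neg_apply, h1, h1,
    hs.eq (planeDir 0) (planeDir 1), neg_add_cancel]

theorem exists_lipschitzWith_regKernel (h : IsSingularPotential G) (M : ℝ) :
    ∃ K : ℝ≥0, LipschitzWith K (regKernel G M) := by
  obtain ⟨K, hK⟩ := exists_norm_le_of_continuous_of_periodic
    ((h.contDiff_regKernel M).continuous_fderiv (by norm_num))
    (fun y z hyz => fderiv_eq_of_proj_eq (h.regKernel_periodic M) hyz)
  exact ⟨K, lipschitzWith_of_nnnorm_fderiv_le
    ((h.contDiff_regKernel M).differentiable (by norm_num)) fun y => hK y⟩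

end IsSingularPotential

end Potential

/-! ### The truncated vortex field is solenoidal. -/

section Field

variable {N : ℕ}

/-- The velocity field of the point vortices with truncated potential. -/
noncomputable def regField (G : (Fin 2 → ℝ) → ℝ) (ξ : Fin N → ℝ) (M : ℝ) (y : Lift N) : Lift N :=
  fun i => (Real.sqrt N)⁻¹ • ∑ j, ξ j • regKernel G M (y i - y j)

theorem IsSingularPotential.exists_isSolenoidal {G : (Fin 2 → ℝ) → ℝ} (h : IsSingularPotential G)
    (ξ : Fin N → ℝ) (M : ℝ) : ∃ K B : ℝ≥0, IsSolenoidal (regField G ξ M) K B := by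
  obtain ⟨K, hK⟩ := h.exists_lipschitzWith_regKernel M
  obtain ⟨B, hB⟩ := exists_norm_le_of_continuous_of_periodic (h.contDiff_regKernel M).continuous
    (h.regKernel_periodic M)
  set c : ℝ := (Real.sqrt N)⁻¹ with hc
  have hc0 : 0 ≤ c := by positivity
  refine ⟨(c * ∑ j, |ξ j| * (K * 2)).toNNReal, (c * ∑ j, |ξ j| * B).toNNReal, ?_, ?_, ?_, ?_⟩
  · refine LipschitzWith.of_dist_le_mul fun y z => ?_
    rw [Real.coe_toNNReal _ (by positivity)]
    refine (dist_pi_le_iff (by positivity)).2 fun i => ?_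
    simp only [regField]
    rw [dist_eq_norm, ← smul_sub, ← Finset.sum_sub_distrib, norm_smul, Real.norm_of_nonneg hc0,
      mul_assoc, Finset.sum_mul]
    refine mul_le_mul_of_nonneg_left ((norm_sum_le _ _).trans (Finset.sum_le_sum fun j _ => ?_)) hc0
    rw [← smul_sub, norm_smul, Real.norm_eq_abs, mul_assoc]
    refine mul_le_mul_of_nonneg_left ?_ (abs_nonneg _)
    rw [← dist_eq_norm]
    refine (hK.dist_le_mul _ _).trans ?_
    rw [mul_assoc]
    refine mul_le_mul_of_nonneg_left ?_ K.2
    have := dist_sub_sub_le (y i) (y j) (z i) (z j)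
    linarith [dist_le_pi_dist y z i, dist_le_pi_dist y z j]
  · intro y
    rw [Real.coe_toNNReal _ (by positivity)]
    refine (pi_norm_le_iff_of_nonneg (by positivity)).2 fun i => ?_
    simp only [regField]
    rw [norm_smul, Real.norm_of_nonneg hc0]
    refine mul_le_mul_of_nonneg_left ((norm_sum_le _ _).trans (Finset.sum_le_sum fun j _ => ?_)) hc0
    rw [norm_smul, Real.norm_eq_abs]
    exact mul_le_mul_of_nonneg_left (hB _) (abs_nonneg _)
  · intro y z hyz
    ext1 i
    simp only [regField]
    congr 1
    refine Finset.sum_congr rfl fun j _ => ?_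
    rw [h.regKernel_periodic M (y i - y j) (z i - z j)]
    rw [proj_sub, proj_sub]
    exact congrArg₂ (· - ·) (congrFun hyz i) (congrFun hyz j)
  · have hkc : ∀ k, ContDiff ℝ 1 fun z => regKernel G M z k := fun k =>
      contDiff_pi.1 (h.contDiff_regKernel M) k
    -- The self-interaction `j = i` sees the constant argument `y i - y i = 0`, so it contributes
    -- nothing to the derivative in `y i`.
    refine ⟨fun i k y => c * ∑ j, ξ j * (if j = i then 0 else
      fderiv ℝ (fun z => regKernel G M z k) (y i - y j) (planeDir k)), ?_, ?_, ?_⟩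
    · refine continuous_pi fun i => continuous_pi fun k => continuous_const.mul
        (continuous_finsetSum _ fun j _ => continuous_const.mul ?_)
      split_ifs
      · exact continuous_const
      · have h1 := (hkc k).continuous_fderiv (by norm_num)
        exact (h1.comp ((continuous_apply i).sub (continuous_apply j))).clm_apply continuous_const
    · intro i k y
      have e : (fun s : ℝ => regField G ξ M (y + s • coordDir i k) i k) = fun s : ℝ =>
          c * ∑ j, ξ j * regKernel G M ((y + s • coordDir i k) i - (y + s • coordDir i k) j) k := by
        ext s; simp [regField, Finset.sum_apply, hc]
      rw [e]
      refine (HasDerivAt.fun_sum fun j _ => HasDerivAt.const_mul _ ?_).const_mul _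
      split_ifs with hj
      · subst hj
        simpa using hasDerivAt_const (0 : ℝ) (regKernel G M 0 k)
      · have e2 : ∀ s : ℝ, (y + s • coordDir i k) i - (y + s • coordDir i k) j
            = (y i - y j) + s • planeDir k := fun s => by
          simp [coordDir, planeDir, Pi.single_eq_of_ne hj]; abel
        simp only [e2]
        have h1 : HasFDerivAt (fun z => regKernel G M z k)
            (fderiv ℝ (fun z => regKernel G M z k) (y i - y j)) (y i - y j + (0 : ℝ) • planeDir k) := by
          rw [zero_smul, add_zero]
          exact ((hkc k).differentiable (by norm_num) _).hasFDerivAt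
        have h2 : HasDerivAt (fun s : ℝ => y i - y j + s • planeDir k) (planeDir k) 0 := by
          simpa using ((hasDerivAt_id (0 : ℝ)).smul_const (planeDir k)).const_add (y i - y j)
        exact h1.comp_hasDerivAt 0 h2
    · intro y
      refine Finset.sum_eq_zero fun i _ => ?_
      rw [← Finset.mul_sum, Finset.sum_comm]
      refine mul_eq_zero_of_right _ (Finset.sum_eq_zero fun j _ => ?_)
      rw [← Finset.mul_sum]
      refine mul_eq_zero_of_right _ ?_
      split_ifs
      · simp
      · exact h.regKernel_div M _

end Field

end PointVortex

namespace PointVortex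

/-! ### The pair energy and absence of collisions. -/

section Energy

variable {N : ℕ} {G : (Fin 2 → ℝ) → ℝ}

/-- The total truncated pair potential. -/
noncomputable def energy (G : (Fin 2 → ℝ) → ℝ) (M : ℝ) (y : Lift N) : ℝ :=
  ∑ i, ∑ j, if i = j then 0 else trunc G M (y i - y j)

/-- The time derivative of `energy` along a velocity `v`. -/
noncomputable def energyDeriv (G : (Fin 2 → ℝ) → ℝ) (M : ℝ) (y v : Lift N) : ℝ :=
  ∑ i, ∑ j, if i = j then 0 else fderiv ℝ (trunc G M) (y i - y j) (v i - v j)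

/-- A bound for the rate of change of the energy, independent of the truncation. -/
noncomputable def energyRate (G : (Fin 2 → ℝ) → ℝ) (ξ : Fin N → ℝ) (y : Lift N) : ℝ :=
  ∑ i, ∑ j, if i = j then 0 else (Real.sqrt N)⁻¹ * ∑ l, if l = i ∨ l = j then 0 else
    |ξ l| * cutoffBound ^ 2 *
      (gradSize G (y i - y j) * gradSize G (y i - y l) +
        gradSize G (y i - y j) * gradSize G (y j - y l))

theorem energyRate_nonneg (ξ : Fin N → ℝ) (y : Lift N) : 0 ≤ energyRate G ξ y := by
  have h := gradSize_nonneg G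
  refine Finset.sum_nonneg fun i _ => Finset.sum_nonneg fun j _ => ?_
  split_ifs
  · exact le_rfl
  · refine mul_nonneg (by positivity) (Finset.sum_nonneg fun l _ => ?_)
    split_ifs
    · exact le_rfl
    · exact mul_nonneg (by positivity) (add_nonneg (mul_nonneg (h _) (h _)) (mul_nonneg (h _) (h _)))

namespace IsSingularPotential

/-- In the derivative of the pair `(i, j)`, the velocities induced by `l = i` and `l = j` are
multiples of the rotated gradient at `y i - y j` (the kernel is odd and vanishes at `0`), hence drop
out. For other `l`, one factor `cutoffBound` comes from the gradient and one from the kernel. -/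
theorem abs_energyDeriv_le (h : IsSingularPotential G) (ξ : Fin N → ℝ) (M : ℝ) (y : Lift N) :
    |energyDeriv G M y (regField G ξ M y)| ≤ energyRate G ξ y := by
  have hC : 0 ≤ cutoffBound := zero_le_one.trans one_le_cutoffBound
  unfold energyDeriv energyRate
  refine (Finset.abs_sum_le_sum_abs _ _).trans (Finset.sum_le_sum fun i _ => ?_)
  refine (Finset.abs_sum_le_sum_abs _ _).trans (Finset.sum_le_sum fun j _ => ?_)
  split_ifs with hij
  · simp
  · simp only [regField]
    rw [← smul_sub, ← Finset.sum_sub_distrib, map_smul, map_sum, smul_eq_mul, abs_mul,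
      abs_of_nonneg (a := (Real.sqrt N)⁻¹) (by positivity)]
    refine mul_le_mul_of_nonneg_left ?_ (by positivity)
    refine (Finset.abs_sum_le_sum_abs _ _).trans (Finset.sum_le_sum fun l _ => ?_)
    rw [← smul_sub, map_smul, smul_eq_mul, abs_mul]
    split_ifs with hl
    · refine (mul_eq_zero_of_right _ ?_).le
      rw [abs_eq_zero]
      rcases hl with rfl | rfl
      · rw [sub_self, h.regKernel_zero, zero_sub, ← h.regKernel_neg, neg_sub]
        exact fderiv_trunc_regKernel _ _
      · rw [sub_self, h.regKernel_zero, sub_zero]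
        exact fderiv_trunc_regKernel _ _
    · rw [mul_assoc]
      refine mul_le_mul_of_nonneg_left ?_ (abs_nonneg _)
      rw [← Real.norm_eq_abs]
      have h1 := h.norm_fderiv_trunc_le M (y i - y j)
      have h2 := (norm_sub_le (regKernel G M (y i - y l)) (regKernel G M (y j - y l))).trans
        (add_le_add (h.norm_regKernel_le M (y i - y l)) (h.norm_regKernel_le M (y j - y l)))
      refine ((ContinuousLinearMap.le_opNorm _ _).trans (mul_le_mul h1 h2 (norm_nonneg _)
        (mul_nonneg hC (gradSize_nonneg _ _)))).trans (le_of_eq ?_)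
      ring

theorem energy_hasDerivAt (h : IsSingularPotential G) (M : ℝ) {γ : ℝ → Lift N} {v : Lift N}
    {t : ℝ} (hγ : HasDerivAt γ v t) :
    HasDerivAt (fun s => energy G M (γ s)) (energyDeriv G M (γ t) v) t := by
  refine HasDerivAt.fun_sum fun i _ => HasDerivAt.fun_sum fun j _ => ?_
  split_ifs
  · exact hasDerivAt_const _ _
  · have h1 := fun i => hasDerivAt_pi.1 hγ i
    exact ((h.contDiff_trunc M).differentiable (by norm_num) _).hasFDerivAt.comp_hasDerivAt t
      ((h1 i).sub (h1 j))

theorem continuous_energyDeriv (h : IsSingularPotential G) (M : ℝ) {γ v : ℝ → Lift N}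
    (hγ : Continuous γ) (hv : Continuous v) : Continuous fun t => energyDeriv G M (γ t) (v t) := by
  refine continuous_finsetSum _ fun i _ => continuous_finsetSum _ fun j _ => ?_
  split_ifs
  · exact continuous_const
  · have h1 := fun i => (continuous_apply i).comp hγ
    have h2 := fun i => (continuous_apply i).comp hv
    exact (((h.contDiff_trunc M).continuous_fderiv (by norm_num)).comp
      ((h1 i).sub (h1 j))).clm_apply ((h2 i).sub (h2 j))

theorem energy_flow_le (h : IsSingularPotential G) (ξ : Fin N → ℝ) (M : ℝ)
    {φ : ℝ → Lift N → Lift N} (hφ : IsFlow (regField G ξ M) φ) {T t : ℝ} (ht : t ∈ Set.Icc 0 T)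
    (y : Lift N) {w : ℝ} (hw : 0 ≤ w)
    (hT : ∫⁻ s in Set.Icc 0 T, ENNReal.ofReal (energyRate G ξ (φ s y)) < ENNReal.ofReal w) :
    energy G M (φ t y) ≤ energy G M y + w := by
  obtain ⟨K, B, hb⟩ := h.exists_isSolenoidal ξ M
  have hc := hφ.continuous_time y
  have hd : Continuous fun s => energyDeriv G M (φ s y) (regField G ξ M (φ s y)) :=
    h.continuous_energyDeriv M hc (hb.lipschitz.continuous.comp hc)
  have h1 := intervalIntegral.integral_eq_sub_of_hasDerivAt (a := 0) (b := t)
    (fun s _ => h.energy_hasDerivAt M (hφ.hasDerivAt y s)) (hd.intervalIntegrable _ _)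
  rw [intervalIntegral.integral_of_le ht.1, hφ.zero] at h1
  have h2 : ‖∫ s in Set.Ioc 0 t, energyDeriv G M (φ s y) (regField G ξ M (φ s y))‖ₑ
      ≤ ENNReal.ofReal w := by
    refine (enorm_integral_le_lintegral_enorm _).trans ((?_ : _ ≤ _).trans hT.le)
    refine (lintegral_mono fun s => ?_).trans
      (lintegral_mono_set fun s hs => ⟨hs.1.le, hs.2.trans ht.2⟩)
    rw [Real.enorm_eq_ofReal_abs]
    exact ENNReal.ofReal_le_ofReal (h.abs_energyDeriv_le ξ M _)
  rw [h1, Real.enorm_eq_ofReal_abs, ENNReal.ofReal_le_ofReal_iff hw] at h2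
  linarith [le_of_abs_le h2]

/-- Adding `c` to each of the `N ^ 2` summands makes all of them nonnegative, so a single one is at
most the sum. -/
theorem trunc_le_energy (_h : IsSingularPotential G) {M c : ℝ} (hc0 : 0 ≤ c)
    (hc : ∀ y, -c ≤ trunc G M y) (y : Lift N) {i j : Fin N} (hij : i ≠ j) :
    trunc G M (y i - y j) ≤ energy G M y + c * N ^ 2 := by
  have e : energy G M y + c * N ^ 2
      = ∑ i, ∑ j, ((if i = j then 0 else trunc G M (y i - y j)) + c) := by
    simp only [Finset.sum_add_distrib, energy]
    simp; ring
  have h0 : ∀ i j : Fin N, 0 ≤ (if i = j then 0 else trunc G M (y i - y j)) + c := by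
    intro i j
    split_ifs
    · linarith
    · linarith [hc (y i - y j)]
  rw [e]
  have h1 := Finset.single_le_sum (f := fun i => ∑ j, ((if i = j then 0 else
    trunc G M (y i - y j)) + c)) (fun i _ => Finset.sum_nonneg fun j _ => h0 i j) (Finset.mem_univ i)
  have h2 := Finset.single_le_sum (f := fun j => (if i = j then 0 else trunc G M (y i - y j)) + c)
    (fun j _ => h0 i j) (Finset.mem_univ j)
  simp only [if_neg hij] at h2
  linarith

theorem gradSize_periodic (h : IsSingularPotential G) (y z : Fin 2 → ℝ) (hyz : proj y = proj z) :
    gradSize G y = gradSize G z := by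
  unfold gradSize; rw [hyz, fderiv_eq_of_proj_eq h.periodic hyz]

theorem energyRate_periodic (h : IsSingularPotential G) (ξ : Fin N → ℝ) :
    IsPeriodic (energyRate G ξ) := fun y z hyz => by
  have e : ∀ i j, gradSize G (y i - y j) = gradSize G (z i - z j) := fun i j =>
    h.gradSize_periodic _ _ (by
      rw [proj_sub, proj_sub]; exact congrArg₂ (· - ·) (congrFun hyz i) (congrFun hyz j))
  unfold energyRate
  simp only [e]

end IsSingularPotential

theorem measurable_gradSize (G : (Fin 2 → ℝ) → ℝ) : Measurable (gradSize G) :=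
  Measurable.ite (measurableSet_eq_fun continuous_proj.measurable measurable_const)
    measurable_const (measurable_fderiv ℝ G).norm

theorem measurable_energyRate (G : (Fin 2 → ℝ) → ℝ) (ξ : Fin N → ℝ) :
    Measurable (energyRate G ξ) := by
  have e : ∀ i j : Fin N, Measurable fun y : Lift N => gradSize G (y i - y j) := fun i j =>
    (measurable_gradSize G).comp ((measurable_pi_apply i).sub (measurable_pi_apply j))
  refine Finset.measurable_fun_sum _ fun i _ => Finset.measurable_fun_sum _ fun j _ => ?_
  split_ifs
  · exact measurable_const
  · refine (Finset.measurable_fun_sum _ fun l _ => ?_).const_mul _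
    split_ifs
    · exact measurable_const
    · exact (((e _ _).mul (e _ _)).add ((e _ _).mul (e _ _))).const_mul _

/-- The homomorphism sending a configuration to two of its differences. -/
def diffHom (i j k l : Fin N) : Config N →+ Torus × Torus where
  toFun x := (x i - x j, x k - x l)
  map_zero' := by simp
  map_add' x y := by ext : 1 <;> simp <;> abel

/-- A continuous surjective homomorphism of compact groups carries normalised Haar measure to
normalised Haar measure. In probabilistic terms, the two differences are independent and uniform. -/
theorem measurePreserving_diffHom {i j k l : Fin N} (hs : Function.Surjective (diffHom i j k l)) :
    MeasurePreserving (diffHom i j k l) (volume : Measure (Config N)) volume := by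
  have : (volume : Measure (Torus × Torus)).IsAddHaarMeasure :=
    Measure.prod.instIsAddHaarMeasure _ _
  refine AddMonoidHom.measurePreserving ?_ hs (by simp)
  exact ((continuous_apply i).sub (continuous_apply j)).prodMk
    ((continuous_apply k).sub (continuous_apply l))

theorem surjective_diffHom_left {i j l : Fin N} (hij : i ≠ j) (hil : l ≠ i) (hjl : l ≠ j) :
    Function.Surjective (diffHom i j i l) := fun ⟨a, b⟩ => by
  refine ⟨Pi.single j (-a) + Pi.single l (-b), ?_⟩
  simp [diffHom, hij, hjl, hil.symm, hjl.symm]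

theorem surjective_diffHom_right {i j l : Fin N} (hij : i ≠ j) (hil : l ≠ i) (hjl : l ≠ j) :
    Function.Surjective (diffHom i j j l) := fun ⟨a, b⟩ => by
  refine ⟨Pi.single i a + Pi.single l (-b), ?_⟩
  simp [diffHom, hil, hil.symm, hjl.symm, hij.symm]

namespace IsSingularPotential

theorem lintegral_gradSize_lt (h : IsSingularPotential G) :
    ∫⁻ x : Torus, ENNReal.ofReal (gradSize G (rep x)) < ⊤ := by
  have hm : Measurable fun x => ENNReal.ofReal (gradSize G (rep x)) :=
    ((measurable_gradSize G).comp measurable_rep).ennreal_ofReal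
  rw [← measurePreserving_proj.lintegral_comp hm]
  refine (lintegral_mono fun y => ?_).trans_lt h.lintegral_lt
  rw [h.gradSize_periodic _ y (proj_rep _), ← ofReal_norm]
  refine ENNReal.ofReal_le_ofReal ?_
  unfold gradSize
  split_ifs <;> simp

/-- By independence of the differences the integral factorises into two `L¹` norms; square
integrability of the gradient is never needed. -/
theorem lintegral_gradSize_mul_lt (h : IsSingularPotential G) {i j k l : Fin N}
    (hs : Function.Surjective (diffHom i j k l)) :
    ∫⁻ x : Config N, ENNReal.ofReal (gradSize G (repN x i - repN x j) *
      gradSize G (repN x k - repN x l)) < ⊤ := by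
  have hm : Measurable fun x => ENNReal.ofReal (gradSize G (rep x)) :=
    ((measurable_gradSize G).comp measurable_rep).ennreal_ofReal
  have e : ∀ (x : Config N) (i j : Fin N),
      gradSize G (repN x i - repN x j) = gradSize G (rep (x i - x j)) := fun x i j =>
    h.gradSize_periodic _ _ (by rw [proj_sub, proj_rep]; simp only [repN, proj_rep])
  have e2 : ∀ x : Config N, ENNReal.ofReal (gradSize G (repN x i - repN x j) *
      gradSize G (repN x k - repN x l)) = (fun p : Torus × Torus =>
        ENNReal.ofReal (gradSize G (rep p.1)) * ENNReal.ofReal (gradSize G (rep p.2)))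
        (diffHom i j k l x) := fun x => by
    rw [ENNReal.ofReal_mul (gradSize_nonneg _ _), e, e]; rfl
  simp only [e2]
  rw [(measurePreserving_diffHom hs).lintegral_comp (f := fun p : Torus × Torus =>
      ENNReal.ofReal (gradSize G (rep p.1)) * ENNReal.ofReal (gradSize G (rep p.2))) ((hm.comp measurable_fst).mul (hm.comp measurable_snd)), Measure.volume_eq_prod,
    lintegral_prod_mul hm.aemeasurable hm.aemeasurable]
  exact ENNReal.mul_lt_top h.lintegral_gradSize_lt h.lintegral_gradSize_lt

theorem lintegral_energyRate_lt (h : IsSingularPotential G) (ξ : Fin N → ℝ) :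
    ∫⁻ x : Config N, ENNReal.ofReal (energyRate G ξ (repN x)) < ⊤ := by
  have hg := gradSize_nonneg G
  have e : ∀ i j : Fin N, Measurable fun x : Config N => gradSize G (repN x i - repN x j) :=
    fun i j => (measurable_gradSize G).comp
      (((measurable_pi_apply i).comp measurable_repN).sub
        ((measurable_pi_apply j).comp measurable_repN))
  have key : ∀ {i j k l : Fin N}, Function.Surjective (diffHom i j k l) →
      Integrable fun x : Config N => gradSize G (repN x i - repN x j) *
        gradSize G (repN x k - repN x l) := fun hs =>
    ⟨((e _ _).mul (e _ _)).aestronglyMeasurable, (hasFiniteIntegral_iff_ofReal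
      (.of_forall fun x => mul_nonneg (hg _) (hg _))).2 (h.lintegral_gradSize_mul_lt hs)⟩
  have hi : Integrable fun x : Config N => energyRate G ξ (repN x) := by
    refine integrable_finsetSum _ fun i _ => integrable_finsetSum _ fun j _ => ?_
    split_ifs with hij
    · exact integrable_zero _ _ _
    · refine (integrable_finsetSum _ fun l _ => ?_).const_mul _
      split_ifs with hl
      · exact integrable_zero _ _ _
      · rw [not_or] at hl
        exact ((key (surjective_diffHom_left hij hl.1 hl.2)).add
          (key (surjective_diffHom_right hij hl.1 hl.2))).const_mul _
  exact (hasFiniteIntegral_iff_ofReal (.of_forall fun x => energyRate_nonneg ξ _)).1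
    hi.hasFiniteIntegral

theorem measurable_uncurry_flow (h : IsSingularPotential G) (ξ : Fin N → ℝ) (M : ℝ)
    {φ : ℝ → Lift N → Lift N} (hφ : IsFlow (regField G ξ M) φ) :
    Measurable (Function.uncurry φ) := by
  obtain ⟨K, B, hb⟩ := h.exists_isSolenoidal ξ M
  exact measurable_uncurry_of_continuous_of_measurable (fun y => hφ.continuous_time y)
    fun t => (hφ.exists_lipschitzWith hb.lipschitz t).choose_spec.continuous.measurable

/-- Tonelli and Liouville: at each time the rate has its initial mean. The right-hand side no longer
mentions `M`. -/
theorem lintegral_lintegral_energyRate (h : IsSingularPotential G) (ξ : Fin N → ℝ) (M : ℝ)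
    {φ : ℝ → Lift N → Lift N} (hφ : IsFlow (regField G ξ M) φ) (T : ℝ) :
    ∫⁻ x : Config N, ∫⁻ s in Set.Icc 0 T, ENNReal.ofReal (energyRate G ξ (φ s (repN x))) =
      (∫⁻ x : Config N, ENNReal.ofReal (energyRate G ξ (repN x))) * ENNReal.ofReal T := by
  obtain ⟨K, B, hb⟩ := h.exists_isSolenoidal ξ M
  have hm : Measurable fun p : Config N × ℝ =>
      ENNReal.ofReal (energyRate G ξ (φ p.2 (repN p.1))) :=
    ((measurable_energyRate G ξ).comp ((h.measurable_uncurry_flow ξ M hφ).comp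
      (measurable_snd.prodMk (measurable_repN.comp measurable_fst)))).ennreal_ofReal
  rw [lintegral_lintegral_swap hm.aemeasurable]
  have : ∀ s : ℝ, ∫⁻ x : Config N, ENNReal.ofReal (energyRate G ξ (φ s (repN x)))
      = ∫⁻ x : Config N, ENNReal.ofReal (energyRate G ξ (repN x)) := fun s => by
    rw [← (measurePreserving_torusFlow hφ hb s).lintegral_comp
      (f := fun x => ENNReal.ofReal (energyRate G ξ (repN x))) ((measurable_energyRate G ξ).comp measurable_repN).ennreal_ofReal]
    refine lintegral_congr fun x => ?_
    rw [h.energyRate_periodic ξ (repN (torusFlow φ s x)) _ (projN_repN _)]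
  simp only [this, lintegral_const, Measure.restrict_apply MeasurableSet.univ, Set.univ_inter,
    Real.volume_Icc, sub_zero]

/-- The means are a fixed finite `D`, so those of the integrals divided by `M` tend to zero, and
Fatou makes their lower limit vanish almost everywhere. This gives only infinitely many good `M`,
depending on `x`, which suffices. -/
theorem ae_frequently_lintegral_lt (h : IsSingularPotential G) (ξ : Fin N → ℝ)
    {φ : ℕ → ℝ → Lift N → Lift N} (hφ : ∀ M : ℕ, IsFlow (regField G ξ M) (φ M)) (T : ℝ) :
    ∀ᵐ x : Config N, ∃ᶠ M : ℕ in atTop,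
      ∫⁻ s in Set.Icc 0 T, ENNReal.ofReal (energyRate G ξ (φ M s (repN x))) <
        ENNReal.ofReal (M / 2) := by
  have hm : ∀ M : ℕ, Measurable fun x : Config N =>
      ∫⁻ s in Set.Icc 0 T, ENNReal.ofReal (energyRate G ξ (φ M s (repN x))) := fun M => by
    have : Measurable fun p : Config N × ℝ =>
        ENNReal.ofReal (energyRate G ξ (φ M p.2 (repN p.1))) :=
      ((measurable_energyRate G ξ).comp ((h.measurable_uncurry_flow ξ M (hφ M)).comp
        (measurable_snd.prodMk (measurable_repN.comp measurable_fst)))).ennreal_ofReal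
    exact this.lintegral_prod_right'
  set D := (∫⁻ x : Config N, ENNReal.ofReal (energyRate G ξ (repN x))) * ENNReal.ofReal T with hD
  have hDt : D ≠ ⊤ := (ENNReal.mul_lt_top (h.lintegral_energyRate_lt ξ) ENNReal.ofReal_lt_top).ne
  have hlim : ∫⁻ x : Config N, liminf (fun M : ℕ => (M : ENNReal)⁻¹ *
      ∫⁻ s in Set.Icc 0 T, ENNReal.ofReal (energyRate G ξ (φ M s (repN x)))) atTop = 0 := by
    refine le_antisymm ((lintegral_liminf_le fun M => (hm M).const_mul _).trans ?_) bot_le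
    have e : ∀ M : ℕ, ∫⁻ x : Config N, (M : ENNReal)⁻¹ *
        ∫⁻ s in Set.Icc 0 T, ENNReal.ofReal (energyRate G ξ (φ M s (repN x)))
        = (M : ENNReal)⁻¹ * D := fun M => by
      rw [lintegral_const_mul _ (hm M), h.lintegral_lintegral_energyRate ξ M (hφ M)]
    simp only [e]
    have : Tendsto (fun M : ℕ => (M : ENNReal)⁻¹ * D) atTop (𝓝 (0 * D)) :=
      ENNReal.Tendsto.mul_const ENNReal.tendsto_inv_nat_nhds_zero (Or.inr hDt)
    rw [zero_mul] at this
    exact this.liminf_eq.le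
  rw [lintegral_eq_zero_iff (Measurable.liminf fun M => (hm M).const_mul _)] at hlim
  filter_upwards [hlim] with x hx
  have hx' : liminf (fun M : ℕ => (M : ENNReal)⁻¹ *
      ∫⁻ s in Set.Icc 0 T, ENNReal.ofReal (energyRate G ξ (φ M s (repN x)))) atTop < 1 / 2 := by
    rw [hx]; simp
  refine ((frequently_lt_of_liminf_lt (by isBoundedDefault) hx').and_eventually
    (eventually_gt_atTop 0)).mono fun M hM => ?_
  obtain ⟨h1, h2⟩ := hM
  have h3 : (M : ENNReal) ≠ 0 := by exact_mod_cast h2.ne'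
  refine not_le.1 fun hle => h1.not_ge ?_
  refine le_trans (le_of_eq ?_) (mul_le_mul_right hle _)
  rw [ENNReal.ofReal_div_of_pos two_pos, ENNReal.ofReal_natCast, ENNReal.div_eq_inv_mul,
    ENNReal.div_eq_inv_mul, mul_left_comm, ENNReal.inv_mul_cancel h3 (ENNReal.natCast_ne_top M)]
  simp

theorem eventually_energy_eq (h : IsSingularPotential G) {y : Lift N}
    (hy : projN y ∈ (diagonal N)ᶜ) :
    ∀ᶠ M : ℕ in atTop, energy G M y = ∑ i, ∑ j, if i = j then 0 else G (y i - y j) := by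
  have h1 : ∀ i j : Fin N, ∀ᶠ M : ℕ in atTop, G (y i - y j) < M := fun i j =>
    tendsto_natCast_atTop_atTop.eventually_gt_atTop _
  filter_upwards [eventually_all.2 fun i => eventually_all.2 (h1 i)] with M hM
  refine Finset.sum_congr rfl fun i _ => Finset.sum_congr rfl fun j _ => ?_
  split_ifs with hij
  · rfl
  · refine (h.trunc_eventuallyEq_self ?_ (hM i j)).eq_of_nhds
    rw [proj_sub]
    exact fun e => hy ⟨i, j, hij, sub_eq_zero.1 e⟩

/-- The truncated dynamics avoids the levels where the potential is truncated. -/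
theorem ae_exists_trunc_inactive (h : IsSingularPotential G) (ξ : Fin N → ℝ)
    {φ : ℕ → ℝ → Lift N → Lift N} (hφ : ∀ M : ℕ, IsFlow (regField G ξ M) (φ M)) (T : ℝ) :
    ∀ᵐ x : Config N, x ∈ (diagonal N)ᶜ → ∃ M : ℕ, ∀ t ∈ Set.Icc 0 T, ∀ i j, i ≠ j →
      proj (φ M t (repN x) i - φ M t (repN x) j) ≠ 0 ∧
        G (φ M t (repN x) i - φ M t (repN x) j) < M := by
  obtain ⟨c, hc0, hc⟩ := h.exists_lower_bound
  filter_upwards [h.ae_frequently_lintegral_lt ξ hφ T] with x hx hxd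
  have hy : projN (repN x) ∈ (diagonal N)ᶜ := by rwa [projN_repN]
  set E := ∑ i, ∑ j, if i = j then 0 else G (repN x i - repN x j) with hE
  have hev : ∀ᶠ M : ℕ in atTop, E + c * N ^ 2 < M / 2 :=
    (tendsto_natCast_atTop_atTop.atTop_div_const two_pos).eventually_gt_atTop _
  -- The budget is `M`: less than `M / 2` for the initial energy and the lower-bound correction, at
  -- most `M / 2` for the growth along the flow.
  obtain ⟨M, hM1, hM2, hM3⟩ := (hx.and_eventually ((h.eventually_energy_eq hy).and hev)).exists
  refine ⟨M, fun t ht i j hij => h.lt_of_trunc_lt ?_⟩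
  have h1 := h.trunc_le_energy hc0 (hc M M.cast_nonneg) (φ M t (repN x)) hij
  have h2 := h.energy_flow_le ξ M (hφ M) ht (repN x) (by positivity) hM1
  rw [hM2] at h2
  linarith

end IsSingularPotential

end Energy

end PointVortex

namespace PointVortex

/-! ### From truncated orbits to vortex solutions and back. -/

section Dynamics

variable {N : ℕ} {ε : ℝ}

/-- The lifted Green function. -/
noncomputable def liftGreen (ε : ℝ) (y : Fin 2 → ℝ) : ℝ := green ε (proj y)

/-- All pairs of points are off the lattice and at potential level below `M`. -/
def IsInactive (ε : ℝ) (M : ℝ) (y : Lift N) : Prop :=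
  ∀ i j, i ≠ j → proj (y i - y j) ≠ 0 ∧ liftGreen ε (y i - y j) < M

theorem IsInactive.mono {M M' : ℝ} {y : Lift N} (hy : IsInactive ε M y) (h : M ≤ M') :
    IsInactive ε M' y := fun i j hij => ⟨(hy i j hij).1, (hy i j hij).2.trans_le h⟩

theorem partialDeriv_green (h : IsSingularPotential (liftGreen ε)) {y : Fin 2 → ℝ}
    (hy : proj y ≠ 0) (k : Fin 2) :
    partialDeriv k (green ε) (proj y) = fderiv ℝ (liftGreen ε) y (planeDir k) := by
  have e : (fun s : ℝ => green ε (proj y + proj (Pi.single k s)))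
      = fun s : ℝ => liftGreen ε (y + s • planeDir k) := by
    ext s
    rw [liftGreen, proj_add, planeDir, ← Pi.single_smul, smul_eq_mul, mul_one]
  rw [partialDeriv, e]
  have h1 : HasFDerivAt (liftGreen ε) (fderiv ℝ (liftGreen ε) y) (y + (0 : ℝ) • planeDir k) := by
    rw [zero_smul, add_zero]; exact (h.differentiableAt hy).hasFDerivAt
  have h2 : HasDerivAt (fun s : ℝ => y + s • planeDir k) (planeDir k) 0 := by
    simpa using ((hasDerivAt_id (0 : ℝ)).smul_const (planeDir k)).const_add y
  exact (h1.comp_hasDerivAt 0 h2).deriv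

theorem kernelK_proj (h : IsSingularPotential (liftGreen ε)) {M : ℝ} {y : Fin 2 → ℝ}
    (hy : proj y ≠ 0) (hM : liftGreen ε y < M) :
    kernelK ε (proj y) = regKernel (liftGreen ε) M y := by
  rw [kernelK, if_neg hy, regKernel, (h.trunc_eventuallyEq_self hy hM).fderiv_eq,
    partialDeriv_green h hy, partialDeriv_green h hy]

theorem velocity_projN (h : IsSingularPotential (liftGreen ε)) (ξ : Fin N → ℝ) {M : ℝ}
    {y : Lift N} (hy : IsInactive ε M y) (i : Fin N) :
    velocity ε ξ (projN y) i = regField (liftGreen ε) ξ M y i := by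
  rw [velocity, regField]
  congr 1
  refine Finset.sum_congr rfl fun j _ => ?_
  congr 1
  rcases eq_or_ne i j with rfl | hij
  · rw [sub_self, sub_self, h.regKernel_zero, kernelK, if_pos rfl]
  · rw [← kernelK_proj h (hy i j hij).1 (hy i j hij).2, proj_sub]; rfl

theorem projN_notMem_diagonal {M : ℝ} {y : Lift N} (hy : IsInactive ε M y) :
    projN y ∈ (diagonal N)ᶜ := fun ⟨i, j, hij, e⟩ =>
  (hy i j hij).1 (by rw [proj_sub]; exact sub_eq_zero.2 e)

/-- Below level `M` both truncated fields are the true velocity, so an orbit of one is an orbit of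
the other. -/
theorem IsInactive.flow_eq (h : IsSingularPotential (liftGreen ε)) {ξ : Fin N → ℝ}
    {M M' T : ℝ} {φ φ' : ℝ → Lift N → Lift N} (hφ : IsFlow (regField (liftGreen ε) ξ M) φ)
    (hφ' : IsFlow (regField (liftGreen ε) ξ M') φ') (hM : M ≤ M') {y : Lift N}
    (hy : ∀ t ∈ Set.Icc 0 T, IsInactive ε M (φ t y)) : ∀ t ∈ Set.Icc 0 T, φ t y = φ' t y := by
  obtain ⟨K, B, hb⟩ := h.exists_isSolenoidal ξ M'
  have := hφ'.eq_of_hasDerivWithinAt hb.lipschitz (γ := fun t => φ t y) (T := T) fun t ht => by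
    have e : regField (liftGreen ε) ξ M' (φ t y) = regField (liftGreen ε) ξ M (φ t y) := by
      ext1 i
      rw [← velocity_projN h ξ (hy t ht), ← velocity_projN h ξ ((hy t ht).mono hM)]
    rw [e]
    exact (hφ.hasDerivAt y t).hasDerivWithinAt
  simpa only [hφ.zero] using this

/-- On bounded time intervals, every vortex solution is an orbit of the truncated dynamics. -/
theorem IsVortexSolution.eventually_eq_torusFlow (h : IsSingularPotential (liftGreen ε))
    {ξ : Fin N → ℝ} {φ : ℕ → ℝ → Lift N → Lift N}
    (hφ : ∀ M : ℕ, IsFlow (regField (liftGreen ε) ξ M) (φ M)) {x₀ : Config N}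
    {X : ℝ≥0 → Config N} (hX : IsVortexSolution ε ξ x₀ X) (T : ℝ≥0) :
    ∀ᶠ M : ℕ in atTop, ∀ t ≤ T, X t = torusFlow (φ M) t x₀ := by
  obtain ⟨Y, hY, hode⟩ := hX.ode
  have hYX : ∀ t : ℝ≥0, projN (Y t) = X t := fun t => funext fun i => hY t i
  have hpr : ∀ t : ℝ≥0, ∀ i j, i ≠ j → proj (Y t i - Y t j) ≠ 0 := fun t i j hij e => by
    rw [proj_sub, hY, hY] at e
    exact hX.noCollision t ⟨i, j, hij, sub_eq_zero.1 e⟩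
  -- Along a collision-free path the pair potentials are continuous in time, hence bounded on `[0,
  -- T]`; any `M` above the bounds is never reached.
  have hcont : ∀ i j, i ≠ j →
      ContinuousOn (fun t : ℝ => liftGreen ε (Y t i - Y t j)) (Set.Icc 0 (T : ℝ)) := by
    intro i j hij t ht
    have h1 := fun i => ((hode ⟨t, ht.1⟩ i).continuousWithinAt).mono
      (fun _ hs => hs.1 : Set.Icc 0 (T : ℝ) ⊆ Set.Ici 0)
    exact ContinuousAt.comp_continuousWithinAt (g := liftGreen ε) (f := fun s => Y s i - Y s j)
      (h.differentiableAt (hpr ⟨t, ht.1⟩ i j hij)).continuousAt ((h1 i).sub (h1 j))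
  have hbdd : ∀ i j, ∀ᶠ M : ℕ in atTop, i ≠ j →
      ∀ t ∈ Set.Icc 0 (T : ℝ), liftGreen ε (Y t i - Y t j) < M := by
    intro i j
    by_cases hij : i = j
    · exact .of_forall fun M hne => absurd hij hne
    · obtain ⟨C, hC⟩ := isCompact_Icc.exists_bound_of_continuousOn (hcont i j hij)
      filter_upwards [tendsto_natCast_atTop_atTop.eventually_gt_atTop C] with M hM _ t ht
      exact (le_of_abs_le (hC t ht)).trans_lt hM
  filter_upwards [eventually_all.2 fun i => eventually_all.2 (hbdd i)] with M hM
  obtain ⟨K, B, hb⟩ := h.exists_isSolenoidal ξ (M : ℝ)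
  have hin : ∀ t ∈ Set.Icc 0 (T : ℝ), IsInactive ε M (Y t) := fun t ht i j hij =>
    ⟨hpr ⟨t, ht.1⟩ i j hij, hM i j hij t ht⟩
  have key := (hφ M).eq_of_hasDerivWithinAt hb.lipschitz (γ := Y) (T := T) fun t ht => by
    refine hasDerivWithinAt_pi.2 fun i => ?_
    rw [← velocity_projN h ξ (hin t ht)]
    have e : projN (Y t) = X ⟨t, ht.1⟩ := hYX ⟨t, ht.1⟩
    rw [e]
    exact hode ⟨t, ht.1⟩ i
  intro t ht
  have e0 : projN (Y 0) = x₀ := by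
    have := hYX 0
    rwa [hX.init] at this
  rw [← hYX, key t ⟨t.2, ht⟩, ← torusFlow_projN (hφ M) hb, e0]

theorem IsVortexSolution.unique (h : IsSingularPotential (liftGreen ε)) {ξ : Fin N → ℝ}
    {x₀ : Config N} {X X' : ℝ≥0 → Config N} (hX : IsVortexSolution ε ξ x₀ X)
    (hX' : IsVortexSolution ε ξ x₀ X') : X = X' := by
  have : ∀ M : ℕ, ∃ φ : ℝ → Lift N → Lift N, IsFlow (regField (liftGreen ε) ξ M) φ := fun M => by
    obtain ⟨K, B, hb⟩ := h.exists_isSolenoidal ξ M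
    exact exists_isFlow hb.lipschitz hb.bound
  choose φ hφ using this
  ext1 t
  obtain ⟨M, h1, h2⟩ := ((hX.eventually_eq_torusFlow h hφ t).and
    (hX'.eventually_eq_torusFlow h hφ t)).exists
  rw [h1 t le_rfl, h2 t le_rfl]

theorem exists_isVortexSolution (h : IsSingularPotential (liftGreen ε)) {ξ : Fin N → ℝ}
    {φ : ℕ → ℝ → Lift N → Lift N}
    (hφ : ∀ M : ℕ, IsFlow (regField (liftGreen ε) ξ M) (φ M)) (y : Lift N)
    (hy : ∀ n : ℕ, ∃ M : ℕ, ∀ t ∈ Set.Icc 0 (n : ℝ), IsInactive ε M (φ M t y)) :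
    ∃ X : ℝ≥0 → Config N, IsVortexSolution ε ξ (projN y) X := by
  choose M hM using hy
  have agree : ∀ n m : ℕ, ∀ t : ℝ, 0 ≤ t → t ≤ n → t ≤ m → φ (M n) t y = φ (M m) t y := by
    intro n m t h0 hn hm
    have e1 := IsInactive.flow_eq h (hφ (M n)) (hφ (max (M n) (M m)))
      (by exact_mod_cast le_max_left _ _) (hM n) t ⟨h0, hn⟩
    have e2 := IsInactive.flow_eq h (hφ (M m)) (hφ (max (M n) (M m)))
      (by exact_mod_cast le_max_right _ _) (hM m) t ⟨h0, hm⟩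
    rw [e1, e2]
  -- The horizon `⌊t⌋₊ + 1` lies strictly beyond `t`, so one truncated flow describes `Y` at all
  -- nonnegative times near `t`, and the derivative can be read off from it.
  let Y : ℝ → Lift N := fun t => φ (M (⌊t⌋₊ + 1)) t y
  have hfl : ∀ t : ℝ, t ≤ ((⌊t⌋₊ + 1 : ℕ) : ℝ) := fun t => by
    push_cast; exact (Nat.lt_floor_add_one t).le
  have hYi : ∀ t : ℝ, 0 ≤ t → IsInactive ε (M (⌊t⌋₊ + 1)) (Y t) := fun t ht =>
    hM _ t ⟨ht, hfl t⟩
  refine ⟨fun t => projN (Y t), ?_, fun t => projN_notMem_diagonal (hYi t t.2), Y,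
    fun t i => rfl, fun t i => ?_⟩
  · simp only [Y, NNReal.coe_zero, (hφ _).zero]
  · rw [velocity_projN h ξ (hYi t t.2)]
    have h1 := (hasDerivAt_pi.1 ((hφ (M (⌊(t : ℝ)⌋₊ + 1))).hasDerivAt y t) i).hasDerivWithinAt
      (s := Set.Ici 0)
    refine h1.congr_of_eventuallyEq ?_ rfl
    have hlt : (t : ℝ) < ((⌊(t : ℝ)⌋₊ + 1 : ℕ) : ℝ) := by
      push_cast; exact Nat.lt_floor_add_one _
    filter_upwards [self_mem_nhdsWithin, mem_nhdsWithin_of_mem_nhds (Iio_mem_nhds hlt)] with s hs hs'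
    exact congrFun (agree _ _ s hs (hfl s) (le_of_lt hs')) i

/-- The difference of first coordinates of two distinct vortices is uniform on the circle, where
points are null. -/
theorem ae_notMem_diagonal (N : ℕ) : ∀ᵐ x : Config N, x ∈ (diagonal N)ᶜ := by
  have key : ∀ i j : Fin N, ∀ᵐ x : Config N, i ≠ j → x i ≠ x j := by
    intro i j
    by_cases hij : i = j
    · exact .of_forall fun x hne => absurd hij hne
    let f : Config N →+ UnitAddCircle :=
      { toFun := fun x => x i 0 - x j 0
        map_zero' := by simp
        map_add' := fun x y => by simp; abel }
    have hf : MeasurePreserving f (volume : Measure (Config N)) volume := by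
      refine AddMonoidHom.measurePreserving ?_ (fun a => ⟨Pi.single i fun _ => a, ?_⟩) (by simp)
      · change Continuous fun x : Config N => x i 0 - x j 0
        fun_prop
      · simp [f, Pi.single_eq_of_ne (Ne.symm hij)]
    have h0 : volume ({0} : Set UnitAddCircle) = 0 := by
      have := AddCircle.volume_closedBall (T := 1) (x := 0) 0
      simpa using this
    have h1 : ∀ᵐ x : Config N, f x ≠ 0 :=
      hf.quasiMeasurePreserving.ae (measure_eq_zero_iff_ae_notMem.1 h0)
    filter_upwards [h1] with x hx _ e
    exact hx (by simp [f, e])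
  filter_upwards [ae_all_iff.2 fun i => ae_all_iff.2 (key i)] with x hx
  exact fun ⟨i, j, hij, e⟩ => hx i j hij e

theorem ae_existsUnique_isVortexSolution (h : IsSingularPotential (liftGreen ε)) (ξ : Fin N → ℝ) :
    ∀ᵐ x₀ : Config N, ∃! X : ℝ≥0 → Config N, IsVortexSolution ε ξ x₀ X := by
  have : ∀ M : ℕ, ∃ φ : ℝ → Lift N → Lift N, IsFlow (regField (liftGreen ε) ξ M) φ := fun M => by
    obtain ⟨K, B, hb⟩ := h.exists_isSolenoidal ξ M
    exact exists_isFlow hb.lipschitz hb.bound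
  choose φ hφ using this
  filter_upwards [ae_all_iff.2 fun n : ℕ => h.ae_exists_trunc_inactive ξ hφ n,
    ae_notMem_diagonal N] with x hx hd
  obtain ⟨X, hX⟩ := exists_isVortexSolution h hφ (repN x) fun n => hx n hd
  rw [projN_repN] at hX
  exact ⟨X, hX, fun X' hX' => hX'.unique h hX⟩

end Dynamics

/-! ### Stationarity and the invariant law. -/

section VortexProcess

/-- The approximations become exact from an index depending on `ω`, so integrals of bounded
continuous functions converge by dominated convergence. Measurability of the limits is a conclusion,
as vortex processes are not assumed measurable. -/
theorem identDistrib_of_eventually_eq {Ω F : Type*} [MeasurableSpace Ω] {P : Measure Ω}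
    [IsProbabilityMeasure P] [MeasurableSpace F] [TopologicalSpace F]
    [TopologicalSpace.PseudoMetrizableSpace F] [BorelSpace F] {V U : Ω → F} {V' U' : ℕ → Ω → F}
    (hV : ∀ᵐ ω ∂P, ∀ᶠ n in atTop, V ω = V' n ω) (hU : ∀ᵐ ω ∂P, ∀ᶠ n in atTop, U ω = U' n ω)
    (hVU : ∀ n, IdentDistrib (V' n) (U' n) P P) : IdentDistrib V U P P := by
  have lim : ∀ {V : Ω → F} {V' : ℕ → Ω → F}, (∀ᵐ ω ∂P, ∀ᶠ n in atTop, V ω = V' n ω) →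
      (∀ n, AEMeasurable (V' n) P) → AEMeasurable V P ∧ ∀ f : BoundedContinuousFunction F ℝ,
        Tendsto (fun n => ∫ ω, f (V' n ω) ∂P) atTop (𝓝 (∫ ω, f (V ω) ∂P)) := by
    intro V V' hV hm
    refine ⟨aemeasurable_of_tendsto_metrizable_ae atTop hm ?_, fun f => ?_⟩
    · filter_upwards [hV] with ω hω
      exact tendsto_const_nhds.congr' hω
    · refine tendsto_integral_of_dominated_convergence (fun _ => ‖f‖)
        (fun n => (f.continuous.measurable.comp_aemeasurable (hm n)).aestronglyMeasurable)
        (integrable_const _) (fun n => .of_forall fun ω => f.norm_coe_le_norm _) ?_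
      filter_upwards [hV] with ω hω
      exact tendsto_const_nhds.congr' (hω.mono fun n hn => by rw [hn])
  obtain ⟨hVm, hVl⟩ := lim hV fun n => (hVU n).aemeasurable_fst
  obtain ⟨hUm, hUl⟩ := lim hU fun n => (hVU n).aemeasurable_snd
  refine ⟨hVm, hUm, ?_⟩
  have := Measure.isProbabilityMeasure_map hVm
  have := Measure.isProbabilityMeasure_map hUm
  refine ext_of_forall_integral_eq_of_IsFiniteMeasure fun f => ?_
  rw [integral_map hVm f.continuous.measurable.aestronglyMeasurable,
    integral_map hUm f.continuous.measurable.aestronglyMeasurable]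
  refine tendsto_nhds_unique (hVl f) ((hUl f).congr fun n => ?_)
  exact ((hVU n).comp f.continuous.measurable).integral_eq.symm

variable {N : ℕ} {ε : ℝ} {Ω : Type*} [MeasurableSpace Ω] {P : Measure Ω}
  {X₀ : Ω → Config N} {ξ : Fin N → ℝ}

theorem exists_isVortexProcess (h : IsSingularPotential (liftGreen ε)) (ξ : Fin N → ℝ)
    (hX₀ : HasLaw X₀ volume P) : ∃ X : ℝ≥0 → Ω → Config N, IsVortexProcess ε ξ P X₀ X := by
  classical
  refine ⟨fun t ω => if hω : ∃ X, IsVortexSolution ε ξ (X₀ ω) X then hω.choose t else X₀ ω, ?_⟩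
  have h1 : ∀ᵐ x ∂(P.map X₀), ∃! X : ℝ≥0 → Config N, IsVortexSolution ε ξ x X := by
    rw [hX₀.map_eq]; exact ae_existsUnique_isVortexSolution h ξ
  filter_upwards [ae_of_ae_map hX₀.aemeasurable h1] with ω hω
  have hω' := hω.exists
  simp only [dif_pos hω']
  exact hω'.choose_spec

theorem IsVortexProcess.isStationaryProcess [IsProbabilityMeasure P] (h : IsSingularPotential (liftGreen ε))
    (hX₀ : HasLaw X₀ volume P) {X : ℝ≥0 → Ω → Config N} (hX : IsVortexProcess ε ξ P X₀ X) :
    IsStationaryProcess P X := by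
  have : ∀ M : ℕ, ∃ φ : ℝ → Lift N → Lift N, IsFlow (regField (liftGreen ε) ξ M) φ := fun M => by
    obtain ⟨K, B, hb⟩ := h.exists_isSolenoidal ξ M
    exact exists_isFlow hb.lipschitz hb.bound
  choose φ hφ using this
  intro m t s
  have lim : ∀ t : Fin m → ℝ≥0, ∀ᵐ ω ∂P, ∀ᶠ M : ℕ in atTop,
      (fun k => X (t k) ω) = fun k => torusFlow (φ M) (t k) (X₀ ω) := fun t => by
    filter_upwards [hX] with ω hω
    filter_upwards [eventually_all.2 fun k => hω.eventually_eq_torusFlow h hφ (t k)] with M hM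
    exact funext fun k => hM k _ le_rfl
  refine identDistrib_of_eventually_eq (lim fun k => t k + s) (lim t) fun M => ?_
  obtain ⟨K, B, hb⟩ := h.exists_isSolenoidal ξ (M : ℝ)
  have hmp := measurePreserving_torusFlow (hφ M) hb s
  -- Shifting time by `s` replaces the starting point by its image under a measure-preserving map;
  -- the group law then handles all times together.
  have h1 : IdentDistrib (fun ω => torusFlow (φ M) s (X₀ ω)) X₀ P P := by
    refine ⟨hmp.measurable.comp_aemeasurable hX₀.aemeasurable, hX₀.aemeasurable, ?_⟩
    have e := AEMeasurable.map_map_of_aemeasurable (g := torusFlow (φ M) s) (μ := P)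
      hmp.measurable.aemeasurable hX₀.aemeasurable
    rw [hX₀.map_eq, hmp.map_eq] at e
    rw [hX₀.map_eq]
    exact e.symm
  have h2 := h1.comp (u := fun x (k : Fin m) => torusFlow (φ M) (t k) x)
    (measurable_pi_lambda _ fun k => measurable_torusFlow (hφ M) hb (t k))
  simpa only [Function.comp_def, ← torusFlow_add (hφ M) hb, ← NNReal.coe_add] using h2

theorem IsVortexProcess.hasLaw [IsProbabilityMeasure P] (h : IsSingularPotential (liftGreen ε))
    (hX₀ : HasLaw X₀ volume P) {X : ℝ≥0 → Ω → Config N} (hX : IsVortexProcess ε ξ P X₀ X)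
    (t : ℝ≥0) : HasLaw (X t) volume P := by
  have h1 := (hX.isStationaryProcess h hX₀ 1 (fun _ => 0) t).comp
    (measurable_pi_apply (0 : Fin 1))
  simp only [Function.comp_def, zero_add] at h1
  have h2 : X 0 =ᵐ[P] X₀ := hX.mono fun ω hω => hω.init
  exact ⟨h1.aemeasurable_fst, by rw [h1.map_eq, Measure.map_congr h2, hX₀.map_eq]⟩

end VortexProcess

end PointVortex

namespace PointVortex

/-! ### Radial heat integrals. -/

section HeatMoment

/-- The heat integral `∫₀¹ u^{s-2-j} exp (-r/(4u)) du`. -/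
noncomputable def heatMoment (s : ℝ) (j : ℕ) (r : ℝ) : ℝ :=
  ∫ u in Set.Ioc (0 : ℝ) 1, u ^ (s - 2 - j) * Real.exp (-r / (4 * u))

variable {s : ℝ}

theorem exp_neg_le_factorial_div_pow {z : ℝ} (hz : 0 < z) (k : ℕ) :
    Real.exp (-z) ≤ k.factorial / z ^ k := by
  have h := Real.pow_div_factorial_le_exp z hz.le k
  have hk : (0 : ℝ) < k.factorial := by exact_mod_cast k.factorial_pos
  rw [div_le_iff₀ hk] at h
  rw [Real.exp_neg, le_div_iff₀ (pow_pos hz k), inv_mul_le_iff₀ (Real.exp_pos z)]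
  exact h

/-- The exponential gains `u ^ k`, which for `k ≥ j + 2` absorbs the negative power of `u ≤ 1`.
Larger `k` buys decay in `r`. -/
theorem rpow_mul_exp_neg_div_le (hs : 0 ≤ s) {j k : ℕ} (hk : j + 2 ≤ k) {r u : ℝ} (hr : 0 < r)
    (hu : u ∈ Set.Ioc (0 : ℝ) 1) :
    u ^ (s - 2 - j) * Real.exp (-r / (4 * u)) ≤ k.factorial * 4 ^ k / r ^ k := by
  have hu0 := hu.1
  have h1 := exp_neg_le_factorial_div_pow (z := r / (4 * u)) (by positivity) k
  rw [← neg_div] at h1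
  have hk' : (j : ℝ) + 2 ≤ k := by exact_mod_cast hk
  have h2 : u ^ (s - 2 - j) * u ^ k ≤ 1 := by
    rw [← Real.rpow_natCast, ← Real.rpow_add hu0]
    exact Real.rpow_le_one hu0.le hu.2 (by linarith)
  calc u ^ (s - 2 - j) * Real.exp (-r / (4 * u))
      ≤ u ^ (s - 2 - j) * (k.factorial / (r / (4 * u)) ^ k) :=
        mul_le_mul_of_nonneg_left h1 (Real.rpow_nonneg hu0.le _)
    _ = (u ^ (s - 2 - j) * u ^ k) * (k.factorial * 4 ^ k / r ^ k) := by
        rw [div_pow, mul_pow]; field_simp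
    _ ≤ 1 * (k.factorial * 4 ^ k / r ^ k) := mul_le_mul_of_nonneg_right h2 (by positivity)
    _ = _ := one_mul _

theorem measurable_heatMoment_integrand (s : ℝ) (j : ℕ) (r : ℝ) :
    Measurable fun u : ℝ => u ^ (s - 2 - j) * Real.exp (-r / (4 * u)) := by fun_prop

theorem integrableOn_heatMoment (hs : 0 ≤ s) (j : ℕ) {r : ℝ} (hr : 0 < r) :
    IntegrableOn (fun u : ℝ => u ^ (s - 2 - j) * Real.exp (-r / (4 * u))) (Set.Ioc 0 1) := by
  refine Measure.integrableOn_of_bounded (M := (j + 2).factorial * 4 ^ (j + 2) / r ^ (j + 2))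
    (by simp) (measurable_heatMoment_integrand s j r).aestronglyMeasurable ?_
  filter_upwards [ae_restrict_mem measurableSet_Ioc] with u hu
  rw [Real.norm_of_nonneg (mul_nonneg (Real.rpow_nonneg hu.1.le _) (Real.exp_pos _).le)]
  exact rpow_mul_exp_neg_div_le hs le_rfl hr hu

theorem heatMoment_nonneg (s : ℝ) (j : ℕ) (r : ℝ) : 0 ≤ heatMoment s j r :=
  setIntegral_nonneg measurableSet_Ioc fun _ hu =>
    mul_nonneg (Real.rpow_nonneg hu.1.le _) (Real.exp_pos _).le

theorem heatMoment_le (hs : 0 ≤ s) {j k : ℕ} (hk : j + 2 ≤ k) {r : ℝ} (hr : 0 < r) :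
    heatMoment s j r ≤ k.factorial * 4 ^ k / r ^ k := by
  have := setIntegral_mono_on (integrableOn_heatMoment hs j hr)
    (integrableOn_const (C := (k.factorial * 4 ^ k / r ^ k : ℝ)) (by simp)) measurableSet_Ioc
    fun _ hu => rpow_mul_exp_neg_div_le hs hk hr hu
  simpa [heatMoment] using this

theorem hasDerivAt_heatMoment (hs : 0 ≤ s) (j : ℕ) {r : ℝ} (hr : 0 < r) :
    HasDerivAt (heatMoment s j) (-(1 / 4) * heatMoment s (j + 1) r) r := by
  have hr2 : 0 < r / 2 := by linarith
  have e : ∀ {u : ℝ} (x : ℝ), u ∈ Set.Ioc (0 : ℝ) 1 →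
      u ^ (s - 2 - j) * (Real.exp (-x / (4 * u)) * (-1 / (4 * u)))
        = -(1 / 4) * (u ^ (s - 2 - (j + 1 : ℕ)) * Real.exp (-x / (4 * u))) := by
    intro u x hu
    have : u ^ (s - 2 - (j + 1 : ℕ)) = u ^ (s - 2 - j) / u := by
      rw [← Real.rpow_sub_one hu.1.ne']; congr 1; push_cast; ring
    rw [this]
    have := hu.1.ne'
    field_simp
  have key := (hasDerivAt_integral_of_dominated_loc_of_deriv_le
    (μ := volume.restrict (Set.Ioc (0 : ℝ) 1))
    (F := fun r u => u ^ (s - 2 - j) * Real.exp (-r / (4 * u)))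
    (F' := fun r u => u ^ (s - 2 - j) * (Real.exp (-r / (4 * u)) * (-1 / (4 * u))))
    (bound := fun _ => (j + 1 + 2).factorial * 4 ^ (j + 1 + 2) / (r / 2) ^ (j + 1 + 2))
    (x₀ := r) (s := Set.Ioi (r / 2)) (Ioi_mem_nhds (by linarith))
    (.of_forall fun x => (measurable_heatMoment_integrand s j x).aestronglyMeasurable)
    (integrableOn_heatMoment hs j hr) (Measurable.aestronglyMeasurable (by fun_prop)) ?_
    (integrableOn_const (by simp)) ?_).2
  · rw [setIntegral_congr_fun measurableSet_Ioc fun u hu => e r hu, integral_const_mul] at key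
    exact key
  · filter_upwards [ae_restrict_mem measurableSet_Ioc] with u hu x hx
    have hx' : r / 2 < x := hx
    rw [e x hu, norm_mul, Real.norm_of_nonneg
      (mul_nonneg (Real.rpow_nonneg hu.1.le _) (Real.exp_pos _).le)]
    have h1 := rpow_mul_exp_neg_div_le hs (le_refl (j + 1 + 2)) (hr2.trans hx') hu
    have h2 : ((j + 1 + 2).factorial * 4 ^ (j + 1 + 2) / x ^ (j + 1 + 2) : ℝ)
        ≤ (j + 1 + 2).factorial * 4 ^ (j + 1 + 2) / (r / 2) ^ (j + 1 + 2) := by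
      gcongr
    have h3 : ‖(-(1 / 4) : ℝ)‖ ≤ 1 := by norm_num
    calc _ ≤ 1 * (u ^ (s - 2 - (j + 1 : ℕ)) * Real.exp (-x / (4 * u))) :=
          mul_le_mul_of_nonneg_right h3
            (mul_nonneg (Real.rpow_nonneg hu.1.le _) (Real.exp_pos _).le)
      _ ≤ _ := by rw [one_mul]; exact h1.trans h2
  · refine .of_forall fun u x _ => ?_
    have h1 : HasDerivAt (fun x : ℝ => -x / (4 * u)) (-1 / (4 * u)) x :=
      (hasDerivAt_neg x).div_const _
    exact (h1.exp).const_mul _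

end HeatMoment

/-! ### Distances to lattice points and summability. -/

section Lattice

/-- The lattice points of the plane. -/
def intVec (m : Fin 2 → ℤ) : Fin 2 → ℝ := fun k => m k

theorem proj_eq_zero_iff {y : Fin 2 → ℝ} : proj y = 0 ↔ ∃ m, y = intVec m := by
  constructor
  · intro h
    have : ∀ k, ∃ m : ℤ, (m : ℝ) = y k := fun k => by
      have h1 : ((y k : ℝ) : UnitAddCircle) = 0 := congrFun h k
      obtain ⟨m, hm⟩ := (AddCircle.coe_eq_zero_iff (1 : ℝ)).1 h1
      exact ⟨m, by simpa using hm⟩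
    choose m hm using this
    exact ⟨m, funext fun k => (hm k).symm⟩
  · rintro ⟨m, rfl⟩
    ext k
    exact (AddCircle.coe_eq_zero_iff (1 : ℝ)).2 ⟨m k, by simp [intVec]⟩

theorem norm_intVec (m : Fin 2 → ℤ) : ‖intVec m‖ = ‖m‖ := by
  rw [Pi.norm_def, Pi.norm_def]
  congr 2

theorem summable_inv_one_add_norm_pow :
    Summable fun m : Fin 2 → ℤ => ((1 + ‖m‖) ^ 3)⁻¹ := by
  refine Summable.of_norm_bounded_eventually
    (EisensteinSeries.summable_one_div_norm_rpow (k := 3) (by norm_num)) ?_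
  refine (Set.finite_singleton (0 : Fin 2 → ℤ)).subset fun m hm => ?_
  by_contra hne
  refine hm ?_
  have h0 : 0 < ‖m‖ := norm_pos_iff.2 hne
  change ‖((1 + ‖m‖) ^ 3)⁻¹‖ ≤ ‖m‖ ^ (-3 : ℝ)
  rw [Real.norm_of_nonneg (by positivity), Real.rpow_neg h0.le]
  norm_cast
  exact inv_anti₀ (by positivity) (by gcongr; linarith)

theorem exists_ball_separated {y₀ : Fin 2 → ℝ} (hy : proj y₀ ≠ 0) :
    ∃ δ : ℝ, 0 < δ ∧ ∃ A : ℝ, 0 < A ∧ ∀ y ∈ Metric.ball y₀ δ, ∀ m, δ ≤ ‖y - intVec m‖ ∧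
      1 + ‖m‖ ≤ A * ‖y - intVec m‖ := by
  obtain ⟨r, hr, hb⟩ := Metric.isOpen_iff.1 isOpen_setOf_proj_ne_zero y₀ hy
  refine ⟨r / 2, by positivity, 1 + (1 + ‖y₀‖ + r / 2) / (r / 2), by positivity, fun y hyb m => ?_⟩
  have h1 : r / 2 ≤ ‖y - intVec m‖ := by
    by_contra hlt
    refine hb (?_ : intVec m ∈ Metric.ball y₀ r) (proj_eq_zero_iff.2 ⟨m, rfl⟩)
    rw [not_le, ← dist_eq_norm] at hlt
    have := dist_triangle (intVec m) y y₀
    rw [dist_comm (intVec m) y] at this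
    rw [Metric.mem_ball] at hyb ⊢
    linarith
  refine ⟨h1, ?_⟩
  have h2 : ‖m‖ ≤ ‖y - intVec m‖ + ‖y‖ := by
    rw [← norm_intVec, norm_sub_rev]
    have := norm_add_le (intVec m - y) y
    rwa [sub_add_cancel] at this
  have h3 : ‖y‖ ≤ ‖y₀‖ + r / 2 := by
    have := norm_sub_norm_le y y₀
    rw [Metric.mem_ball, dist_eq_norm] at hyb
    linarith
  have h4 : 1 + ‖y₀‖ + r / 2 ≤ (1 + ‖y₀‖ + r / 2) / (r / 2) * ‖y - intVec m‖ := by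
    rw [div_mul_eq_mul_div, le_div_iff₀ (by positivity)]
    exact mul_le_mul_of_nonneg_left h1 (by positivity)
  linarith

end Lattice

/-! ### Smoothness of the periodised heat integrals off the lattice. -/

section LatticeSum

variable {s : ℝ}

/-- A monomial times a radial heat integral. -/
noncomputable def heatTerm (s : ℝ) (j a b : ℕ) (x : Fin 2 → ℝ) : ℝ :=
  x 0 ^ a * x 1 ^ b * heatMoment s j (x 0 ^ 2 + x 1 ^ 2)

theorem sq_norm_le (x : Fin 2 → ℝ) : ‖x‖ ^ 2 ≤ x 0 ^ 2 + x 1 ^ 2 := by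
  have h : ‖x‖ ≤ Real.sqrt (x 0 ^ 2 + x 1 ^ 2) := by
    refine (pi_norm_le_iff_of_nonneg (Real.sqrt_nonneg _)).2 fun k => Real.le_sqrt_of_sq_le ?_
    rw [Real.norm_eq_abs, sq_abs]
    fin_cases k
    · exact le_add_of_nonneg_right (sq_nonneg _)
    · exact le_add_of_nonneg_left (sq_nonneg _)
  calc ‖x‖ ^ 2 ≤ Real.sqrt (x 0 ^ 2 + x 1 ^ 2) ^ 2 := by gcongr
    _ = _ := Real.sq_sqrt (by positivity)

theorem abs_heatTerm_le (hs : 0 ≤ s) (j a b : ℕ) {δ : ℝ} (hδ : 0 < δ) :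
    ∃ C : ℝ, 0 ≤ C ∧ ∀ x : Fin 2 → ℝ, δ ≤ ‖x‖ → |heatTerm s j a b x| ≤ C / ‖x‖ ^ 3 := by
  -- With this `k` the total decay is `‖x‖ ^ (-(2j + 4 + a + b))`; three powers are kept for
  -- summation over the plane lattice and the rest is bounded by powers of `δ`.
  set k := j + 2 + (a + b) with hk
  refine ⟨k.factorial * 4 ^ k / δ ^ (2 * j + 1 + (a + b)), by positivity, fun x hx => ?_⟩
  have h0 : 0 < ‖x‖ := hδ.trans_le hx
  have hq : 0 < x 0 ^ 2 + x 1 ^ 2 := (pow_pos h0 2).trans_le (sq_norm_le x)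
  have h1 : |x 0 ^ a * x 1 ^ b| ≤ ‖x‖ ^ (a + b) := by
    rw [abs_mul, abs_pow, abs_pow, pow_add]
    gcongr
    · exact norm_le_pi_norm x 0
    · exact norm_le_pi_norm x 1
  have h2 : heatMoment s j (x 0 ^ 2 + x 1 ^ 2) ≤ k.factorial * 4 ^ k / (‖x‖ ^ 2) ^ k := by
    refine (heatMoment_le hs (k := k) (by omega) hq).trans ?_
    gcongr
    exact sq_norm_le x
  rw [heatTerm, abs_mul, abs_of_nonneg (heatMoment_nonneg _ _ _)]
  refine (mul_le_mul h1 h2 (heatMoment_nonneg _ _ _) (by positivity)).trans ?_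
  have e : ‖x‖ ^ (a + b) * (k.factorial * 4 ^ k / (‖x‖ ^ 2) ^ k)
      = k.factorial * 4 ^ k / ‖x‖ ^ (2 * j + 1 + (a + b)) / ‖x‖ ^ 3 := by
    have : (‖x‖ ^ 2) ^ k = ‖x‖ ^ (a + b) * (‖x‖ ^ (2 * j + 1 + (a + b)) * ‖x‖ ^ 3) := by
      rw [← pow_mul, ← pow_add, ← pow_add]; congr 1; omega
    rw [this]
    field_simp
  rw [e]
  gcongr

/-- The differential of `heatTerm` as a combination of such terms. -/
noncomputable def heatTermDeriv (T : ℕ → ℕ → ℕ → ℝ) (j a b : ℕ) : (Fin 2 → ℝ) →L[ℝ] ℝ :=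
  (a * T j (a - 1) b - 1 / 2 * T (j + 1) (a + 1) b) • ContinuousLinearMap.proj 0 +
    (b * T j a (b - 1) - 1 / 2 * T (j + 1) a (b + 1)) • ContinuousLinearMap.proj 1

/-- The family is closed under differentiation: the monomial loses a power, while the radial factor
raises `j` and contributes `-1/4 * 2 x k`. The truncated `a - 1` at `a = 0` is harmless because its
coefficient is `a`. -/
theorem hasFDerivAt_heatTerm (hs : 0 ≤ s) (j a b : ℕ) {x : Fin 2 → ℝ} (hx : x ≠ 0) :
    HasFDerivAt (heatTerm s j a b) (heatTermDeriv (fun j a b => heatTerm s j a b x) j a b) x := by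
  have hq : 0 < x 0 ^ 2 + x 1 ^ 2 := (pow_pos (norm_pos_iff.2 hx) 2).trans_le (sq_norm_le x)
  have p := fun k : Fin 2 => (ContinuousLinearMap.proj (R := ℝ) (φ := fun _ : Fin 2 => ℝ)
    k).hasFDerivAt (x := x)
  have p0 : HasFDerivAt (fun y : Fin 2 → ℝ => y 0) _ x := p 0
  have p1 : HasFDerivAt (fun y : Fin 2 → ℝ => y 1) _ x := p 1
  have hm := (hasDerivAt_heatMoment hs j hq).comp_hasFDerivAt x ((p0.pow 2).add (p1.pow 2))
  have := ((p0.pow a).mul (p1.pow b)).mul hm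
  refine HasFDerivAt.congr_fderiv this ?_
  ext v
  simp [heatTermDeriv, heatTerm]
  ring

/-- The periodisation of `heatTerm`. -/
noncomputable def latticeSum (s : ℝ) (j a b : ℕ) (y : Fin 2 → ℝ) : ℝ :=
  ∑' m : Fin 2 → ℤ, heatTerm s j a b (y - intVec m)

theorem exists_summable_bound (hs : 0 ≤ s) (j a b : ℕ) {y₀ : Fin 2 → ℝ} (hy : proj y₀ ≠ 0) :
    ∃ δ : ℝ, 0 < δ ∧ ∃ u : (Fin 2 → ℤ) → ℝ, Summable u ∧ ∀ y ∈ Metric.ball y₀ δ, ∀ m,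
      |heatTerm s j a b (y - intVec m)| ≤ u m := by
  obtain ⟨δ, hδ, A, hA, h⟩ := exists_ball_separated hy
  obtain ⟨C, hC, hb⟩ := abs_heatTerm_le hs j a b hδ
  refine ⟨δ, hδ, fun m => C * A ^ 3 * ((1 + ‖m‖) ^ 3)⁻¹,
    summable_inv_one_add_norm_pow.mul_left _, fun y hyb m => ?_⟩
  obtain ⟨h1, h2⟩ := h y hyb m
  have h0 : 0 < ‖y - intVec m‖ := hδ.trans_le h1
  refine (hb _ h1).trans ?_
  change C / ‖y - intVec m‖ ^ 3 ≤ C * A ^ 3 * ((1 + ‖m‖) ^ 3)⁻¹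
  rw [← div_eq_mul_inv, div_le_div_iff₀ (by positivity) (by positivity), mul_assoc, ← mul_pow]
  gcongr

theorem summable_heatTerm (hs : 0 ≤ s) (j a b : ℕ) {y : Fin 2 → ℝ} (hy : proj y ≠ 0) :
    Summable fun m : Fin 2 → ℤ => heatTerm s j a b (y - intVec m) := by
  obtain ⟨δ, hδ, u, hu, h⟩ := exists_summable_bound hs j a b hy
  exact Summable.of_norm_bounded hu fun m => h y (Metric.mem_ball_self hδ) m

theorem hasFDerivAt_latticeSum (hs : 0 ≤ s) (j a b : ℕ) {y : Fin 2 → ℝ} (hy : proj y ≠ 0) :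
    HasFDerivAt (latticeSum s j a b)
      (heatTermDeriv (fun j a b => latticeSum s j a b y) j a b) y := by
  obtain ⟨δ₁, hδ₁, u₁, hu₁, h₁⟩ := exists_summable_bound hs j (a - 1) b hy
  obtain ⟨δ₂, hδ₂, u₂, hu₂, h₂⟩ := exists_summable_bound hs (j + 1) (a + 1) b hy
  obtain ⟨δ₃, hδ₃, u₃, hu₃, h₃⟩ := exists_summable_bound hs j a (b - 1) hy
  obtain ⟨δ₄, hδ₄, u₄, hu₄, h₄⟩ := exists_summable_bound hs (j + 1) a (b + 1) hy
  obtain ⟨δ₅, hδ₅, A, hA, h₅⟩ := exists_ball_separated hy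
  set δ := min (min δ₁ δ₂) (min (min δ₃ δ₄) δ₅)
  have hδ : 0 < δ := by positivity
  have hball : ∀ z ∈ Metric.ball y δ, z ∈ Metric.ball y δ₁ ∧ z ∈ Metric.ball y δ₂ ∧
      z ∈ Metric.ball y δ₃ ∧ z ∈ Metric.ball y δ₄ ∧ z ∈ Metric.ball y δ₅ := fun z hz => by
    simp only [Metric.mem_ball, δ, lt_min_iff] at hz ⊢; tauto
  have hproj : ∀ k : Fin 2,
      ‖(ContinuousLinearMap.proj k : (Fin 2 → ℝ) →L[ℝ] ℝ)‖ ≤ 1 := fun k =>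
    ContinuousLinearMap.opNorm_le_bound _ zero_le_one fun v => by
      rw [one_mul]; exact norm_le_pi_norm v k
  have key := hasFDerivAt_tsum_of_isPreconnected (𝕜 := ℝ)
    (u := fun m => (a * u₁ m + 1 / 2 * u₂ m) + (b * u₃ m + 1 / 2 * u₄ m))
    (f := fun m z => heatTerm s j a b (z - intVec m))
    (f' := fun m z => heatTermDeriv (fun j a b => heatTerm s j a b (z - intVec m)) j a b)
    (((hu₁.mul_left _).add (hu₂.mul_left _)).add ((hu₃.mul_left _).add (hu₄.mul_left _)))
    Metric.isOpen_ball (convex_ball y δ).isPreconnected (fun m z hz => ?_) (fun m z hz => ?_)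
    (Metric.mem_ball_self hδ) (summable_heatTerm hs j a b hy) (Metric.mem_ball_self hδ)
  · refine HasFDerivAt.congr_fderiv key ?_
    have s1 := summable_heatTerm hs j (a - 1) b hy
    have s2 := summable_heatTerm hs (j + 1) (a + 1) b hy
    have s3 := summable_heatTerm hs j a (b - 1) hy
    have s4 := summable_heatTerm hs (j + 1) a (b + 1) hy
    have t1 := (s1.mul_left (a : ℝ)).sub (s2.mul_left (1 / 2 : ℝ))
    have t2 := (s3.mul_left (b : ℝ)).sub (s4.mul_left (1 / 2 : ℝ))
    simp only [heatTermDeriv, latticeSum]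
    rw [(t1.smul_const _).tsum_add (t2.smul_const _), t1.tsum_smul_const, t2.tsum_smul_const,
      (s1.mul_left (a : ℝ)).tsum_sub (s2.mul_left (1 / 2 : ℝ)),
      (s3.mul_left (b : ℝ)).tsum_sub (s4.mul_left (1 / 2 : ℝ)), tsum_mul_left, tsum_mul_left,
      tsum_mul_left, tsum_mul_left]
  · have hne : z - intVec m ≠ 0 := norm_pos_iff.1
      (hδ₅.trans_le (h₅ z (hball z hz).2.2.2.2 m).1)
    exact (hasFDerivAt_comp_sub (intVec m)).2 (hasFDerivAt_heatTerm hs j a b hne)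
  · obtain ⟨b1, b2, b3, b4, -⟩ := hball z hz
    have c1 := h₁ z b1 m
    have c2 := h₂ z b2 m
    have c3 := h₃ z b3 m
    have c4 := h₄ z b4 m
    have aux : ∀ (n : ℕ) {x y p q : ℝ}, |x| ≤ p → |y| ≤ q →
        |(n : ℝ) * x - 1 / 2 * y| ≤ n * p + 1 / 2 * q := fun n x y p q hx hy => by
      refine (abs_sub _ _).trans ?_
      rw [abs_mul, abs_mul, Nat.abs_cast, abs_of_pos (show (0 : ℝ) < 1 / 2 by norm_num)]
      gcongr
    refine (norm_add_le _ _).trans (add_le_add ?_ ?_)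
    · rw [norm_smul]
      exact (mul_le_of_le_one_right (norm_nonneg _) (hproj 0)).trans (aux a c1 c2)
    · rw [norm_smul]
      exact (mul_le_of_le_one_right (norm_nonneg _) (hproj 1)).trans (aux b c3 c4)

theorem contDiffOn_latticeSum (hs : 0 ≤ s) (n : ℕ) : ∀ j a b : ℕ,
    ContDiffOn ℝ n (latticeSum s j a b) {y | proj y ≠ 0} := by
  induction n with
  | zero =>
    intro j a b
    exact contDiffOn_zero.2 fun y hy =>
      (hasFDerivAt_latticeSum hs j a b hy).continuousAt.continuousWithinAt
  | succ n ih =>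
    intro j a b
    push_cast
    refine (contDiffOn_succ_iff_fderiv_of_isOpen isOpen_setOf_proj_ne_zero).2
      ⟨fun y hy => (hasFDerivAt_latticeSum hs j a b hy).differentiableAt.differentiableWithinAt,
        by simp, ?_⟩
    refine ContDiffOn.congr (f := fun y => heatTermDeriv (fun j a b => latticeSum s j a b y) j a b)
      ?_ fun y hy => (hasFDerivAt_latticeSum hs j a b hy).fderiv
    unfold heatTermDeriv
    exact (((contDiffOn_const.mul (ih _ _ _)).sub (contDiffOn_const.mul (ih _ _ _))).smul
      contDiffOn_const).add
      (((contDiffOn_const.mul (ih _ _ _)).sub (contDiffOn_const.mul (ih _ _ _))).smul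
      contDiffOn_const)

end LatticeSum

end PointVortex

namespace PointVortex

/-! ### The large-time part of the Green function is `C²`. -/

section SmoothPart

variable {s : ℝ}

/-- The linear phase `2π n·y`. -/
noncomputable def phase (n : Fin 2 → ℤ) : (Fin 2 → ℝ) →L[ℝ] ℝ :=
  (2 * Real.pi * n 0) • ContinuousLinearMap.proj 0 + (2 * Real.pi * n 1) • ContinuousLinearMap.proj 1

theorem phase_apply (n : Fin 2 → ℤ) (y : Fin 2 → ℝ) :
    phase n y = 2 * Real.pi * n 0 * y 0 + 2 * Real.pi * n 1 * y 1 := by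
  simp [phase]

theorem mFourier_proj (n : Fin 2 → ℤ) (y : Fin 2 → ℝ) :
    UnitAddTorus.mFourier n (proj y) =
      Complex.exp (2 * Real.pi * Complex.I * n 0 * y 0) *
        Complex.exp (2 * Real.pi * Complex.I * n 1 * y 1) := by
  change ∏ i, fourier (n i) ((y i : ℝ) : UnitAddCircle) = _
  rw [Fin.prod_univ_two, fourier_coe_apply, fourier_coe_apply]
  simp

theorem re_mFourier_proj (n : Fin 2 → ℤ) (y : Fin 2 → ℝ) :
    (UnitAddTorus.mFourier n (proj y)).re = Real.cos (phase n y) := by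
  rw [mFourier_proj, ← Complex.exp_add, ← Complex.exp_ofReal_mul_I_re, phase_apply]
  congr 2
  push_cast
  ring

theorem norm_phase_le (n : Fin 2 → ℤ) : ‖phase n‖ ≤ 4 * Real.pi * ‖n‖ := by
  refine ContinuousLinearMap.opNorm_le_bound _ (by positivity) fun y => ?_
  rw [phase_apply]
  have h : ∀ k, |2 * Real.pi * n k * y k| ≤ 2 * Real.pi * ‖n‖ * ‖y‖ := fun k => by
    rw [abs_mul, abs_mul, abs_of_pos Real.two_pi_pos]
    have h1 : |(n k : ℝ)| ≤ ‖n‖ := by simpa [Int.norm_eq_abs] using norm_le_pi_norm n k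
    have h2 : |y k| ≤ ‖y‖ := norm_le_pi_norm y k
    gcongr
  refine (norm_add_le _ _).trans ?_
  have h0 := h 0
  have h1 := h 1
  rw [Real.norm_eq_abs, Real.norm_eq_abs]
  linarith

theorem one_le_norm_of_ne_zero {n : Fin 2 → ℤ} (hn : n ≠ 0) : 1 ≤ ‖n‖ := by
  obtain ⟨k, hk⟩ := Function.ne_iff.1 hn
  refine le_trans ?_ (norm_le_pi_norm n k)
  rw [Int.norm_eq_abs]
  exact_mod_cast Int.one_le_abs hk

theorem symbolLam_sq (n : Fin 2 → ℤ) :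
    symbolLam n ^ 2 = 4 * Real.pi ^ 2 * ((n 0 : ℝ) ^ 2 + (n 1 : ℝ) ^ 2) := by
  rw [symbolLam, mul_pow, Real.sq_sqrt (by positivity)]
  ring

theorem sq_norm_le_symbolLam_sq (n : Fin 2 → ℤ) : ‖n‖ ^ 2 ≤ symbolLam n ^ 2 := by
  rw [symbolLam_sq, ← norm_intVec]
  refine (sq_norm_le (intVec n)).trans (le_mul_of_one_le_left (by positivity) ?_)
  have := Real.pi_gt_three
  nlinarith

/-- The part over large times of the integral representing the Green coefficient. -/
noncomputable def tailCoeff (s : ℝ) (n : Fin 2 → ℤ) : ℝ :=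
  if n = 0 then 0 else
    ∫ u in Set.Ioi (1 : ℝ), u ^ (s - 1) * Real.exp (-(symbolLam n ^ 2 * u))

theorem tailCoeff_nonneg (s : ℝ) (n : Fin 2 → ℤ) : 0 ≤ tailCoeff s n := by
  unfold tailCoeff
  split_ifs
  · exact le_rfl
  · exact setIntegral_nonneg measurableSet_Ioi fun u hu =>
      mul_nonneg (Real.rpow_nonneg (zero_le_one.trans (le_of_lt hu)) _) (Real.exp_pos _).le

/-- On `u ≥ 1` the power is at most one, leaving `exp(-L) / L ≤ 2 / L ^ 3`, and `(1 + ‖n‖) ^ 2 ≤ 4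
L`; thus `128 = 2 * 64`. Six powers leave room for two derivatives and summation. -/
theorem tailCoeff_le (hs : s ≤ 1) (n : Fin 2 → ℤ) :
    tailCoeff s n ≤ 128 * ((1 + ‖n‖) ^ 6)⁻¹ := by
  unfold tailCoeff
  split_ifs with hn
  · positivity
  have h1 := one_le_norm_of_ne_zero hn
  have hl := sq_norm_le_symbolLam_sq n
  set L := symbolLam n ^ 2
  have hL : 0 < L := lt_of_lt_of_le (by positivity) hl
  have hint : IntegrableOn (fun u : ℝ => Real.exp (-L * u)) (Set.Ioi 1) :=
    integrableOn_exp_mul_Ioi (by linarith) 1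
  have h2 : ∫ u in Set.Ioi (1 : ℝ), u ^ (s - 1) * Real.exp (-(L * u))
      ≤ ∫ u in Set.Ioi (1 : ℝ), Real.exp (-L * u) := by
    refine integral_mono_of_nonneg ?_ hint ?_
    · filter_upwards [ae_restrict_mem measurableSet_Ioi] with u hu
      exact mul_nonneg (Real.rpow_nonneg (zero_le_one.trans (le_of_lt hu)) _) (Real.exp_pos _).le
    · filter_upwards [ae_restrict_mem measurableSet_Ioi] with u hu
      rw [neg_mul]
      exact mul_le_of_le_one_left (Real.exp_pos _).le
        (Real.rpow_le_one_of_one_le_of_nonpos (le_of_lt hu) (by linarith))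
  rw [integral_exp_mul_Ioi (by linarith)] at h2
  have h3 := exp_neg_le_factorial_div_pow hL 2
  have h4 : (1 + ‖n‖) ^ 2 ≤ 4 * L := by nlinarith
  have h5 : (1 + ‖n‖) ^ 6 ≤ 64 * L ^ 3 := by
    calc (1 + ‖n‖) ^ 6 = ((1 + ‖n‖) ^ 2) ^ 3 := by ring
      _ ≤ (4 * L) ^ 3 := by gcongr
      _ = 64 * L ^ 3 := by ring
  refine h2.trans ?_
  rw [mul_one, neg_div_neg_eq]
  calc Real.exp (-L) / L ≤ ((2 : ℕ).factorial / L ^ 2) / L := by gcongr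
    _ = 128 / (64 * L ^ 3) := by simp [Nat.factorial]; field_simp; norm_num
    _ ≤ 128 / (1 + ‖n‖) ^ 6 := by gcongr
    _ = _ := div_eq_mul_inv _ _

/-- The smooth part of the Green function. -/
noncomputable def smoothPart (s : ℝ) (y : Fin 2 → ℝ) : ℝ :=
  ∑' n : Fin 2 → ℤ, tailCoeff s n * Real.cos (phase n y)

theorem norm_iteratedFDeriv_cos_phase_le (n : Fin 2 → ℤ) (k : ℕ) (y : Fin 2 → ℝ) :
    ‖iteratedFDeriv ℝ k (fun y => Real.cos (phase n y)) y‖ ≤ ‖phase n‖ ^ k := by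
  have := (phase n).iteratedFDeriv_comp_right (f := Real.cos) (n := k) Real.contDiff_cos y
    (i := k) le_rfl
  change ‖iteratedFDeriv ℝ k (Real.cos ∘ phase n) y‖ ≤ _
  rw [this]
  refine (ContinuousMultilinearMap.norm_compContinuousLinearMap_le _ _).trans ?_
  rw [norm_iteratedFDeriv_eq_norm_iteratedDeriv, Finset.prod_const, Finset.card_univ,
    Fintype.card_fin]
  exact mul_le_of_le_one_left (by positivity) (Real.abs_iteratedDeriv_cos_le_one k _)

theorem contDiff_smoothPart (hs : s ≤ 1) : ContDiff ℝ 2 (smoothPart s) := by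
  have hc : ∀ n, ContDiff ℝ ((2 : ℕ) : ℕ∞) fun y => Real.cos (phase n y) := fun n =>
    Real.contDiff_cos.comp (phase n).contDiff
  have := contDiff_tsum (𝕜 := ℝ) (N := ((2 : ℕ) : ℕ∞))
    (f := fun (n : Fin 2 → ℤ) y => tailCoeff s n * Real.cos (phase n y))
    (v := fun _ n => 128 * (16 ^ 2) * ((1 + ‖n‖) ^ 3)⁻¹)
    (fun n => contDiff_const.mul (hc n))
    (fun k hk => summable_inv_one_add_norm_pow.mul_left _) fun k n y hk => ?_
  · exact this
  have hk' : k ≤ 2 := by exact_mod_cast hk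
  have e : iteratedFDeriv ℝ k (tailCoeff s n • fun y => Real.cos (phase n y)) y
      = tailCoeff s n • iteratedFDeriv ℝ k (fun y => Real.cos (phase n y)) y :=
    iteratedFDeriv_const_smul_apply ((hc n).of_le (by exact_mod_cast hk)).contDiffAt
  change ‖iteratedFDeriv ℝ k (tailCoeff s n • fun y => Real.cos (phase n y)) y‖ ≤ _
  rw [e, norm_smul, Real.norm_of_nonneg (tailCoeff_nonneg s n)]
  have h1 : ‖phase n‖ ≤ 16 * (1 + ‖n‖) := by
    have := norm_phase_le n
    have := Real.pi_lt_four
    nlinarith [norm_nonneg n]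
  have h3 : 1 ≤ 16 * (1 + ‖n‖) := by linarith [norm_nonneg n]
  calc tailCoeff s n * ‖iteratedFDeriv ℝ k (fun y => Real.cos (phase n y)) y‖
      ≤ (128 * ((1 + ‖n‖) ^ 6)⁻¹) * (16 * (1 + ‖n‖)) ^ 2 :=
        mul_le_mul (tailCoeff_le hs n) ((norm_iteratedFDeriv_cos_phase_le n k y).trans
          ((pow_le_pow_left₀ (norm_nonneg _) h1 k).trans (pow_le_pow_right₀ h3 hk')))
          (norm_nonneg _) (by positivity)
    _ = 128 * 16 ^ 2 * ((1 + ‖n‖) ^ 4)⁻¹ := by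
        have : 1 + ‖n‖ ≠ 0 := by positivity
        field_simp
    _ ≤ 128 * 16 ^ 2 * ((1 + ‖n‖) ^ 3)⁻¹ := by
        gcongr
        · linarith [norm_nonneg n]
        · norm_num

theorem summable_tailCoeff (hs : s ≤ 1) : Summable (tailCoeff s) := by
  refine Summable.of_nonneg_of_le (tailCoeff_nonneg s) (fun n => (tailCoeff_le hs n).trans ?_)
    (summable_inv_one_add_norm_pow.mul_left 128)
  gcongr
  · linarith [norm_nonneg n]
  · norm_num

end SmoothPart

end PointVortex

namespace PointVortex

/-! ### Poisson summation for the heat kernel. -/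

section Poisson

theorem summable_exp_neg_mul_int_sq {c : ℝ} (hc : 0 < c) :
    Summable fun n : ℤ => Real.exp (-(c * (n : ℝ) ^ 2)) := by
  have h := (Real.summable_one_div_int_pow (p := 2)).2 one_lt_two
  refine Summable.of_norm_bounded_eventually (h.mul_left (1 / c)) ?_
  refine (Set.finite_singleton (0 : ℤ)).subset fun n hn => ?_
  by_contra hne
  refine hn ?_
  have h0 : (0 : ℝ) < (n : ℝ) ^ 2 := by have : (n : ℝ) ≠ 0 := by exact_mod_cast hne
                                        positivity
  have := exp_neg_le_factorial_div_pow (mul_pos hc h0) 1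
  change ‖Real.exp (-(c * (n : ℝ) ^ 2))‖ ≤ 1 / c * (1 / (n : ℝ) ^ 2)
  rw [Real.norm_of_nonneg (Real.exp_pos _).le]
  refine this.trans_eq ?_
  simp
  ring

theorem summable_exp_neg_sub_int_sq {c : ℝ} (hc : 0 < c) (y : ℝ) :
    Summable fun n : ℤ => Real.exp (-(c * (y - n) ^ 2)) := by
  refine Summable.of_nonneg_of_le (fun n => (Real.exp_pos _).le) (fun n => ?_)
    ((summable_exp_neg_mul_int_sq (half_pos hc)).mul_left (Real.exp (c * y ^ 2)))
  rw [← Real.exp_add, Real.exp_le_exp]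
  -- Completing the square: `(y - n)² + y² - n² / 2 = (2y - n)² / 2`.
  nlinarith [mul_nonneg hc.le (sq_nonneg (2 * y - n))]

/-- Poisson summation for the one-dimensional heat kernel. -/
theorem tsum_exp_mul_exp_eq {t : ℝ} (ht : 0 < t) (y : ℝ) :
    ∑' n : ℤ, (Real.exp (-(4 * Real.pi ^ 2 * t * (n : ℝ) ^ 2)) : ℂ) *
        Complex.exp (2 * Real.pi * Complex.I * n * y) =
      ((Real.sqrt (4 * Real.pi * t))⁻¹ : ℝ) *
        ∑' m : ℤ, (Real.exp (-(1 / (4 * t) * (y - m) ^ 2)) : ℂ) := by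
  have ha : 0 < 4 * Real.pi * t := by positivity
  have h := Complex.tsum_exp_neg_quadratic (a := ((4 * Real.pi * t : ℝ) : ℂ))
    (by rw [Complex.ofReal_re]; exact ha) (Complex.I * y)
  have hc : (1 : ℂ) / ((4 * Real.pi * t : ℝ) : ℂ) ^ (1 / 2 : ℂ)
      = ((Real.sqrt (4 * Real.pi * t))⁻¹ : ℝ) := by
    rw [Real.sqrt_eq_rpow, Complex.ofReal_inv, Complex.ofReal_cpow ha.le, one_div]
    norm_num
  rw [hc] at h
  refine Eq.trans (tsum_congr fun n => ?_) (h.trans ?_)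
  · rw [Complex.ofReal_exp, ← Complex.exp_add]
    congr 1
    push_cast
    ring
  · congr 1
    refine tsum_congr fun m => ?_
    rw [Complex.ofReal_exp]
    congr 1
    have hp : (Real.pi : ℂ) ≠ 0 := by exact_mod_cast Real.pi_ne_zero
    have ht' : (t : ℂ) ≠ 0 := by exact_mod_cast ht.ne'
    have hI : (m : ℂ) + Complex.I * (Complex.I * y) = m - y := by
      linear_combination (y : ℂ) * Complex.I_mul_I
    rw [hI]
    push_cast
    field_simp
    ring

theorem tsum_finTwo_mul {f g : ℤ → ℂ} (hf : Summable fun n => ‖f n‖)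
    (hg : Summable fun n => ‖g n‖) :
    ∑' n : Fin 2 → ℤ, f (n 0) * g (n 1) = (∑' n, f n) * ∑' n, g n := by
  rw [tsum_mul_tsum_of_summable_norm hf hg, ← (finTwoArrowEquiv ℤ).tsum_eq]
  rfl

theorem summable_finTwo_mul {f g : ℤ → ℂ} (hf : Summable fun n => ‖f n‖)
    (hg : Summable fun n => ‖g n‖) : Summable fun n : Fin 2 → ℤ => f (n 0) * g (n 1) :=
  (finTwoArrowEquiv ℤ).summable_iff.2 (summable_mul_of_summable_norm hf hg)

/-- The heat factor at a frequency. -/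
theorem exp_neg_mul_symbolLam_sq (t : ℝ) (n : Fin 2 → ℤ) :
    Real.exp (-t * symbolLam n ^ 2) = Real.exp (-(4 * Real.pi ^ 2 * t * (n 0 : ℝ) ^ 2)) *
      Real.exp (-(4 * Real.pi ^ 2 * t * (n 1 : ℝ) ^ 2)) := by
  rw [← Real.exp_add, symbolLam_sq]
  congr 1
  ring

theorem summable_exp_neg_mul_symbolLam_sq {t : ℝ} (ht : 0 < t) :
    Summable fun n : Fin 2 → ℤ => Real.exp (-t * symbolLam n ^ 2) := by
  have h := summable_exp_neg_mul_int_sq (c := 4 * Real.pi ^ 2 * t) (by positivity)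
  have := (finTwoArrowEquiv ℤ).summable_iff.2 (summable_mul_of_summable_norm h.norm h.norm)
  exact this.congr fun n => (exp_neg_mul_symbolLam_sq t n).symm

/-- Poisson summation for the heat kernel of the torus. -/
theorem tsum_exp_mul_cos_eq {t : ℝ} (ht : 0 < t) (y : Fin 2 → ℝ) :
    ∑' n : Fin 2 → ℤ, Real.exp (-t * symbolLam n ^ 2) * Real.cos (phase n y) =
      (4 * Real.pi * t)⁻¹ * ∑' m : Fin 2 → ℤ,
        Real.exp (-((y - intVec m) 0 ^ 2 + (y - intVec m) 1 ^ 2) / (4 * t)) := by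
  have hF : ∀ k : Fin 2, Summable fun n : ℤ =>
      ‖(Real.exp (-(4 * Real.pi ^ 2 * t * (n : ℝ) ^ 2)) : ℂ) *
        Complex.exp (2 * Real.pi * Complex.I * n * y k)‖ := fun k => by
    refine (summable_exp_neg_mul_int_sq (c := 4 * Real.pi ^ 2 * t) (by positivity)).congr
      fun n => ?_
    have : (2 * Real.pi * Complex.I * n * y k : ℂ) = (2 * Real.pi * n * y k : ℝ) * Complex.I := by
      push_cast; ring
    rw [norm_mul, this, Complex.norm_exp_ofReal_mul_I, mul_one, Complex.norm_real,
      Real.norm_of_nonneg (Real.exp_pos _).le]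
  have hG : ∀ k : Fin 2, Summable fun m : ℤ =>
      ‖(Real.exp (-(1 / (4 * t) * (y k - m) ^ 2)) : ℂ)‖ := fun k => by
    refine (summable_exp_neg_sub_int_sq (c := 1 / (4 * t)) (by positivity) (y k)).congr
      fun n => ?_
    rw [Complex.norm_real, Real.norm_of_nonneg (Real.exp_pos _).le]
  have h1 := tsum_finTwo_mul (hF 0) (hF 1)
  have h2 := tsum_finTwo_mul (hG 0) (hG 1)
  have hs := summable_finTwo_mul (hF 0) (hF 1)
  have e1 : ∀ n : Fin 2 → ℤ, Real.exp (-t * symbolLam n ^ 2) * Real.cos (phase n y) =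
      Complex.re (((Real.exp (-(4 * Real.pi ^ 2 * t * (n 0 : ℝ) ^ 2)) : ℂ) *
        Complex.exp (2 * Real.pi * Complex.I * n 0 * y 0)) *
        ((Real.exp (-(4 * Real.pi ^ 2 * t * (n 1 : ℝ) ^ 2)) : ℂ) *
        Complex.exp (2 * Real.pi * Complex.I * n 1 * y 1))) := fun n => by
    rw [mul_mul_mul_comm, ← mFourier_proj, ← Complex.ofReal_mul, Complex.re_ofReal_mul,
      re_mFourier_proj, exp_neg_mul_symbolLam_sq]
  rw [tsum_congr e1, ← Complex.re_tsum hs, h1, tsum_exp_mul_exp_eq ht, tsum_exp_mul_exp_eq ht,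
    mul_mul_mul_comm, ← h2, ← Complex.ofReal_mul, Complex.re_ofReal_mul]
  congr 1
  · rw [← mul_inv, Real.mul_self_sqrt (by positivity)]
  · simp_rw [← Complex.ofReal_mul]
    rw [← Complex.ofReal_tsum, Complex.ofReal_re]
    refine tsum_congr fun m => ?_
    rw [← Real.exp_add]
    congr 1
    simp only [Pi.sub_apply, intVec]
    field_simp
    ring

end Poisson

end PointVortex

namespace PointVortex

/-! ### Ewald splitting of the Green function. -/

section Ewald

variable {s : ℝ}

/-- The sum of the Gaussians `t⁻¹ exp (-|y-m|²/(4t))`, `4π` times the heat kernel of the torus. -/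
noncomputable def gaussSum (y : Fin 2 → ℝ) (t : ℝ) : ℝ :=
  ∑' m : Fin 2 → ℤ, t⁻¹ * Real.exp (-((y - intVec m) 0 ^ 2 + (y - intVec m) 1 ^ 2) / (4 * t))

/-- Off the lattice the Gaussian beats the prefactor `t⁻¹` as `t ↓ 0`. The range extends to `2`
because it is used at `t = u + τ` with `u, τ ≤ 1`. -/
theorem exists_gaussian_bound {y : Fin 2 → ℝ} (hy : proj y ≠ 0) :
    ∃ b : (Fin 2 → ℤ) → ℝ, Summable b ∧ ∀ t ∈ Set.Ioc (0 : ℝ) 2, ∀ m,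
      ‖t⁻¹ * Real.exp (-((y - intVec m) 0 ^ 2 + (y - intVec m) 1 ^ 2) / (4 * t))‖ ≤ b m := by
  obtain ⟨δ, hδ, A, hA, h⟩ := exists_ball_separated hy
  refine ⟨fun m => 64 * A ^ 4 * ((1 + ‖m‖) ^ 3)⁻¹, summable_inv_one_add_norm_pow.mul_left _,
    fun t ht m => ?_⟩
  obtain ⟨h1, h2⟩ := h y (Metric.mem_ball_self hδ) m
  have h0 : 0 < ‖y - intVec m‖ := hδ.trans_le h1
  have hq := sq_norm_le (y - intVec m)
  set r := (y - intVec m) 0 ^ 2 + (y - intVec m) 1 ^ 2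
  have hr : 0 < r := (by positivity : 0 < ‖y - intVec m‖ ^ 2).trans_le hq
  have ht0 := ht.1
  have h3 := exp_neg_le_factorial_div_pow (z := r / (4 * t)) (by positivity) 2
  rw [← neg_div] at h3
  rw [Real.norm_of_nonneg (by positivity)]
  have h4 : (1 + ‖m‖) ^ 4 ≤ A ^ 4 * r ^ 2 := by
    calc (1 + ‖m‖) ^ 4 ≤ (A * ‖y - intVec m‖) ^ 4 := by gcongr
      _ = A ^ 4 * (‖y - intVec m‖ ^ 2) ^ 2 := by ring
      _ ≤ A ^ 4 * r ^ 2 := by gcongr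
  calc t⁻¹ * Real.exp (-r / (4 * t)) ≤ t⁻¹ * ((2 : ℕ).factorial / (r / (4 * t)) ^ 2) := by gcongr
    _ = 32 * t / r ^ 2 := by simp [Nat.factorial]; field_simp; norm_num
    _ ≤ 64 / r ^ 2 := 
        div_le_div_of_nonneg_right (by linarith [ht.2]) (by positivity)
    _ ≤ 64 * A ^ 4 / (1 + ‖m‖) ^ 4 := by
        rw [div_le_div_iff₀ (by positivity) (by positivity)]
        nlinarith
    _ = 64 * A ^ 4 * ((1 + ‖m‖) ^ 4)⁻¹ := div_eq_mul_inv _ _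
    _ ≤ 64 * A ^ 4 * ((1 + ‖m‖) ^ 3)⁻¹ := by
        gcongr
        · linarith [norm_nonneg m]
        · norm_num

theorem continuousOn_gaussSum {y : Fin 2 → ℝ} (hy : proj y ≠ 0) :
    ContinuousOn (gaussSum y) (Set.Ioc 0 2) := by
  obtain ⟨b, hb, h⟩ := exists_gaussian_bound hy
  refine continuousOn_tsum (fun m t ht => ?_) hb fun m t ht => h t ht m
  have ht0 : t ≠ 0 := ht.1.ne'
  exact ((continuousAt_inv₀ ht0).mul (Real.continuous_exp.continuousAt.comp
    (continuousAt_const.div (by fun_prop) (by positivity)))).continuousWithinAt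

theorem exists_gaussSum_le {y : Fin 2 → ℝ} (hy : proj y ≠ 0) :
    ∃ C : ℝ, ∀ t ∈ Set.Ioc (0 : ℝ) 2, ‖gaussSum y t‖ ≤ C := by
  obtain ⟨b, hb, h⟩ := exists_gaussian_bound hy
  exact ⟨∑' m, b m, fun t ht => tsum_of_norm_bounded hb.hasSum (h t ht)⟩

theorem integrableOn_rpow_sub_one (hs : 0 < s) :
    IntegrableOn (fun u : ℝ => u ^ (s - 1)) (Set.Ioc 0 1) :=
  (intervalIntegrable_iff_integrableOn_Ioc_of_le zero_le_one).1
    (intervalIntegral.intervalIntegrable_rpow' (by linarith))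

theorem integral_rpow_sub_one (hs : 0 < s) : ∫ u in Set.Ioc (0 : ℝ) 1, u ^ (s - 1) = 1 / s := by
  rw [← intervalIntegral.integral_of_le zero_le_one, integral_rpow (.inl (by linarith))]
  simp [hs.ne']

theorem tendsto_integral_gaussSum (hs : 0 < s) {y : Fin 2 → ℝ} (hy : proj y ≠ 0) :
    Tendsto (fun τ : ℝ => ∫ u in Set.Ioc (0 : ℝ) 1, u ^ (s - 1) * gaussSum y (u + τ)) (𝓝[>] 0)
      (𝓝 (∫ u in Set.Ioc (0 : ℝ) 1, u ^ (s - 1) * gaussSum y u)) := by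
  obtain ⟨C, hC⟩ := exists_gaussSum_le hy
  have hτ : ∀ᶠ τ : ℝ in 𝓝[>] 0, τ ∈ Set.Ioc (0 : ℝ) 1 := Ioc_mem_nhdsGT zero_lt_one
  have hmem : ∀ {τ u : ℝ}, τ ∈ Set.Ioc (0 : ℝ) 1 → u ∈ Set.Ioc (0 : ℝ) 1 →
      u + τ ∈ Set.Ioc (0 : ℝ) 2 := fun hτ hu =>
    ⟨by linarith [hτ.1, hu.1], by linarith [hτ.2, hu.2]⟩
  refine tendsto_integral_filter_of_dominated_convergence (fun u => u ^ (s - 1) * C) ?_ ?_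
    ((integrableOn_rpow_sub_one hs).mul_const C) ?_
  · filter_upwards [hτ] with τ hτ
    refine AEStronglyMeasurable.mul (by fun_prop) ?_
    refine ContinuousOn.aestronglyMeasurable ?_ measurableSet_Ioc
    exact (continuousOn_gaussSum hy).comp (by fun_prop) fun u hu => hmem hτ hu
  · filter_upwards [hτ] with τ hτ
    filter_upwards [ae_restrict_mem measurableSet_Ioc] with u hu
    rw [norm_mul, Real.norm_of_nonneg (Real.rpow_nonneg hu.1.le _)]
    exact mul_le_mul_of_nonneg_left (hC _ (hmem hτ hu)) (Real.rpow_nonneg hu.1.le _)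
  · filter_upwards [ae_restrict_mem measurableSet_Ioc] with u hu
    refine Tendsto.const_mul _ ?_
    have hu2 : u ∈ Set.Ioo (0 : ℝ) 2 := ⟨hu.1, by linarith [hu.2]⟩
    have hc : ContinuousAt (gaussSum y) u :=
      (continuousOn_gaussSum hy).continuousAt (mem_of_superset (Ioo_mem_nhds hu2.1 hu2.2)
        Set.Ioo_subset_Ioc_self)
    refine hc.tendsto.comp (Tendsto.mono_left ?_ nhdsWithin_le_nhds)
    have : Tendsto (fun τ : ℝ => u + τ) (𝓝 0) (𝓝 (u + 0)) := by
      exact (continuous_const.add continuous_id).tendsto 0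
    simpa using this

theorem integral_gaussSum (hs : 0 ≤ s) {y : Fin 2 → ℝ} (hy : proj y ≠ 0) :
    ∫ u in Set.Ioc (0 : ℝ) 1, u ^ (s - 1) * gaussSum y u = latticeSum s 0 0 0 y := by
  have hpos : ∀ m, 0 < (y - intVec m) 0 ^ 2 + (y - intVec m) 1 ^ 2 := fun m => by
    refine (pow_pos (norm_pos_iff.2 fun h => hy ?_) 2).trans_le (sq_norm_le _)
    exact proj_eq_zero_iff.2 ⟨m, sub_eq_zero.1 h⟩
  have hsum := summable_heatTerm hs 0 0 0 hy
  have hn : ∀ m : Fin 2 → ℤ, ∫ u in Set.Ioc (0 : ℝ) 1, ‖u ^ (s - 2 - (0 : ℕ)) *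
      Real.exp (-((y - intVec m) 0 ^ 2 + (y - intVec m) 1 ^ 2) / (4 * u))‖
      = heatTerm s 0 0 0 (y - intVec m) := fun m => by
    rw [heatTerm, pow_zero, pow_zero, one_mul, one_mul, heatMoment]
    refine setIntegral_congr_fun measurableSet_Ioc fun u hu => ?_
    exact Real.norm_of_nonneg (mul_nonneg (Real.rpow_nonneg hu.1.le _) (Real.exp_pos _).le)
  have h := (hasSum_integral_of_summable_integral_norm (μ := volume.restrict (Set.Ioc (0 : ℝ) 1))
    (F := fun (m : Fin 2 → ℤ) u => u ^ (s - 2 - (0 : ℕ)) *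
      Real.exp (-((y - intVec m) 0 ^ 2 + (y - intVec m) 1 ^ 2) / (4 * u)))
    (fun m => integrableOn_heatMoment hs 0 (hpos m)) (hsum.congr fun m => (hn m).symm)).tsum_eq
  rw [latticeSum]
  simp only [heatTerm, pow_zero, one_mul]
  refine Eq.trans ?_ h.symm
  refine setIntegral_congr_fun measurableSet_Ioc fun u hu => ?_
  simp only [gaussSum]
  rw [← tsum_mul_left]
  refine tsum_congr fun m => ?_
  rw [← mul_assoc]
  congr 1
  rw [← div_eq_mul_inv, ← Real.rpow_sub_one hu.1.ne']
  congr 1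
  push_cast
  ring

/-- The part over small times of the integral representing the Green coefficient. -/
noncomputable def headCoeff (s : ℝ) (n : Fin 2 → ℤ) : ℝ :=
  ∫ u in Set.Ioc (0 : ℝ) 1, u ^ (s - 1) * Real.exp (-(symbolLam n ^ 2 * u))

theorem symbolLam_pos {n : Fin 2 → ℤ} (hn : n ≠ 0) : 0 < symbolLam n := by
  have h1 := one_le_norm_of_ne_zero hn
  have h2 := sq_norm_le_symbolLam_sq n
  have h3 : 0 ≤ symbolLam n := by unfold symbolLam; positivity
  refine h3.lt_of_ne fun h => ?_
  rw [← h] at h2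
  nlinarith

/-- This is the Gamma integral cut at `u = 1`. At `n = 0` the head equals `1 / s` although the Green
coefficient is zero, hence the correction. -/
theorem gamma_mul_greenCoeff {ε : ℝ} (hε : 0 < ε) (n : Fin 2 → ℤ) :
    Real.Gamma ((1 + ε) / 2) * greenCoeff ε n =
      headCoeff ((1 + ε) / 2) n + tailCoeff ((1 + ε) / 2) n -
        if n = 0 then 1 / ((1 + ε) / 2) else 0 := by
  have hs : 0 < (1 + ε) / 2 := by linarith
  by_cases hn : n = 0
  · subst hn
    have : headCoeff ((1 + ε) / 2) 0 = 1 / ((1 + ε) / 2) := by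
      rw [← integral_rpow_sub_one hs, headCoeff]
      simp [symbolLam]
    simp [greenCoeff, tailCoeff, this]
  · have hl := symbolLam_pos hn
    have h := Real.integral_rpow_mul_exp_neg_mul_Ioi hs (pow_pos hl 2)
    have hint : IntegrableOn (fun u : ℝ => u ^ ((1 + ε) / 2 - 1) *
        Real.exp (-(symbolLam n ^ 2 * u))) (Set.Ioi 0) := by
      by_contra hni
      rw [integral_undef hni] at h
      have := mul_pos (Real.rpow_pos_of_pos (one_div_pos.2 (pow_pos hl 2)) ((1 + ε) / 2))
        (Real.Gamma_pos_of_pos hs)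
      exact this.ne h
    rw [← Set.Ioc_union_Ioi_eq_Ioi (zero_le_one (α := ℝ)),
      setIntegral_union (Set.Ioc_disjoint_Ioi le_rfl) measurableSet_Ioi
        (hint.mono_set Set.Ioc_subset_Ioi_self)
        (hint.mono_set (Set.Ioi_subset_Ioi zero_le_one))] at h
    rw [if_neg hn, sub_zero, greenCoeff, if_neg hn, headCoeff, tailCoeff, if_neg hn, h, mul_comm]
    congr 1
    rw [one_div, Real.inv_rpow (by positivity), ← Real.rpow_neg (by positivity),
      ← Real.rpow_natCast, ← Real.rpow_mul hl.le]
    congr 1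
    push_cast
    ring

theorem headCoeff_nonneg (s : ℝ) (n : Fin 2 → ℤ) : 0 ≤ headCoeff s n :=
  setIntegral_nonneg measurableSet_Ioc fun _ hu =>
    mul_nonneg (Real.rpow_nonneg hu.1.le _) (Real.exp_pos _).le

theorem integrableOn_headCoeff (hs : 0 < s) (n : Fin 2 → ℤ) :
    IntegrableOn (fun u : ℝ => u ^ (s - 1) * Real.exp (-(symbolLam n ^ 2 * u))) (Set.Ioc 0 1) := by
  refine Integrable.mono (integrableOn_rpow_sub_one hs)
    (Measurable.aestronglyMeasurable (by fun_prop)) ?_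
  filter_upwards [ae_restrict_mem measurableSet_Ioc] with u hu
  rw [norm_mul]
  refine mul_le_of_le_one_right (norm_nonneg _) ?_
  rw [Real.norm_of_nonneg (Real.exp_pos _).le, Real.exp_le_one_iff, neg_nonpos]
  have := hu.1
  positivity

theorem headCoeff_le (hs : 0 < s) (n : Fin 2 → ℤ) : headCoeff s n ≤ 1 / s := by
  rw [← integral_rpow_sub_one hs]
  refine setIntegral_mono_on (integrableOn_headCoeff hs n) (integrableOn_rpow_sub_one hs)
    measurableSet_Ioc fun u hu => mul_le_of_le_one_right (Real.rpow_nonneg hu.1.le _) ?_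
  rw [Real.exp_le_one_iff, neg_nonpos]
  have := hu.1
  positivity

/-- The regularising factor merges with `exp(-λ² u)` into the heat factor at time `u + τ`, to which
Poisson summation applies; it also supplies the absolute summability needed to exchange sum and
integral. -/
theorem hasSum_headCoeff (hs : 0 < s) (y : Fin 2 → ℝ) {τ : ℝ} (hτ : 0 < τ) :
    HasSum (fun n => headCoeff s n * (Real.exp (-τ * symbolLam n ^ 2) * Real.cos (phase n y)))
      ((4 * Real.pi)⁻¹ * ∫ u in Set.Ioc (0 : ℝ) 1, u ^ (s - 1) * gaussSum y (u + τ)) := by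
  set e : (Fin 2 → ℤ) → ℝ := fun n => Real.exp (-τ * symbolLam n ^ 2) * Real.cos (phase n y)
  have he : ∀ n, |e n| ≤ Real.exp (-τ * symbolLam n ^ 2) := fun n => by
    rw [abs_mul, abs_of_pos (Real.exp_pos _)]
    exact mul_le_of_le_one_right (Real.exp_pos _).le (Real.abs_cos_le_one _)
  have hn : ∀ n : Fin 2 → ℤ, ∫ u in Set.Ioc (0 : ℝ) 1,
      ‖u ^ (s - 1) * Real.exp (-(symbolLam n ^ 2 * u)) * e n‖ = headCoeff s n * |e n| := fun n => by
    rw [headCoeff, ← integral_mul_const]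
    refine setIntegral_congr_fun measurableSet_Ioc fun u hu => ?_
    rw [norm_mul]
    congr 1
    exact Real.norm_of_nonneg (mul_nonneg (Real.rpow_nonneg hu.1.le _) (Real.exp_pos _).le)
  have h := hasSum_integral_of_summable_integral_norm
    (μ := volume.restrict (Set.Ioc (0 : ℝ) 1))
    (F := fun (n : Fin 2 → ℤ) u => u ^ (s - 1) * Real.exp (-(symbolLam n ^ 2 * u)) * e n)
    (fun n => (integrableOn_headCoeff hs n).mul_const _) (by
      simp_rw [hn]
      refine Summable.of_nonneg_of_le (fun n => mul_nonneg (headCoeff_nonneg s n) (abs_nonneg _))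
        (fun n => ?_) ((summable_exp_neg_mul_symbolLam_sq hτ).mul_left (1 / s))
      exact mul_le_mul (headCoeff_le hs n) (he n) (abs_nonneg _) (by positivity))
  simp_rw [integral_mul_const] at h
  refine (?_ : _ = (4 * Real.pi)⁻¹ * _) ▸ h
  rw [← integral_const_mul]
  symm
  refine setIntegral_congr_fun measurableSet_Ioc fun u hu => ?_
  have hu0 := hu.1
  have hp := tsum_exp_mul_cos_eq (t := u + τ) (by linarith) y
  have : ∀ n, u ^ (s - 1) * Real.exp (-(symbolLam n ^ 2 * u)) * e n =
      u ^ (s - 1) * (Real.exp (-(u + τ) * symbolLam n ^ 2) * Real.cos (phase n y)) := fun n => by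
    rw [mul_assoc, ← mul_assoc (Real.exp _), ← Real.exp_add]
    ring_nf
  simp only [this]
  rw [tsum_mul_left, hp, gaussSum, tsum_mul_left, mul_inv (4 * Real.pi) (u + τ)]
  ring

theorem tendsto_tailCoeff_sum (hs : s ≤ 1) (y : Fin 2 → ℝ) :
    Tendsto (fun τ : ℝ => ∑' n, tailCoeff s n *
      (Real.exp (-τ * symbolLam n ^ 2) * Real.cos (phase n y))) (𝓝[>] 0) (𝓝 (smoothPart s y)) := by
  refine tendsto_tsum_of_dominated_convergence (summable_tailCoeff hs) (fun n => ?_) ?_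
  · refine Tendsto.const_mul _ (Tendsto.mono_left ?_ nhdsWithin_le_nhds)
    have : Continuous fun τ : ℝ => Real.exp (-τ * symbolLam n ^ 2) * Real.cos (phase n y) := by
      fun_prop
    simpa using this.tendsto 0
  · filter_upwards [self_mem_nhdsWithin] with τ hτ n
    have hτ' : 0 < τ := hτ
    rw [norm_mul, Real.norm_of_nonneg (tailCoeff_nonneg s n)]
    refine mul_le_of_le_one_right (tailCoeff_nonneg s n) ?_
    rw [norm_mul, Real.norm_of_nonneg (Real.exp_pos _).le]
    refine mul_le_one₀ ?_ (norm_nonneg _) (Real.abs_cos_le_one _)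
    rw [Real.exp_le_one_iff, neg_mul, neg_nonpos]
    positivity

/-- Ewald's decomposition of the Green function. -/
theorem liftGreen_eq {ε : ℝ} (hε : 0 < ε) (hε1 : ε < 1) {y : Fin 2 → ℝ} (hy : proj y ≠ 0) :
    liftGreen ε y = (Real.Gamma ((1 + ε) / 2))⁻¹ * ((4 * Real.pi)⁻¹ *
      latticeSum ((1 + ε) / 2) 0 0 0 y + smoothPart ((1 + ε) / 2) y - 1 / ((1 + ε) / 2)) := by
  have hs : 0 < (1 + ε) / 2 := by linarith
  have hs1 : (1 + ε) / 2 ≤ 1 := by linarith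
  have hΓ := Real.Gamma_pos_of_pos hs
  refine Tendsto.limUnder_eq ?_
  rw [← integral_gaussSum hs.le hy]
  refine Tendsto.congr' ?_ ((((tendsto_integral_gaussSum hs hy).const_mul _).add
    (tendsto_tailCoeff_sum hs1 y)).sub_const _ |>.const_mul _)
  filter_upwards [self_mem_nhdsWithin] with τ hτ
  have h1 := hasSum_headCoeff hs y hτ
  have hsum : Summable fun n => tailCoeff ((1 + ε) / 2) n *
      (Real.exp (-τ * symbolLam n ^ 2) * Real.cos (phase n y)) := by
    have hτ' : 0 < τ := hτ
    refine Summable.of_norm_bounded (summable_tailCoeff hs1) fun n => ?_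
    rw [norm_mul, Real.norm_of_nonneg (tailCoeff_nonneg _ n)]
    refine mul_le_of_le_one_right (tailCoeff_nonneg _ n) ?_
    rw [norm_mul, Real.norm_of_nonneg (Real.exp_pos _).le]
    refine mul_le_one₀ ?_ (norm_nonneg _) (Real.abs_cos_le_one _)
    rw [Real.exp_le_one_iff, neg_mul, neg_nonpos]
    positivity
  have h3 : HasSum (fun n : Fin 2 → ℤ => if n = 0 then 1 / ((1 + ε) / 2) else 0)
      (1 / ((1 + ε) / 2)) := by
    convert hasSum_ite_eq (0 : Fin 2 → ℤ) (1 / ((1 + ε) / 2)) using 1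
  have h := ((h1.add hsum.hasSum).sub h3).mul_left (Real.Gamma ((1 + ε) / 2))⁻¹
  rw [← h.tsum_eq]
  refine tsum_congr fun n => ?_
  have hg := gamma_mul_greenCoeff hε n
  rw [re_mFourier_proj, mul_assoc (greenCoeff ε n), inv_mul_eq_iff_eq_mul₀ hΓ.ne',
    ← mul_assoc (Real.Gamma _), hg]
  by_cases hn : n = 0
  · subst hn
    simp [symbolLam, phase_apply]
  · simp [hn]
    ring

end Ewald

end PointVortex

namespace PointVortex

/-! ### The singularity of the Green function at the lattice. -/

section Singularity

variable {s : ℝ}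

theorem proj_ne_zero_of_norm_lt_one {y : Fin 2 → ℝ} (hy : y ≠ 0) (hy1 : ‖y‖ < 1) :
    proj y ≠ 0 := fun h => by
  obtain ⟨m, rfl⟩ := proj_eq_zero_iff.1 h
  rw [norm_intVec] at hy1
  refine hy1.not_ge (one_le_norm_of_ne_zero ?_)
  rintro rfl
  exact hy (funext fun k => by simp [intVec])

/-- Only `u ∈ (r, 2r]` is kept, an interval of length `r` where the exponential is at least
`exp(-1)`; `r < 1/2` keeps it inside `(0, 1]`. -/
theorem le_heatMoment (hs : 0 ≤ s) (hs1 : s < 1) {r : ℝ} (hr : r ∈ Set.Ioo (0 : ℝ) (1 / 2)) :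
    2 ^ (s - 2) * Real.exp (-1) * r ^ (s - 1) ≤ heatMoment s 0 r := by
  have h0 := hr.1
  have hsub : Set.Ioc r (2 * r) ⊆ Set.Ioc 0 1 := Set.Ioc_subset_Ioc h0.le (by linarith [hr.2])
  have hint := integrableOn_heatMoment hs 0 h0
  have h1 := setIntegral_ge_of_const_le_real (μ := volume) (s := Set.Ioc r (2 * r))
    (c := (2 * r) ^ (s - 2) * Real.exp (-1)) measurableSet_Ioc (by simp) (fun u hu => ?_)
    (hint.mono_set hsub)
  · have h2 := setIntegral_mono_set hint
      ((ae_restrict_mem measurableSet_Ioc).mono fun u hu =>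
        mul_nonneg (Real.rpow_nonneg hu.1.le _) (Real.exp_pos _).le) hsub.eventuallyLE
    refine le_trans (le_of_eq ?_) (h1.trans h2)
    rw [Measure.real, Real.volume_Ioc, ENNReal.toReal_ofReal (by linarith),
      Real.mul_rpow zero_le_two h0.le, show s - 1 = s - 2 + 1 by ring, Real.rpow_add_one h0.ne']
    ring
  · have hu0 : 0 < u := h0.trans hu.1
    refine mul_le_mul ?_ ?_ (Real.exp_pos _).le (Real.rpow_nonneg hu0.le _)
    · rw [Nat.cast_zero, sub_zero]
      exact Real.rpow_le_rpow_of_nonpos hu0 hu.2 (by linarith)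
    · rw [Real.exp_le_exp, neg_div, neg_le_neg_iff, div_le_one (by positivity)]
      linarith [hu.1]

theorem tendsto_heatMoment (hs : 0 ≤ s) (hs1 : s < 1) :
    Tendsto (heatMoment s 0) (𝓝[>] 0) atTop := by
  refine tendsto_atTop_mono' _ ?_ ((tendsto_rpow_neg_nhdsGT_zero
    (show s - 1 < 0 by linarith)).const_mul_atTop
    (show 0 < 2 ^ (s - 2) * Real.exp (-1) by positivity))
  filter_upwards [Ioo_mem_nhdsGT (show (0 : ℝ) < 1 / 2 by norm_num)] with r hr
  exact le_heatMoment hs hs1 hr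

theorem heatTerm_nonneg (s : ℝ) (j : ℕ) (x : Fin 2 → ℝ) : 0 ≤ heatTerm s j 0 0 x := by
  simpa [heatTerm] using heatMoment_nonneg s j _

theorem tendsto_latticeSum (hs : 0 ≤ s) (hs1 : s < 1) :
    Tendsto (latticeSum s 0 0 0) (𝓝[≠] 0) atTop := by
  have hq : Tendsto (fun y : Fin 2 → ℝ => y 0 ^ 2 + y 1 ^ 2) (𝓝[≠] 0) (𝓝[>] 0) := by
    refine tendsto_nhdsWithin_iff.2 ⟨Tendsto.mono_left ?_ nhdsWithin_le_nhds, ?_⟩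
    · have : Continuous fun y : Fin 2 → ℝ => y 0 ^ 2 + y 1 ^ 2 := by fun_prop
      simpa using this.tendsto 0
    · filter_upwards [self_mem_nhdsWithin] with y hy
      exact (pow_pos (norm_pos_iff.2 hy) 2).trans_le (sq_norm_le y)
  refine tendsto_atTop_mono' _ ?_ ((tendsto_heatMoment hs hs1).comp hq)
  filter_upwards [self_mem_nhdsWithin, nhdsWithin_le_nhds (Metric.ball_mem_nhds 0 one_pos)]
    with y hy hy1
  have hp := proj_ne_zero_of_norm_lt_one hy (mem_ball_zero_iff.1 hy1)
  have := (summable_heatTerm hs 0 0 0 hp).le_tsum 0 fun m _ => heatTerm_nonneg s 0 _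
  have h0 : intVec 0 = 0 := funext fun k => by simp [intVec]
  simpa [heatTerm, h0, latticeSum] using this

theorem exp_neg_le_two_mul_rpow {z p : ℝ} (hz : 0 < z) (hp : 0 ≤ p) (hp2 : p ≤ 2) :
    Real.exp (-z) ≤ 2 * z ^ (-p) := by
  rcases le_total z 1 with h | h
  · have h1 := Real.one_le_rpow_of_pos_of_le_one_of_nonpos hz h (neg_nonpos.2 hp)
    have h2 : Real.exp (-z) ≤ 1 := Real.exp_le_one_iff.2 (by linarith)
    linarith
  · have h1 := exp_neg_le_factorial_div_pow hz 2
    have h2 : z ^ (-2 : ℝ) ≤ z ^ (-p) := Real.rpow_le_rpow_of_exponent_le h (by linarith)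
    have h3 : z ^ (-2 : ℝ) = (z ^ 2)⁻¹ := by rw [Real.rpow_neg hz.le]; norm_cast
    rw [div_eq_mul_inv, ← h3] at h1
    norm_num [Nat.factorial] at h1
    linarith

/-- Trading the exponential for `(r / 4u) ^ (-p)` leaves `u ^ (s - 3 + p)`, integrable at zero
exactly when `p > 2 - s`. -/
theorem exists_heatMoment_one_le (hs : 0 ≤ s) {p : ℝ} (hp : 2 - s < p) (hp0 : 0 ≤ p)
    (hp2 : p ≤ 2) : ∃ C : ℝ, 0 ≤ C ∧ ∀ r, 0 < r → heatMoment s 1 r ≤ C * r ^ (-p) := by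
  have hint : IntegrableOn (fun u : ℝ => u ^ (s - 2 - (1 : ℕ) + p)) (Set.Ioc 0 1) :=
    (intervalIntegrable_iff_integrableOn_Ioc_of_le zero_le_one).1
      (intervalIntegral.intervalIntegrable_rpow' (by push_cast; linarith))
  refine ⟨2 * 4 ^ p * ∫ u in Set.Ioc (0 : ℝ) 1, u ^ (s - 2 - (1 : ℕ) + p),
    mul_nonneg (by positivity) (setIntegral_nonneg measurableSet_Ioc fun u hu =>
      Real.rpow_nonneg hu.1.le _), fun r hr => ?_⟩
  have := setIntegral_mono_on (integrableOn_heatMoment hs 1 hr)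
    (hint.const_mul (2 * 4 ^ p * r ^ (-p))) measurableSet_Ioc fun u hu => ?_
  · rw [integral_const_mul] at this
    refine this.trans_eq ?_
    ring
  · have hu0 := hu.1
    have h := exp_neg_le_two_mul_rpow (z := r / (4 * u)) (by positivity) hp0 hp2
    rw [← neg_div] at h
    refine (mul_le_mul_of_nonneg_left h (Real.rpow_nonneg hu0.le _)).trans_eq ?_
    rw [Real.rpow_neg (by positivity) p, Real.div_rpow hr.le (by positivity),
      Real.mul_rpow (by norm_num) hu0.le, Real.rpow_add hu0, Real.rpow_neg hr.le]
    field_simp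

theorem exists_latticeSum_bound (hs : 0 ≤ s) (j a b : ℕ) :
    ∃ C : ℝ, 0 ≤ C ∧ ∀ y : Fin 2 → ℝ, ‖y‖ < 3 / 4 →
      |latticeSum s j a b y| ≤ |heatTerm s j a b y| + C := by
  obtain ⟨C, hC, hb⟩ := abs_heatTerm_le hs j a b (show (0 : ℝ) < 1 / 4 by norm_num)
  have hsum := summable_inv_one_add_norm_pow.mul_left (512 * C)
  refine ⟨∑' m : Fin 2 → ℤ, 512 * C * ((1 + ‖m‖) ^ 3)⁻¹,
    tsum_nonneg fun m => by positivity, fun y hy => ?_⟩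
  rw [← Real.norm_eq_abs (latticeSum s j a b y)]
  refine tsum_of_norm_bounded (f := fun m : Fin 2 → ℤ => heatTerm s j a b (y - intVec m))
    ((hasSum_ite_eq (0 : Fin 2 → ℤ) |heatTerm s j a b y|).add hsum.hasSum) fun m => ?_
  by_cases hm : m = 0
  · have h0 : intVec 0 = 0 := funext fun k => by simp [intVec]
    subst hm
    rw [if_pos rfl, h0, sub_zero, Real.norm_eq_abs]
    exact le_add_of_nonneg_right (by positivity)
  · rw [if_neg hm, zero_add, Real.norm_eq_abs]
    have h1 := one_le_norm_of_ne_zero hm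
    have h2 : ‖m‖ ≤ ‖y - intVec m‖ + ‖y‖ := by
      rw [← norm_intVec, norm_sub_rev]
      have := norm_add_le (intVec m - y) y
      rwa [sub_add_cancel] at this
    -- With `d` the distance on the right, `‖y‖ < 3/4` gives `d ≥ 1/4`, so `1 + ‖m‖ ≤ d + 7/4 ≤ 8
    -- d`; the constant `512` is `8 ^ 3`.
    have h3 : 1 + ‖m‖ ≤ 8 * ‖y - intVec m‖ := by linarith
    refine (hb _ (by linarith)).trans ?_
    have h4 : (1 + ‖m‖) ^ 3 ≤ 512 * ‖y - intVec m‖ ^ 3 := by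
      calc (1 + ‖m‖) ^ 3 ≤ (8 * ‖y - intVec m‖) ^ 3 := by gcongr
        _ = _ := by ring
    have h5 : 0 < ‖y - intVec m‖ := by linarith
    rw [← div_eq_mul_inv, div_le_div_iff₀ (by positivity) (by positivity)]
    nlinarith

theorem exists_norm_fderiv_latticeSum_le (hs : 1 / 2 < s) (hs1 : s < 1) :
    ∃ C α : ℝ, 0 ≤ C ∧ 0 ≤ α ∧ α < 2 ∧ ∀ y : Fin 2 → ℝ, y ≠ 0 → ‖y‖ < 3 / 4 →
      ‖fderiv ℝ (latticeSum s 0 0 0) y‖ ≤ C * ‖y‖ ^ (-α) := by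
  have hs0 : 0 ≤ s := by linarith
  -- The gradient is of size `‖y‖ * ‖y‖ ^ (-2p)`, integrable in the plane when `p < 3/2`. The chosen
  -- `p` is the midpoint of `(2 - s, 3/2)`, which is nonempty because `s > 1/2`.
  obtain ⟨A, hA, hm⟩ := exists_heatMoment_one_le (p := (7 - 2 * s) / 4) hs0 (by linarith)
    (by linarith) (by linarith)
  obtain ⟨B, hB, h10⟩ := exists_latticeSum_bound hs0 1 1 0
  obtain ⟨B', hB', h01⟩ := exists_latticeSum_bound hs0 1 0 1
  refine ⟨A + B + B', (5 - 2 * s) / 2, by positivity, by linarith, by linarith, fun y hy hy1 => ?_⟩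
  have hp := proj_ne_zero_of_norm_lt_one hy (hy1.trans (by norm_num))
  have hy0 : 0 < ‖y‖ := norm_pos_iff.2 hy
  have hterm : ∀ k : Fin 2, |y k| * heatMoment s 1 (y 0 ^ 2 + y 1 ^ 2) ≤
      A * ‖y‖ ^ (-((5 - 2 * s) / 2)) := fun k => by
    have hq := sq_norm_le y
    have hq0 : 0 < y 0 ^ 2 + y 1 ^ 2 := (pow_pos hy0 2).trans_le hq
    have h1 : (y 0 ^ 2 + y 1 ^ 2) ^ (-((7 - 2 * s) / 4)) ≤ (‖y‖ ^ 2) ^ (-((7 - 2 * s) / 4)) :=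
      Real.rpow_le_rpow_of_nonpos (by positivity) hq (by linarith)
    calc |y k| * heatMoment s 1 (y 0 ^ 2 + y 1 ^ 2)
        ≤ ‖y‖ * (A * (‖y‖ ^ 2) ^ (-((7 - 2 * s) / 4))) :=
          mul_le_mul (norm_le_pi_norm y k) ((hm _ hq0).trans (mul_le_mul_of_nonneg_left h1 hA))
            (heatMoment_nonneg _ _ _) hy0.le
      _ = A * ‖y‖ ^ (-((5 - 2 * s) / 2)) := by
          rw [← Real.rpow_natCast, ← Real.rpow_mul hy0.le,
            show -((5 - 2 * s) / 2) = ((2 : ℕ) : ℝ) * (-((7 - 2 * s) / 4)) + 1 by push_cast; ring,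
            Real.rpow_add_one hy0.ne']
          ring
  have e10 : |heatTerm s 1 1 0 y| = |y 0| * heatMoment s 1 (y 0 ^ 2 + y 1 ^ 2) := by
    rw [heatTerm, pow_one, pow_zero, mul_one, abs_mul, abs_of_nonneg (heatMoment_nonneg _ _ _)]
  have e01 : |heatTerm s 1 0 1 y| = |y 1| * heatMoment s 1 (y 0 ^ 2 + y 1 ^ 2) := by
    rw [heatTerm, pow_one, pow_zero, one_mul, abs_mul, abs_of_nonneg (heatMoment_nonneg _ _ _)]
  have b10 := h10 y hy1
  have b01 := h01 y hy1
  rw [e10] at b10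
  rw [e01] at b01
  have t0 := hterm 0
  have t1 := hterm 1
  have hone : 1 ≤ ‖y‖ ^ (-((5 - 2 * s) / 2)) :=
    Real.one_le_rpow_of_pos_of_le_one_of_nonpos hy0 (by linarith) (by linarith)
  rw [(hasFDerivAt_latticeSum hs0 0 0 0 hp).fderiv]
  refine ContinuousLinearMap.opNorm_le_bound _ (by positivity) fun v => ?_
  have hv : ∀ k, |v k| ≤ ‖v‖ := norm_le_pi_norm v
  have e : heatTermDeriv (fun j a b => latticeSum s j a b y) 0 0 0 v =
      -(1 / 2) * (latticeSum s 1 1 0 y * v 0) + -(1 / 2) * (latticeSum s 1 0 1 y * v 1) := by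
    simp [heatTermDeriv]
    ring
  have hN := norm_nonneg v
  rw [e]
  calc ‖-(1 / 2) * (latticeSum s 1 1 0 y * v 0) + -(1 / 2) * (latticeSum s 1 0 1 y * v 1)‖
      ≤ 1 / 2 * (|latticeSum s 1 1 0 y| * ‖v‖) + 1 / 2 * (|latticeSum s 1 0 1 y| * ‖v‖) := by
        refine (norm_add_le _ _).trans (add_le_add ?_ ?_)
        · rw [norm_mul, norm_mul, Real.norm_eq_abs, abs_neg, abs_of_pos (by norm_num)]
          gcongr
          exacts [le_rfl, hv 0]
        · rw [norm_mul, norm_mul, Real.norm_eq_abs, abs_neg, abs_of_pos (by norm_num)]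
          gcongr
          exacts [le_rfl, hv 1]
    _ = (1 / 2 * (|latticeSum s 1 1 0 y| + |latticeSum s 1 0 1 y|)) * ‖v‖ := by ring
    _ ≤ ((A + B + B') * ‖y‖ ^ (-((5 - 2 * s) / 2))) * ‖v‖ := by
        refine mul_le_mul_of_nonneg_right ?_ hN
        nlinarith

theorem isSingularPotential_liftGreen {ε : ℝ} (hε : 0 < ε) (hε1 : ε < 1) :
    IsSingularPotential (liftGreen ε) := by
  have hs : 1 / 2 < (1 + ε) / 2 := by linarith
  have hs0 : 0 ≤ (1 + ε) / 2 := by linarith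
  have hs1 : (1 + ε) / 2 < 1 := by linarith
  have hH := contDiff_smoothPart hs1.le
  have hΓ : 0 < (Real.Gamma ((1 + ε) / 2))⁻¹ := inv_pos.2 (Real.Gamma_pos_of_pos (by linarith))
  have hπ : 0 < (4 * Real.pi)⁻¹ := by positivity
  have heq : ∀ {y}, proj y ≠ 0 → liftGreen ε =ᶠ[𝓝 y] fun y => (Real.Gamma ((1 + ε) / 2))⁻¹ *
      ((4 * Real.pi)⁻¹ * latticeSum ((1 + ε) / 2) 0 0 0 y + smoothPart ((1 + ε) / 2) y -
        1 / ((1 + ε) / 2)) := fun hy => by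
    filter_upwards [isOpen_setOf_proj_ne_zero.mem_nhds hy] with z hz
    exact liftGreen_eq hε hε1 hz
  refine ⟨fun y z h => by rw [liftGreen, h, liftGreen], fun y => ?_, fun y hy => ?_, ?_, ?_⟩
  · simp only [liftGreen, green, re_mFourier_proj, map_neg, Real.cos_neg]
  · refine ContDiffAt.congr_of_eventuallyEq ?_ (heq hy)
    have hL : ContDiffAt ℝ 2 (latticeSum ((1 + ε) / 2) 0 0 0) y :=
      (contDiffOn_latticeSum hs0 2 0 0 0).contDiffAt (isOpen_setOf_proj_ne_zero.mem_nhds hy)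
    exact contDiffAt_const.mul
      (((contDiffAt_const.mul hL).add hH.contDiffAt).sub contDiffAt_const)
  · have h1 := ((tendsto_latticeSum hs0 hs1).const_mul_atTop hπ).atTop_add
      ((hH.continuous.tendsto 0).mono_left nhdsWithin_le_nhds)
    have h2 := (tendsto_atTop_add_const_right _ (-(1 / ((1 + ε) / 2))) h1).const_mul_atTop hΓ
    refine h2.congr' ?_
    filter_upwards [self_mem_nhdsWithin, nhdsWithin_le_nhds (Metric.ball_mem_nhds 0 one_pos)]
      with y hy hy1
    rw [liftGreen_eq hε hε1 (proj_ne_zero_of_norm_lt_one hy (mem_ball_zero_iff.1 hy1)),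
      ← sub_eq_add_neg]
  · obtain ⟨C, α, hC, hα, hα2, hb⟩ := exists_norm_fderiv_latticeSum_le hs hs1
    obtain ⟨D, hD⟩ := (isCompact_closedBall (0 : Fin 2 → ℝ) 1).exists_bound_of_continuousOn
      (hH.continuous_fderiv (by norm_num)).continuousOn
    -- The ball of radius `3/4` contains the cell, and `0` is the only lattice point in it.
    have hint : IntegrableOn (fderiv ℝ (liftGreen ε)) (Metric.ball 0 (3 / 4)) := by
      refine integrableOn_ball_of_norm_le_rpow (C := (Real.Gamma ((1 + ε) / 2))⁻¹ *
        ((4 * Real.pi)⁻¹ * C + D)) (α := α) (by simp) (by simpa using hα2) ?_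
        (measurable_fderiv ℝ _).aestronglyMeasurable
      filter_upwards [ae_restrict_mem measurableSet_ball,
        ae_restrict_of_ae (compl_mem_ae_iff.2 (measure_singleton (0 : Fin 2 → ℝ)))] with y hy hy0
      have hy1 : ‖y‖ < 3 / 4 := mem_ball_zero_iff.1 hy
      have hne : y ≠ 0 := hy0
      have hp := proj_ne_zero_of_norm_lt_one hne (hy1.trans (by norm_num))
      have hL := (hasFDerivAt_latticeSum hs0 0 0 0 hp).differentiableAt
      have hS := (hH.differentiable (by norm_num)) y
      have hone : 1 ≤ ‖y‖ ^ (-α) :=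
        Real.one_le_rpow_of_pos_of_le_one_of_nonpos (norm_pos_iff.2 hne) (by linarith) (by linarith)
      have hDy := hD y (mem_closedBall_zero_iff.2 (by linarith))
      have hD0 : 0 ≤ D := (norm_nonneg _).trans hDy
      have hD' : HasFDerivAt (fun y => (Real.Gamma ((1 + ε) / 2))⁻¹ *
          ((4 * Real.pi)⁻¹ * latticeSum ((1 + ε) / 2) 0 0 0 y + smoothPart ((1 + ε) / 2) y -
            1 / ((1 + ε) / 2))) _ y :=
        (((hL.hasFDerivAt.const_mul _).add hS.hasFDerivAt).sub_const _).const_mul _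
      rw [(heq hp).fderiv_eq, hD'.fderiv, norm_smul, Real.norm_of_nonneg hΓ.le, mul_assoc]
      refine mul_le_mul_of_nonneg_left ((norm_add_le _ _).trans ?_) hΓ.le
      rw [norm_smul, Real.norm_of_nonneg hπ.le, add_mul, mul_assoc]
      refine add_le_add (mul_le_mul_of_nonneg_left (hb y hne hy1) hπ.le) ?_
      exact hDy.trans (le_mul_of_one_le_right hD0 hone)
    refine lt_of_le_of_lt (lintegral_mono_set fun y hy => ?_) hint.2
    exact mem_ball_zero_iff.2 ((norm_le_of_mem_cell hy).trans_lt (by norm_num))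

end Singularity

end PointVortex

/-! ### The theorem. -/

theorem mainTheorem4 (ε : ℝ) (hε : 0 < ε) (hε1 : ε < 1) (N : ℕ) (ξ : Fin N → ℝ) :
    (∀ᵐ x₀ ∂(volume : Measure (PointVortex.Config N)), x₀ ∈ (PointVortex.diagonal N)ᶜ →
      ∃! X : ℝ≥0 → PointVortex.Config N, PointVortex.IsVortexSolution ε ξ x₀ X) ∧
    ∀ (Ω : Type*) [MeasurableSpace Ω] (P : Measure Ω) [IsProbabilityMeasure P]
      (X₀ : Ω → PointVortex.Config N), HasLaw X₀ volume P →
      (∃ X : ℝ≥0 → Ω → PointVortex.Config N, PointVortex.IsVortexProcess ε ξ P X₀ X) ∧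
      ∀ X : ℝ≥0 → Ω → PointVortex.Config N, PointVortex.IsVortexProcess ε ξ P X₀ X →
        PointVortex.IsStationaryProcess P X ∧ ∀ t : ℝ≥0, HasLaw (X t) volume P := by
  have h := PointVortex.isSingularPotential_liftGreen hε hε1
  refine ⟨?_, fun Ω _ P _ X₀ hX₀ => ⟨PointVortex.exists_isVortexProcess h ξ hX₀, fun X hX =>
    ⟨hX.isStationaryProcess h hX₀, fun t => hX.hasLaw h hX₀ t⟩⟩⟩
  filter_upwards [PointVortex.ae_existsUnique_isVortexSolution h ξ] with x hx _ using hx
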